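/- A (rectilinear) angle sequence of length $n$ is a sequence $S=(s_1,\dots,s_n)$ of left turns $\mathtt L$ ($+90^\circ$) and right turns $\mathtt R$ ($-90^\circ$). A polygon $P$ realizes $S$ if $P$ is a simple rectilinear polygon with $n$ vertices, all of them points of the integer grid, and the turns at the vertices of $P$, in the order in which some counterclockwise walk along its boundary meets them, are $s_1,\dots,s_n$. A rectilinear polygon is $xy$-monotone if its boundary splits into two $x$-monotone chains and also into two $y$-monotone chains; $S$ is $xy$-monotone if it is realized by an $xy$-monotone polygon. The area of a polygon is the number of grid cells in its interior; its bounding box is the smallest enclosing axis-parallel rectangle. Up to rotation, an $xy$-monotone angle sequence has the form $\mathtt L(\mathtt{LR})^{t_1}\,\mathtt L(\mathtt{LR})^{t_2}\,\mathtt L(\mathtt{LR})^{t_3}\,\mathtt L(\mathtt{LR})^{t_4}$; the four blocks $(\mathtt{LR})^{t_i}$ are its stair sequences, and $t_1,\dots,t_4\ge 0$ are their numbers of reflex vertices. **Theorem.** Running times refer to a unit-cost random access machine with integer addition, subtraction, multiplication and division and with words of $O(\log n)$ bits. Consider either of the objectives (i) area of the bounding box, (ii) area. 1. There is an algorithm that,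 given an $xy$-monotone angle sequence $S$ of length $n$, finds in $O(n)$ time a polygon that realizes $S$ and has minimum objective value among all polygons that realize $S$. 2. There is an algorithm that, given only the numbers $t_1,t_2,t_3,t_4$ of reflex vertices of the four stair sequences of an $xy$-monotone angle sequence $S$, computes in $O(1)$ time the minimum objective value among all polygons that realize $S$. -/

import Mathlib

/-! ### Rectilinear angle sequences and polygons on the integer grid -/

/-- A turn of a counterclockwise walk: a left turn (`+90°`) or a right turn (`-90°`). -/
inductive Turn : Type
  | left : Turn
  | right : Turn

/-- A closed polygonal curve with `n` vertices on the integer grid, given by its vertices in the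
order in which a walk along the curve meets them; the vertex after `i` is `finRotate n i`. -/
abbrev GridCycle (n : ℕ) : Type := Fin n → ℤ × ℤ

namespace GridCycle

variable {n : ℕ}

/-- The vertex that follows vertex `i` on the walk. -/
def succVertex (P : GridCycle n) (i : Fin n) : ℤ × ℤ := P (finRotate n i)

/-- The vertex that precedes vertex `i` on the walk. -/
def predVertex (P : GridCycle n) (i : Fin n) : ℤ × ℤ := P ((finRotate n).symm i)

/-- The grid points of the closed edge from vertex `i` to the next vertex. The edges considered are
axis-parallel with integer endpoints, so that this is the order interval between the endpoints;
two such segments of the plane meet if and only if they share a grid point. -/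
def edge (P : GridCycle n) (i : Fin n) : Set (ℤ × ℤ) := Set.uIcc (P i) (P.succVertex i)

/-- `P` is (the vertex sequence of) a simple rectilinear polygon: all edges are axis-parallel and of
positive length, consecutive edges share only their common endpoint, and other pairs of edges are
disjoint. -/
structure IsSimpleRectilinear (P : GridCycle n) : Prop where
  three_le : 3 ≤ n
  ne_succ : ∀ i, P i ≠ P.succVertex i
  axis_parallel : ∀ i, (P i).1 = (P.succVertex i).1 ∨ (P i).2 = (P.succVertex i).2
  consecutive : ∀ i, P.edge i ∩ P.edge (finRotate n i) = {P.succVertex i}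
  nonconsecutive : ∀ i j, j ≠ i → j ≠ finRotate n i → i ≠ finRotate n j →
    Disjoint (P.edge i) (P.edge j)

/-- The cross product of the edge that enters vertex `i` and the edge that leaves it: positive for a
left turn, negative for a right turn. -/
def cross (P : GridCycle n) (i : Fin n) : ℤ :=
  ((P i).1 - (P.predVertex i).1) * ((P.succVertex i).2 - (P i).2) -
    ((P i).2 - (P.predVertex i).2) * ((P.succVertex i).1 - (P i).1)

/-- The orientation test for a simple polygon: the walk is counterclockwise if and only if it turns
left at a lowest vertex. (For a rectilinear polygon all lowest vertices are convex.) -/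
def IsCounterclockwise (P : GridCycle n) : Prop :=
  ∀ i, (∀ j, (P i).2 ≤ (P j).2) → 0 < P.cross i

/-- The walk makes turn `s` at vertex `i`. -/
def HasTurn (P : GridCycle n) (i : Fin n) : Turn → Prop
  | Turn.left => 0 < P.cross i
  | Turn.right => P.cross i < 0

/-- `P` is a simple rectilinear polygon, listed along a counterclockwise walk whose turns form the
angle sequence `S`. -/
structure Realizes (P : GridCycle n) (S : Fin n → Turn) : Prop where
  simple : P.IsSimpleRectilinear
  ccw : P.IsCounterclockwise
  turns : ∀ i, P.HasTurn i (S i)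

/-- The cyclic sequence `f` splits into one weakly increasing and one weakly decreasing chain. -/
def SplitsIntoTwoChains (f : Fin n → ℤ) : Prop :=
  ∃ (i : Fin n) (m : ℕ),
    (∀ k, k < m → f ((finRotate n)^[k] i) ≤ f ((finRotate n)^[k + 1] i)) ∧
    (∀ k, m ≤ k → k < n → f ((finRotate n)^[k + 1] i) ≤ f ((finRotate n)^[k] i))

/-- The boundary splits into two `x`-monotone chains, and also into two `y`-monotone chains. -/
def IsXYMonotone (P : GridCycle n) : Prop :=
  SplitsIntoTwoChains (fun i => (P i).1) ∧ SplitsIntoTwoChains (fun i => (P i).2)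

/-- The area of the bounding box. -/
noncomputable def boxArea (P : GridCycle n) : ℤ :=
  ((⨆ i, (P i).1) - (⨅ i, (P i).1)) * ((⨆ i, (P i).2) - (⨅ i, (P i).2))

/-- Edge `i` is a horizontal edge crossed by the upward vertical ray from the centre of the grid
cell `c`, where `c` denotes the cell `[c.1, c.1 + 1] × [c.2, c.2 + 1]`. -/
def EdgeAbove (P : GridCycle n) (c : ℤ × ℤ) (i : Fin n) : Prop :=
  (P i).2 = (P.succVertex i).2 ∧ c.2 < (P i).2 ∧
    min (P i).1 (P.succVertex i).1 ≤ c.1 ∧ c.1 < max (P i).1 (P.succVertex i).1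

/-- The grid cell `c` lies in the interior of the polygon: the upward ray from its centre crosses
the boundary an odd number of times. -/
def CellInside (P : GridCycle n) (c : ℤ × ℤ) : Prop := Odd {i | P.EdgeAbove c i}.ncard

/-- The area of the polygon: the number of grid cells in its interior. -/
noncomputable def area (P : GridCycle n) : ℤ := ({c | P.CellInside c}.ncard : ℤ)

end GridCycle

/-- The two objectives to be minimized. -/
inductive Objective : Type
  | boundingBox : Objective
  | area : Objective

/-- The value of the objective on a polygon. -/
noncomputable def Objective.value {n : ℕ} : Objective → GridCycle n → ℤ
  | Objective.boundingBox, P => P.boxArea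
  | Objective.area, P => P.area

/-- An angle sequence is `xy`-monotone if it is realized by an `xy`-monotone polygon. -/
def IsXYMonotoneSeq {n : ℕ} (S : Fin n → Turn) : Prop :=
  ∃ P : GridCycle n, P.Realizes S ∧ P.IsXYMonotone

/-- The stair sequence `(LR)^k`, which has `k` reflex vertices. -/
def stairSeq (k : ℕ) : List Turn := (List.replicate k [Turn.left, Turn.right]).flatten

/-- The `xy`-monotone angle sequence `L (LR)^tl L (LR)^bl L (LR)^br L (LR)^tr`. -/
def stairWord (tl bl br tr : ℕ) : List Turn :=
  Turn.left :: stairSeq tl ++ Turn.left :: stairSeq bl ++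
    Turn.left :: stairSeq br ++ Turn.left :: stairSeq tr

/-- Up to a cyclic rotation, `S` consists of four stair sequences, in counterclockwise order, with
`tl`, `bl`, `br`, `tr` reflex vertices. -/
def HasStairCounts {n : ℕ} (S : Fin n → Turn) (tl bl br tr : ℕ) : Prop :=
  (List.ofFn S).IsRotated (stairWord tl bl br tr)

/-! ### A random access machine with a step count -/

/-- Memory of the machine: registers and a random access memory, all holding integers. -/
structure RamState : Type where
  reg : ℕ → ℤ
  mem : ℤ → ℤ

/-- Arithmetic expressions: constants, registers, indirect memory access and arithmetic. -/
inductive RamExpr : Type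
  | const (k : ℤ) : RamExpr
  | reg (r : ℕ) : RamExpr
  | load (addr : RamExpr) : RamExpr
  | add (e f : RamExpr) : RamExpr
  | sub (e f : RamExpr) : RamExpr
  | mul (e f : RamExpr) : RamExpr
  | div (e f : RamExpr) : RamExpr

namespace RamExpr

/-- The value of an expression. (Division is integer division; division by zero yields zero.) -/
def eval (s : RamState) : RamExpr → ℤ
  | const k => k
  | reg r => s.reg r
  | load a => s.mem (a.eval s)
  | add e f => e.eval s + f.eval s
  | sub e f => e.eval s - f.eval s
  | mul e f => e.eval s * f.eval s
  | div e f => e.eval s / f.eval s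

/-- The number of unit-cost operations needed to evaluate an expression. -/
def cost : RamExpr → ℕ
  | const _ => 1
  | reg _ => 1
  | load a => a.cost + 1
  | add e f => e.cost + f.cost + 1
  | sub e f => e.cost + f.cost + 1
  | mul e f => e.cost + f.cost + 1
  | div e f => e.cost + f.cost + 1

/-- All values (and addresses) that occur while the expression is evaluated have absolute value at
most `W`. -/
def Fits (W : ℤ) (s : RamState) : RamExpr → Prop
  | const k => |k| ≤ W
  | reg r => |s.reg r| ≤ W
  | load a => a.Fits W s ∧ |(load a).eval s| ≤ W
  | add e f => e.Fits W s ∧ f.Fits W s ∧ |(add e f).eval s| ≤ W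
  | sub e f => e.Fits W s ∧ f.Fits W s ∧ |(sub e f).eval s| ≤ W
  | mul e f => e.Fits W s ∧ f.Fits W s ∧ |(mul e f).eval s| ≤ W
  | div e f => e.Fits W s ∧ f.Fits W s ∧ |(div e f).eval s| ≤ W

end RamExpr

/-- Programs of the machine. -/
inductive RamProg : Type
  | nop : RamProg
  | assign (r : ℕ) (e : RamExpr) : RamProg
  | store (addr e : RamExpr) : RamProg
  | seq (p q : RamProg) : RamProg
  | branch (e : RamExpr) (p q : RamProg) : RamProg
  | loop (e : RamExpr) (p : RamProg) : RamProg

/-- `RamRun W p s t s'`: started in state `s`, the program `p` halts in state `s'` after exactly `t`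
unit-cost steps, and every value computed on the way has absolute value at most `W`. Tests ask
whether the value of an expression is positive; `loop e p` repeats `p` while `e` is positive. -/
inductive RamRun (W : ℤ) : RamProg → RamState → ℕ → RamState → Prop
  | nop (s : RamState) : RamRun W RamProg.nop s 1 s
  | assign (r : ℕ) (e : RamExpr) (s : RamState) : e.Fits W s →
      RamRun W (RamProg.assign r e) s (e.cost + 1) ⟨Function.update s.reg r (e.eval s), s.mem⟩
  | store (a e : RamExpr) (s : RamState) : a.Fits W s → e.Fits W s →
      RamRun W (RamProg.store a e) s (a.cost + e.cost + 1)
        ⟨s.reg, Function.update s.mem (a.eval s) (e.eval s)⟩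
  | seq (p q : RamProg) (s s' s'' : RamState) (t t' : ℕ) :
      RamRun W p s t s' → RamRun W q s' t' s'' → RamRun W (RamProg.seq p q) s (t + t') s''
  | branchPos (e : RamExpr) (p q : RamProg) (s s' : RamState) (t : ℕ) : e.Fits W s →
      0 < e.eval s → RamRun W p s t s' → RamRun W (RamProg.branch e p q) s (e.cost + 1 + t) s'
  | branchNonpos (e : RamExpr) (p q : RamProg) (s s' : RamState) (t : ℕ) : e.Fits W s →
      e.eval s ≤ 0 → RamRun W q s t s' → RamRun W (RamProg.branch e p q) s (e.cost + 1 + t) s'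
  | loopStop (e : RamExpr) (p : RamProg) (s : RamState) : e.Fits W s →
      e.eval s ≤ 0 → RamRun W (RamProg.loop e p) s (e.cost + 1) s
  | loopStep (e : RamExpr) (p : RamProg) (s s' s'' : RamState) (t t' : ℕ) : e.Fits W s →
      0 < e.eval s → RamRun W p s t s' → RamRun W (RamProg.loop e p) s' t' s'' →
      RamRun W (RamProg.loop e p) s (e.cost + 1 + t + t') s''

/-- Turns as machine words: `1` for a left turn, `-1` for a right turn. -/
def Turn.code : Turn → ℤ
  | Turn.left => 1
  | Turn.right => -1

/-- The initial state on an angle sequence: `n` in register `0`, the turns at addresses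
`0, …, n - 1`, and `0` everywhere else. -/
def seqInput {n : ℕ} (S : Fin n → Turn) : RamState where
  reg := fun r => if r = 0 then (n : ℤ) else 0
  mem := fun a => if h : a.toNat < n then (if 0 ≤ a then (S ⟨a.toNat, h⟩).code else 0) else 0

/-- The initial state on four numbers: they are in the registers `0, …, 3`, and everything else
is `0`. -/
def countsInput (a b c d : ℕ) : RamState where
  reg := fun r => if r = 0 then (a : ℤ) else if r = 1 then (b : ℤ) else
    if r = 2 then (c : ℤ) else if r = 3 then (d : ℤ) else 0
  mem := fun _ => 0

/-- The polygon with `n` vertices that a final state outputs: the coordinates of vertex `i` are at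
the addresses `n + 2 i` and `n + 2 i + 1`. -/
def polygonOutput (n : ℕ) (s : RamState) : GridCycle n :=
  fun i => (s.mem (n + 2 * (i : ℕ)), s.mem (n + 2 * (i : ℕ) + 1))

/-! The turns fix the direction of every edge once the direction of one edge is known. Hence every
realization of a sequence with four stairs, monotone or not, when read from a suitable separator,
runs to the left along an upper chain and back to the right along a lower chain
(`GridCycle.Realizes.exists_profile`). Such a polygon is recorded by the breakpoints `X`, `U` and
the heights `Y`, `Z` of its chains; `a`, `b`, `c`, `d` are the reflex counts of the upper left,
lower left, lower right and upper right stair. Conversely, every `IsProfile` bounds a realization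
(`GridCycle.realizes_of_profile`). Both objectives are therefore minimized over profiles.

Bounding box: the edges of the chains force width at least `max (a + d) (b + c) + 1` and height at
least `max (a + b) (c + d) + 1`. Unit steps in the corners attain both, unless two opposite stairs
have equal positive length and the other two are empty. Then these stairs would touch in the
smallest box, and one side has to grow by one (`IsProfile.not_minimal_of_collides`).

Area: it is the sum of the heights of the unit columns. If both left stairs are finished before a
right stair begins, the left part rises and the right part falls, which gives
`ColumnProfile.compact_bound`. Otherwise, up to reflection, the last step of the upper left stair
does not precede the first step of the lower right stair. The polygon is then a diagonal strip: the
`c` steps of one stair cut it into `c + 1` bays, over which the `a` steps of the other are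
distributed. The cost `bayCost` of a bay is convex in its number of steps. Replacing it by a tangent
makes the bound depend only on the total `a` (`ColumnProfile.strip_bound`). For the right slope this
linear programming dual equals the cost `stripValue` of an even distribution (`stripValue_eq_dual`).
The compact bound is never below all candidates (`exists_candidate_le_compactValue`). So the minimum
area is the least of at most five closed forms, attained by the explicit polygons of `stripParams`
and `boxParams` (`StairsFrom.realizes`).

Algorithms: comparisons can be expressed by integer division, so the optimum is a single arithmetic
expression in the four counts, and so is each coordinate of vertex `k` once `k` is also given. The
value is thus computed in constant time. A polygon is written in linear time by a scan for the four
places with two adjacent left turns, followed by constant work per vertex. An expression of cost `k`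
on inputs bounded by `M ≥ 2`, with constants at most `M`, has value at most `M ^ k`, so all words
stay polynomial in `n`. -/

/-! ### Lower bounds for column profiles -/

/-- The triangular number `1 + 2 + ⋯ + k`. -/
def tri (k : ℤ) : ℤ := k * (k + 1) / 2

theorem two_mul_tri (k : ℤ) : 2 * tri k = k * (k + 1) :=
  Int.mul_ediv_cancel' (Int.even_mul_succ_self k).two_dvd

theorem tri_succ (k : ℤ) : tri (k + 1) = tri k + k + 1 := by
  have h1 := two_mul_tri k
  have h2 := two_mul_tri (k + 1)
  linarith

theorem tri_zero : tri 0 = 0 := rfl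

theorem le_tri {k : ℤ} (hk : 0 ≤ k) : k ≤ tri k := by
  have h1 := two_mul_tri k
  rcases hk.eq_or_lt with rfl | h
  · simp [tri]
  · nlinarith

/-- Cost of a bay with `m` steps of one stair, next to a corner cut with `b` steps. -/
def bayCost (b m : ℤ) : ℤ := tri m + max (max m b) 1

/-- Constant term of the tangent of slope `p + 1` to `bayCost b`. -/
def bayTangent (b p : ℤ) : ℤ := bayCost b p - (p + 1) * p

/-- From `m` to `m + 1` the triangular part of `bayCost b` grows by `m + 1` and the maximum by `0`
or `1`. Hence `p + 1` lies between the backward and the forward difference at `p`, and `bayCost b`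
is convex. -/
theorem bayTangent_le (b p m : ℤ) : (p + 1) * m + bayTangent b p ≤ bayCost b m := by
  unfold bayTangent bayCost
  have h1 := two_mul_tri m
  have h2 := two_mul_tri p
  obtain ⟨e, rfl⟩ : ∃ e, m = p + e := ⟨m - p, by ring⟩
  rcases le_or_gt 0 e with he | he
  · have : max (max p b) 1 ≤ max (max (p + e) b) 1 := by
      gcongr; omega
    rcases he.eq_or_lt with rfl | h
    · nlinarith
    · nlinarith
  · have : max (max p b) 1 ≤ max (max (p + e) b) 1 - e := by omega
    nlinarith

/-- Lets a lower bound drop the tangents of inner bays that do not occur in the polygon. -/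
theorem bayTangent_zero_nonpos {p : ℤ} (hp : 1 ≤ p) : bayTangent 0 p ≤ 0 := by
  unfold bayTangent bayCost
  have h2 := two_mul_tri p
  have : max (max p 0) 1 = p := by omega
  rw [this]; nlinarith

/-- A potential argument: from one column to the next, the left side grows by `h (x + 1) - h x` and
by at most `u x + v x + 1 ≤ h x` more, hence by at most the new column. The extreme growth occurs
when both stairs step at once, which is why the maximum rather than the sum of the counts appears.
-/
theorem sum_rising {N : ℕ} {h u v : ℕ → ℤ} (h0 : 1 ≤ h 0) (u0 : u 0 = 0) (v0 : v 0 = 0)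
    (hu : ∀ x < N, u (x + 1) = u x ∨ u (x + 1) = u x + 1)
    (hv : ∀ x < N, v (x + 1) = v x ∨ v (x + 1) = v x + 1)
    (hh : ∀ x < N, h x + (u (x + 1) - u x) + (v (x + 1) - v x) ≤ h (x + 1)) :
    ∀ x ≤ N, 0 ≤ u x ∧ 0 ≤ v x ∧ 1 + u x + v x ≤ h x ∧
      tri (u x) + tri (v x) + max (u x) (v x) - u x - v x + h x ≤ ∑ y ∈ Finset.range (x + 1), h y := by
  intro x
  induction x with
  | zero => intro _; simp [u0, v0, h0, tri]
  | succ x ih =>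
    intro hx
    obtain ⟨i1, i2, i3, i4⟩ := ih (by omega)
    have e := hh x (by omega)
    rw [Finset.sum_range_succ]
    have t1 := tri_succ (u x)
    have t2 := tri_succ (v x)
    rcases hu x (by omega) with e1 | e1 <;> rcases hv x (by omega) with e2 | e2 <;>
      rw [e1, e2] at e ⊢ <;> refine ⟨by omega, by omega, by omega, by omega⟩

/-- Glues a sweep from the left and a sweep from the right at their common column `x`, which both of
them count. -/
theorem sum_range_split (h : ℕ → ℤ) (x k : ℕ) :
    ∑ y ∈ Finset.range (x + k + 1), h y =
      ∑ y ∈ Finset.range (x + 1), h y + ∑ y ∈ Finset.range (k + 1), h (x + k - y) - h x := by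
  have e := Finset.sum_range_reflect (fun y => h (x + y)) (k + 1)
  have e2 : ∑ y ∈ Finset.range (k + 1), h (x + k - y) = ∑ y ∈ Finset.range (k + 1), h (x + y) := by
    rw [← e]
    refine Finset.sum_congr rfl fun y hy => ?_
    have := Finset.mem_range.1 hy
    congr 1; omega
  rw [e2, show x + k + 1 = (x + 1) + k by ring, Finset.sum_range_succ' (fun y => h (x + y))]
  have : ∀ k, ∑ y ∈ Finset.range ((x + 1) + k), h y =
      ∑ y ∈ Finset.range (x + 1), h y + ∑ y ∈ Finset.range k, h (x + (y + 1)) := by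
    intro k
    induction k with
    | zero => simp
    | succ k ih =>
      rw [← add_assoc, Finset.sum_range_succ, ih, Finset.sum_range_succ _ k,
        show x + 1 + k = x + (k + 1) by ring]
      ring
  rw [this]; simp; ring

/-- The columns `0, …, N` of a polygon between two boundary chains: column `x` reaches from `g x` to
`f x`, and `i x`, `j x` count the steps of the upper and of the lower chain to its left. The upper
chain makes `a` steps up and then `d` steps down, the lower chain `b` steps down and then `c` steps
up. -/
structure ColumnProfile (a b c d : ℤ) (N : ℕ) (i j f g : ℕ → ℤ) : Prop where
  a_nonneg : 0 ≤ a
  b_nonneg : 0 ≤ b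
  c_nonneg : 0 ≤ c
  d_nonneg : 0 ≤ d
  i_zero : i 0 = 0
  j_zero : j 0 = 0
  i_last : i N = a + d
  j_last : j N = b + c
  pos : ∀ x ≤ N, g x < f x
  adj : ∀ x < N, g (x + 1) < f x ∧ g x < f (x + 1)
  top_step : ∀ x < N, (i (x + 1) = i x ∧ f (x + 1) = f x) ∨
    (i (x + 1) = i x + 1 ∧ (i x < a → f x < f (x + 1)) ∧ (a ≤ i x → f (x + 1) < f x))
  bot_step : ∀ x < N, (j (x + 1) = j x ∧ g (x + 1) = g x) ∨
    (j (x + 1) = j x + 1 ∧ (j x < b → g (x + 1) < g x) ∧ (b ≤ j x → g x < g (x + 1)))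

/-! ### Symmetries of column profiles and the two sweep bounds -/

namespace ColumnProfile

variable {a b c d : ℤ} {N : ℕ} {i j f g : ℕ → ℤ}

theorem flip_vertical (H : ColumnProfile a b c d N i j f g) :
    ColumnProfile b a d c N j i (fun x => -g x) (fun x => -f x) where
  a_nonneg := H.b_nonneg
  b_nonneg := H.a_nonneg
  c_nonneg := H.d_nonneg
  d_nonneg := H.c_nonneg
  i_zero := H.j_zero
  j_zero := H.i_zero
  i_last := H.j_last
  j_last := H.i_last
  pos x hx := by have := H.pos x hx; simpa using this
  adj x hx := by have := H.adj x hx; simpa using this.symm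
  top_step x hx := by simpa using H.bot_step x hx
  bot_step x hx := by simpa using H.top_step x hx

theorem flip_horizontal (H : ColumnProfile a b c d N i j f g) :
    ColumnProfile d c b a N (fun x => a + d - i (N - x)) (fun x => b + c - j (N - x))
      (fun x => f (N - x)) (fun x => g (N - x)) where
  a_nonneg := H.d_nonneg
  b_nonneg := H.c_nonneg
  c_nonneg := H.b_nonneg
  d_nonneg := H.a_nonneg
  i_zero := by simp [H.i_last]
  j_zero := by simp [H.j_last]
  i_last := by simp [H.i_zero, add_comm]
  j_last := by simp [H.j_zero, add_comm]
  pos x hx := H.pos _ (by omega)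
  adj x hx := by
    obtain ⟨y, rfl⟩ : ∃ y, N = x + 1 + y := ⟨N - (x + 1), by omega⟩
    have := H.adj y (by omega)
    rw [show x + 1 + y - x = y + 1 by omega, show x + 1 + y - (x + 1) = y by omega]
    exact this.symm
  top_step x hx := by
    obtain ⟨y, rfl⟩ : ∃ y, N = x + 1 + y := ⟨N - (x + 1), by omega⟩
    have := H.top_step y (by omega)
    simp only [show x + 1 + y - x = y + 1 by omega, show x + 1 + y - (x + 1) = y by omega]
    omega
  bot_step x hx := by
    obtain ⟨y, rfl⟩ : ∃ y, N = x + 1 + y := ⟨N - (x + 1), by omega⟩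
    have := H.bot_step y (by omega)
    simp only [show x + 1 + y - x = y + 1 by omega, show x + 1 + y - (x + 1) = y by omega]
    omega

theorem mono_i (H : ColumnProfile a b c d N i j f g) {x y : ℕ} (hxy : x ≤ y) (hy : y ≤ N) :
    i x ≤ i y := by
  induction y, hxy using Nat.le_induction with
  | base => rfl
  | succ y hxy ih => have := H.top_step y (by omega); have := ih (by omega); omega

theorem mono_j (H : ColumnProfile a b c d N i j f g) {x y : ℕ} (hxy : x ≤ y) (hy : y ≤ N) :
    j x ≤ j y := H.flip_vertical.mono_i hxy hy

theorem rising (H : ColumnProfile a b c d N i j f g) {x : ℕ} (hx : x ≤ N) (hi : i x ≤ a)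
    (hj : j x ≤ b) : 1 + i x + j x ≤ f x - g x ∧
      tri (i x) + tri (j x) + max (i x) (j x) - i x - j x + (f x - g x) ≤
        ∑ y ∈ Finset.range (x + 1), (f y - g y) := by
  have h0 := H.pos 0 (by omega)
  refine (sum_rising (N := x) (h := fun y => f y - g y) (u := i) (v := j) (by omega)
    H.i_zero H.j_zero (fun y hy => ?_) (fun y hy => ?_) (fun y hy => ?_) x le_rfl).2.2
  · have := H.top_step y (by omega); omega
  · have := H.bot_step y (by omega); omega
  · have t1 := H.top_step y (by omega)
    have t2 := H.bot_step y (by omega)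
    have m1 := H.mono_i (x := y + 1) (y := x) (by omega) hx
    have m2 := H.mono_j (x := y + 1) (y := x) (by omega) hx
    omega

theorem falling (H : ColumnProfile a b c d N i j f g) {x : ℕ} (hx : x ≤ N) (hi : a ≤ i x)
    (hj : b ≤ j x) : 1 + (b + c - j x) + (a + d - i x) ≤ f x - g x ∧
      tri (b + c - j x) + tri (a + d - i x) + max (b + c - j x) (a + d - i x) - (b + c - j x)
        - (a + d - i x) + (f x - g x) ≤ ∑ y ∈ Finset.range (N - x + 1), (f (N - y) - g (N - y)) := by
  have := H.flip_horizontal.rising (x := N - x) (by omega)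
    (by rw [Nat.sub_sub_self hx]; omega) (by rw [Nat.sub_sub_self hx]; omega)
  simp only [Nat.sub_sub_self hx] at this
  obtain ⟨h1, h2⟩ := this
  refine ⟨by omega, ?_⟩
  rw [max_comm]
  linarith

/-- If all steps of the left stairs come before all steps of the right stairs, the area is at least
this number. -/
theorem compact_bound (H : ColumnProfile a b c d N i j f g)
    (h1 : ∀ x < N, i x < a → j (x + 1) ≤ b) (h2 : ∀ x < N, j x < b → i (x + 1) ≤ a) :
    tri a + tri b + tri c + tri d + max a b + max c d + 1 - min (a + b) (c + d) ≤
      ∑ y ∈ Finset.range (N + 1), (f y - g y) := by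
  classical
  -- At the first column where both left stairs are complete, the hypotheses keep both right stairs
  -- from having begun, so the counts there are exactly `a` and `b`. Its height is at least `1 + a +
  -- b` and `1 + c + d`; the larger of the two produces the minimum in the bound.
  have hex : ∃ x, x ≤ N ∧ a ≤ i x ∧ b ≤ j x :=
    ⟨N, le_rfl, by rw [H.i_last]; linarith [H.d_nonneg], by rw [H.j_last]; linarith [H.c_nonneg]⟩
  obtain ⟨hN, ha, hb⟩ := Nat.find_spec hex
  have hmin := @Nat.find_min _ _ hex
  generalize Nat.find hex = x at *
  have hia : i x = a ∧ j x = b := by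
    rcases Nat.eq_zero_or_pos x with h0 | h0
    · have := H.i_zero; have := H.j_zero; have := H.a_nonneg; have := H.b_nonneg
      subst h0; omega
    · obtain ⟨y, rfl⟩ : ∃ y, x = y + 1 := ⟨x - 1, by omega⟩
      have hmin := hmin (m := y) (by omega)
      have t1 := H.top_step y (by omega)
      have t2 := H.bot_step y (by omega)
      have := h1 y (by omega)
      have := h2 y (by omega)
      by_cases hh : i y < a
      · omega
      · have : j y < b := by
          by_contra h; exact hmin ⟨by omega, by omega, by omega⟩
        omega
  obtain ⟨r1, r2⟩ := H.rising hN hia.1.le hia.2.le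
  obtain ⟨r3, r4⟩ := H.falling hN hia.1.ge hia.2.ge
  rw [hia.1, hia.2] at r1 r2 r3 r4
  have := sum_range_split (fun y => f y - g y) x (N - x)
  rw [show x + (N - x) = N by omega] at this
  rw [this]
  simp only [add_sub_cancel_left] at r1 r2 r3 r4 ⊢
  omega

/-- The lower right steps cut the polygon into a first bay next to the `b` steps, `c - 1` inner
bays, and a last bay next to the `d` steps. A sweep closes the bays one by one and charges each by
the tangent of slope `p + 1` to its cost, so that it does not matter how the `a` upper steps are
distributed. -/
theorem strip_bound (H : ColumnProfile a b c d N i j f g) {p : ℤ} (hp : 0 ≤ p) {x₀ : ℕ}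
    (hx₀ : x₀ < N) (hi : i x₀ < a) (hj : b < j (x₀ + 1)) :
    tri b + tri d + 1 + (p + 1) * a + bayTangent b p + (c - 1) * bayTangent 0 p + bayTangent d p ≤
      ∑ y ∈ Finset.range (N + 1), (f y - g y) := by
  classical
  -- `x1` is the last column of the first bay, and `x2` below is the first column at which the upper
  -- left stair is complete.
  have hex1 : ∃ x, x < N ∧ b < j (x + 1) := ⟨x₀, hx₀, hj⟩
  obtain ⟨hx1, hjx1⟩ := Nat.find_spec hex1
  have hle := Nat.find_min' hex1 ⟨hx₀, hj⟩
  have hmin1 := @Nat.find_min _ _ hex1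
  generalize Nat.find hex1 = x1 at *
  have hix1 : i x1 < a := (H.mono_i hle hx₀.le).trans_lt hi
  have hjx1' : j x1 = b := by
    have t := H.bot_step x1 hx1
    have : j x1 ≤ b := by
      rcases Nat.eq_zero_or_pos x1 with h0 | h0
      · rw [h0, H.j_zero]; exact H.b_nonneg
      · obtain ⟨y, rfl⟩ : ∃ y, x1 = y + 1 := ⟨x1 - 1, by omega⟩
        by_contra h; exact hmin1 (m := y) (by omega) ⟨by omega, by omega⟩
    omega
  have hex2 : ∃ x, x ≤ N ∧ a ≤ i x := ⟨N, le_rfl, by rw [H.i_last]; linarith [H.d_nonneg]⟩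
  obtain ⟨hx2, hix2⟩ := Nat.find_spec hex2
  have hmin2 := @Nat.find_min _ _ hex2
  generalize Nat.find hex2 = x2 at *
  have hx12 : x1 < x2 := by
    by_contra h
    have := H.mono_i (x := x2) (y := x1) (by omega) hx1.le
    omega
  have i1nn : 0 ≤ i x1 := by have := H.mono_i (x := 0) (y := x1) (by omega) hx1.le; rwa [H.i_zero] at this
  -- `m` counts the upper steps in the open bay; a step that coincides with the opening of a bay
  -- belongs to the new bay. Closed bays are charged by their tangents, the open bay by `tri m - min
  -- m 1` together with the current height. Overlap of neighbouring columns keeps that height at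
  -- least `m + 1`. The implication records that a step into the current column lies in the open
  -- bay, so the bay is nonempty when the sweep stops.
  have key : ∀ t, x1 + 1 + t ≤ x2 → ∃ m, 0 ≤ m ∧ m + 1 ≤ f (x1 + 1 + t) - g (x1 + 1 + t) ∧
      (i (x1 + t) < i (x1 + 1 + t) → 1 ≤ m) ∧
      tri b + 1 + (p + 1) * (i (x1 + 1 + t) - m) + bayTangent b p +
        (j (x1 + 1 + t) - b - 1) * bayTangent 0 p + tri m - min m 1 +
        (f (x1 + 1 + t) - g (x1 + 1 + t)) ≤
      ∑ y ∈ Finset.range (x1 + 1 + t + 1), (f y - g y) := by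
    intro t
    induction t with
    | zero =>
      intro _
      obtain ⟨r1, r2⟩ := H.rising hx1.le hix1.le hjx1'.le
      have t1 := H.top_step x1 hx1
      have t2 := H.bot_step x1 hx1
      have t3 := H.adj x1 hx1
      have tan := bayTangent_le b p (i x1)
      rw [add_zero, add_zero]
      have hj1 : j (x1 + 1) = b + 1 := by omega
      refine ⟨i (x1 + 1) - i x1, by omega, by omega, by omega, ?_⟩
      rw [Finset.sum_range_succ, hj1]
      have e1 : tri (i (x1 + 1) - i x1) = i (x1 + 1) - i x1 := by
        rcases t1 with t1 | t1
        · rw [t1.1]; simp [tri]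
        · rw [t1.1]; simp [tri]
      rw [e1]
      unfold bayCost at tan
      rw [hjx1'] at r1 r2
      have e3 : i (x1 + 1) - (i (x1 + 1) - i x1) = i x1 := by ring
      rw [e3]
      have e2 : min (i (x1 + 1) - i x1) 1 = i (x1 + 1) - i x1 := by omega
      rw [e2]
      have e4 : max (max (i x1) b) 1 ≤ max (i x1) b - i x1 - b + (f x1 - g x1) - 1 := by
        have := H.b_nonneg
        omega
      linarith
    | succ t ih =>
      intro ht
      obtain ⟨m, m0, mh, -, ms⟩ := ih (by omega)
      rw [show x1 + 1 + (t + 1) = (x1 + 1 + t) + 1 by ring, show x1 + (t + 1) = x1 + 1 + t by ring]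
      generalize hx : x1 + 1 + t = x at *
      have hxN : x < N := by omega
      have hia : i x < a := by
        by_contra h; exact hmin2 (m := x) (by omega) ⟨by omega, by omega⟩
      have hjb : b ≤ j x := by
        have := H.mono_j (x := x1 + 1) (y := x) (by omega) (by omega)
        omega
      have t1 := H.top_step x hxN
      have t2 := H.bot_step x hxN
      have t3 := H.adj x hxN
      rw [Finset.sum_range_succ]
      rcases t2 with t2 | t2
      · refine ⟨m + (i (x + 1) - i x), by omega, by omega, by omega, ?_⟩
        have e3 : i (x + 1) - (m + (i (x + 1) - i x)) = i x - m := by ring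
        rw [e3, t2.1]
        rcases t1 with t1 | t1
        · rw [t1.1, sub_self, add_zero]
          have := t2.2; have := t1.2
          linarith
        · rw [t1.1, show m + (i x + 1 - i x) = m + 1 by ring, tri_succ]
          have e4 : min (m + 1) 1 = 1 := by omega
          rw [e4]
          have : min m 1 ≤ 1 := by omega
          rcases m0.eq_or_lt with rfl | hm
          · have : min (0 : ℤ) 1 = 0 := rfl
            omega
          · omega
      -- A lower step closes the bay: since the height is at least `m + 1`, the open-bay terms
      -- dominate `bayCost 0 m`, which is replaced by its tangent.
      · refine ⟨i (x + 1) - i x, by omega, by omega, by omega, ?_⟩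
        have e3 : i (x + 1) - (i (x + 1) - i x) = i x := by ring
        have e1 : tri (i (x + 1) - i x) = i (x + 1) - i x := by
          rcases t1 with t1 | t1
          · rw [t1.1]; simp [tri]
          · rw [t1.1]; simp [tri]
        have e2 : min (i (x + 1) - i x) 1 = i (x + 1) - i x := by omega
        rw [e3, e1, e2, t2.1]
        have tan := bayTangent_le 0 p m
        unfold bayCost at tan
        have e4 : max (max m 0) 1 ≤ f x - g x - min m 1 := by omega
        have e5 : (j x + 1 - b - 1) * bayTangent 0 p =
          (j x - b - 1) * bayTangent 0 p + bayTangent 0 p := by ring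
        have e6 : (p + 1) * (i x - m) = (p + 1) * i x - (p + 1) * m := by ring
        rw [e5]; rw [e6] at ms
        linarith
  obtain ⟨t, rfl⟩ : ∃ t, x2 = x1 + 1 + t := ⟨x2 - (x1 + 1), by omega⟩
  obtain ⟨m, m0, mh, m1, ms⟩ := key t le_rfl
  have hlast : i (x1 + t) < a := by
    by_contra h; exact hmin2 (m := x1 + t) (by omega) ⟨by omega, by omega⟩
  have hia : i (x1 + 1 + t) = a := by
    have t1 := H.top_step (x1 + t) (by omega)
    rw [show x1 + t + 1 = x1 + 1 + t by ring] at t1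
    omega
  have hm1 : 1 ≤ m := m1 (by omega)
  generalize hx : x1 + 1 + t = x at *
  have hjb : b < j x := by
    have := H.mono_j (x := x1 + 1) (y := x) (by omega) (by omega)
    omega
  obtain ⟨r3, r4⟩ := H.falling hx2 hia.ge hjb.le
  have hsplit := sum_range_split (fun y => f y - g y) x (N - x)
  rw [show x + (N - x) = N by omega] at hsplit
  rw [hsplit]
  have hjl : j x ≤ b + c := by rw [← H.j_last]; exact H.mono_j hx2 le_rfl
  obtain ⟨n, hn⟩ : ∃ n, b + c - j x = n := ⟨_, rfl⟩
  have hjn : j x = b + c - n := by omega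
  rw [hia, hjn] at ms
  rw [hia] at r3 r4
  rw [hn] at r3 r4
  rw [add_sub_cancel_left] at r3 r4
  have hd := H.d_nonneg
  have hnn : 0 ≤ n := by omega
  have hmin : min m 1 = 1 := by omega
  rw [hmin] at ms
  -- The last `n` lower steps come after the upper left stair is complete, so `n` of the `c - 1`
  -- inner tangents have not been charged. For `p ≥ 1` they are nonpositive; for `p = 0` each equals
  -- `1` and is paid for by `tri n`.
  have fin : (p + 1) * m + bayTangent d p + n * bayTangent 0 p ≤
      tri m + max m (n + d) + tri n + max n d - n - d := by
    have tn := le_tri hnn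
    have tm := le_tri m0
    rcases hp.eq_or_lt with rfl | hp
    · have k0 : bayTangent 0 0 = 1 := by simp [bayTangent, bayCost, tri]
      have kd : bayTangent d 0 = max d 1 := by
        simp only [bayTangent, bayCost, tri]; omega
      rw [k0, kd]
      rcases hnn.eq_or_lt with rfl | hn'
      · simp only [tri_zero]; omega
      · omega
    · have k0 := bayTangent_zero_nonpos (p := p) (by omega)
      have : n * bayTangent 0 p ≤ 0 := mul_nonpos_of_nonneg_of_nonpos hnn k0
      have tan := bayTangent_le d p m
      unfold bayCost at tan
      omega
  have e6 : (p + 1) * (a - m) = (p + 1) * a - (p + 1) * m := by ring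
  have e7 : (b + c - n - b - 1) * bayTangent 0 p = (c - 1) * bayTangent 0 p - n * bayTangent 0 p := by
    ring
  rw [e6, e7] at ms
  have e8 : max m (n + d) + 1 ≤ f x - g x := by omega
  linarith

end ColumnProfile

/-! ### The candidate values for the area -/

/-- Area of the strip-shaped polygon with `a` unit steps on one side and `c ≤ a` steps on the other,
and with `b` and `d` reflex vertices at its two ends. -/
def stripValue (a b c d : ℤ) : ℤ :=
  tri b + tri d + 1 + (c + 1) * tri (a / (c + 1)) + (c - 1) * max (a / (c + 1)) 1 +
    max (max (a / (c + 1)) b) 1 + max (max (a / (c + 1)) d) 1 +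
    (a - a / (c + 1) * (c + 1)) * (a / (c + 1) + 1) +
    if 0 < a / (c + 1) then
      max 0 (a - a / (c + 1) * (c + 1) -
        ((if a / (c + 1) < b then 1 else 0) + (if a / (c + 1) < d then 1 else 0)))
    else 0

/-- The counts for which the strip-shaped polygon is used. -/
def StripAdmissible (a _b c d : ℤ) : Prop := c ≤ a ∧ (0 < c ∨ d = 0)

/-- Side lengths of the smallest bounding box for which no two opposite stairs interfere. -/
def boxSide (a b c d : ℤ) : ℤ := max (a + d) (b + c) + 1

theorem boxSide_rotate (a b c d : ℤ) : boxSide c d a b = boxSide a b c d := by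
  unfold boxSide
  rw [max_comm, add_comm d a, add_comm c b]

theorem boxSide_flip (a b c d : ℤ) : boxSide b a d c = boxSide a b c d := by
  unfold boxSide
  rw [max_comm]

/-- Area of the polygon whose stairs consist of unit steps in the corners of the bounding box. -/
def boxValue (a b c d : ℤ) : ℤ :=
  boxSide a b c d * boxSide b c d a - tri a - tri b - tri c - tri d

/-- Two opposite stairs of equal length that would collide in the corners of the smallest box. -/
def Collides (a b c d : ℤ) : Prop := b = 0 ∧ d = 0 ∧ a = c ∧ 0 < a

/-- The values of area that are attained by the strips and the corner-filling polygon. -/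
def IsAreaCandidate (a b c d v : ℤ) : Prop :=
  (StripAdmissible a b c d ∧ v = stripValue a b c d) ∨
  (StripAdmissible b c d a ∧ v = stripValue b c d a) ∨
  (StripAdmissible c d a b ∧ v = stripValue c d a b) ∨
  (StripAdmissible d a b c ∧ v = stripValue d a b c) ∨
  ((¬ Collides a b c d ∧ ¬ Collides b c d a) ∧ v = boxValue a b c d)

theorem stripValue_symm (a b c d : ℤ) : stripValue a b c d = stripValue a d c b := by
  unfold stripValue
  rw [add_comm (if a / (c + 1) < b then (1 : ℤ) else 0)]
  ring

/-- For `c = d = 0` the number `c - 1 = -1` of inner bays cancels the last bay, and a single bay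
remains. -/
theorem stripValue_zero {a b : ℤ} (ha : 0 ≤ a) :
    stripValue a b 0 0 = tri a + tri b + 1 + max (max a b) 1 := by
  unfold stripValue
  have : max (max a 0) 1 = max a 1 := by omega
  simp only [zero_add, Int.ediv_one, tri_zero, mul_one, sub_self, this]
  have : ∀ x y : ℤ, 0 ≤ x → 0 ≤ y → max 0 (0 - (x + y)) = 0 := by intros; omega
  rw [this _ _ (by split_ifs <;> norm_num) (by split_ifs <;> norm_num)]
  simp only [ite_self]
  ring

/-- The strip value is the value of a linear programming dual. -/
theorem stripValue_eq_dual {a b c d : ℤ} (ha : 0 ≤ a) (hc : 0 ≤ c) :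
    ∃ p, 0 ≤ p ∧ stripValue a b c d = tri b + tri d + 1 + (p + 1) * a + bayTangent b p +
      (c - 1) * bayTangent 0 p + bayTangent d p := by
  have hq : 0 ≤ a / (c + 1) := Int.ediv_nonneg ha (by omega)
  unfold stripValue
  obtain ⟨r, hr⟩ : ∃ r, a - a / (c + 1) * (c + 1) = r := ⟨_, rfl⟩
  rw [hr]
  generalize a / (c + 1) = q at *
  have ea : a = q * (c + 1) + r := by linarith
  have m0 : max (max q 0) 1 = max q 1 := by omega
  -- The choice of the slope: the `r` leftover steps go to distinct bays. One more step costs `q +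
  -- 1` in an end bay with `q` below its `b` or `d`, and everywhere if `q = 0`; in all other bays it
  -- costs `q + 2`. The slope is `q + 2` precisely when the cheap places do not suffice.
  by_cases h : 0 < q ∧ (if q < b then 1 else 0) + (if q < d then 1 else 0) < r
  · obtain ⟨hq0, hs⟩ := h
    refine ⟨q + 1, by omega, ?_⟩
    unfold bayTangent bayCost
    rw [if_pos hq0, max_eq_right (a := (0 : ℤ)) (b := r - _) (by omega), tri_succ, ea]
    have e0 : max (max (q + 1) 0) 1 = q + 1 := by omega
    have e1 : max q 1 = q := by omega
    have e2 : ∀ b, max (max (q + 1) b) 1 = max (max q b) 1 + 1 - (if q < b then 1 else 0) := by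
      intro b; split_ifs <;> omega
    rw [e0, e1, e2 b, e2 d]
    ring
  · refine ⟨q, hq, ?_⟩
    have : (if 0 < q then max 0 (r - ((if q < b then 1 else 0) + (if q < d then 1 else 0))) else 0)
        = 0 := by
      by_cases h0 : 0 < q
      · rw [if_pos h0, max_eq_left]
        have := not_and.1 h h0
        omega
      · rw [if_neg h0]
    rw [this]
    unfold bayTangent bayCost
    rw [m0, ea]
    ring

/-- Every distribution of the steps over the bays costs at least the strip value. -/
theorem stripValue_le {a b c d : ℤ} (ha : 0 ≤ a) (hc : 1 ≤ c) (m₀ m₁ m₂ : ℤ)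
    (hm : m₀ + (c - 1) * m₁ + m₂ = a) :
    stripValue a b c d ≤
      tri b + tri d + 1 + bayCost b m₀ + (c - 1) * bayCost 0 m₁ + bayCost d m₂ := by
  obtain ⟨p, -, e⟩ := stripValue_eq_dual (a := a) (b := b) (c := c) (d := d) ha (by omega)
  have t0 := bayTangent_le b p m₀
  have t1 := bayTangent_le 0 p m₁
  have t2 := bayTangent_le d p m₂
  have := mul_le_mul_of_nonneg_left t1 (show 0 ≤ c - 1 by omega)
  rw [e, ← hm]
  linarith

/-- Puts one step into every bay but the first and the rest into the first. This is far from optimal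
in general but usually good enough against `compactValue`. -/
theorem stripValue_le' {a b c d : ℤ} (hc : 1 ≤ c) (hca : c ≤ a) :
    stripValue a b c d ≤ tri b + tri d + tri (a - c) + max (max (a - c) b) 1 + 2 * c
      + max 1 d := by
  have := stripValue_le (a := a) (b := b) (c := c) (d := d) (by omega) hc (a - c) 1 1 (by ring)
  unfold bayCost at this
  rw [show tri 1 = 1 from rfl, show max (max 1 0) 1 = (1 : ℤ) from rfl] at this
  have e : max (max 1 d) 1 = max 1 d := by omega
  rw [e] at this
  linarith

/-- The area of the smallest polygons all of whose left steps precede all of the right steps. -/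
def compactValue (a b c d : ℤ) : ℤ :=
  tri a + tri b + tri c + tri d + max a b + max c d + 1 - min (a + b) (c + d)

/-! ### Comparison of the compact bound with the candidates -/

theorem tri_sub (a c : ℤ) : tri (a - c) = tri a + tri c - a * c - c := by
  have h1 := two_mul_tri a
  have h2 := two_mul_tri c
  have h3 := two_mul_tri (a - c)
  nlinarith

/-- A reflection exchanges the two end bays of a strip, which `stripValue` does not notice.
Admissibility is asymmetric only when the stair that separates the bays is empty; then only two
adjacent stairs can be nonempty, and they exchange roles. -/
theorem IsAreaCandidate.flip {a b c d v : ℤ} (ha : 0 ≤ a) (hb : 0 ≤ b) (hc : 0 ≤ c) (hd : 0 ≤ d)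
    (h : IsAreaCandidate b a d c v) : IsAreaCandidate a b c d v := by
  unfold IsAreaCandidate StripAdmissible at *
  have s : ∀ {a b : ℤ}, 0 ≤ a → 0 ≤ b → stripValue a b 0 0 = stripValue b a 0 0 := by
    intro a b ha hb
    rw [stripValue_zero ha, stripValue_zero hb, max_comm a b]; ring
  rcases h with ⟨⟨h1, h2⟩, h⟩ | ⟨⟨h1, h2⟩, h⟩ | ⟨⟨h1, h2⟩, h⟩ | ⟨⟨h1, h2⟩, h⟩ | ⟨h1, h⟩
  · by_cases hd0 : 0 < d
    · right; left; exact ⟨⟨h1, Or.inl hd0⟩, by rw [h, stripValue_symm]⟩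
    · left
      obtain rfl : d = 0 := by omega
      obtain rfl : c = 0 := by omega
      exact ⟨⟨ha, Or.inr rfl⟩, by rw [h, s hb ha]⟩
  · by_cases hc0 : 0 < c
    · left; exact ⟨⟨h1, Or.inl hc0⟩, by rw [h, stripValue_symm]⟩
    · right; right; right; left
      obtain rfl : c = 0 := by omega
      obtain rfl : b = 0 := by omega
      exact ⟨⟨hd, Or.inr rfl⟩, by rw [h, s ha hd]⟩
  · by_cases hb0 : 0 < b
    · right; right; right; left; exact ⟨⟨h1, Or.inl hb0⟩, by rw [h, stripValue_symm]⟩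
    · right; right; left
      obtain rfl : b = 0 := by omega
      obtain rfl : a = 0 := by omega
      exact ⟨⟨hc, Or.inr rfl⟩, by rw [h, s hd hc]⟩
  · by_cases ha0 : 0 < a
    · right; right; left; exact ⟨⟨h1, Or.inl ha0⟩, by rw [h, stripValue_symm]⟩
    · right; left
      obtain rfl : a = 0 := by omega
      obtain rfl : d = 0 := by omega
      exact ⟨⟨hb, Or.inr rfl⟩, by rw [h, s hc hb]⟩
  · right; right; right; right
    unfold Collides boxValue at *
    refine ⟨⟨by omega, by omega⟩, ?_⟩
    rw [h, boxSide_flip a b c d, ← boxSide_rotate a d c b, boxSide_flip b c d a]; ring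

theorem IsAreaCandidate.rotate {a b c d v : ℤ} (h : IsAreaCandidate b c d a v) :
    IsAreaCandidate a b c d v := by
  unfold IsAreaCandidate at *
  rcases h with h | h | h | h | ⟨h1, h⟩
  · exact Or.inr (Or.inl h)
  · exact Or.inr (Or.inr (Or.inl h))
  · exact Or.inr (Or.inr (Or.inr (Or.inl h)))
  · exact Or.inl h
  · refine Or.inr (Or.inr (Or.inr (Or.inr ⟨?_, ?_⟩)))
    · unfold Collides at *; omega
    · rw [h]; unfold boxValue
      rw [boxSide_rotate a b c d]
      ring

theorem compactValue_flip (a b c d : ℤ) : compactValue b a d c = compactValue a b c d := by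
  unfold compactValue
  rw [max_comm b a, max_comm d c, add_comm b a, add_comm d c]; ring

/-- By `tri_sub`, the strip of the longest stair `a` against the opposite stair `c` gains the
product `a * c` over the compact value, which outweighs the linear terms. Empty stairs and a few
tight cases need another candidate. -/
theorem exists_candidate_le_compactValue_of_max {a b c d : ℤ} (hb : 0 ≤ b) (hc : 0 ≤ c)
    (hd : 0 ≤ d) (hba : b ≤ a) (hca : c ≤ a) (hda : d ≤ a) :
    ∃ v, IsAreaCandidate a b c d v ∧ v ≤ compactValue a b c d := by
  rcases (show 0 ≤ a by omega).eq_or_lt with rfl | ha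
  · obtain rfl : b = 0 := by omega
    obtain rfl : c = 0 := by omega
    obtain rfl : d = 0 := by omega
    refine ⟨boxValue 0 0 0 0, ?_, by simp [boxValue, compactValue, boxSide, tri]⟩
    exact Or.inr (Or.inr (Or.inr (Or.inr ⟨by simp [Collides], rfl⟩)))
  rcases hc.eq_or_lt with rfl | hc0
  · rcases hd.eq_or_lt with rfl | hd0
    · refine ⟨_, Or.inl ⟨⟨hca, Or.inr rfl⟩, rfl⟩, ?_⟩
      rw [stripValue_zero ha.le]
      unfold compactValue
      simp only [tri_zero]
      omega
    · rcases hb.eq_or_lt with rfl | hb0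
      · refine ⟨_, Or.inr (Or.inr (Or.inr (Or.inl ⟨⟨hd, Or.inr rfl⟩, rfl⟩))), ?_⟩
        rw [stripValue_zero hd]
        unfold compactValue
        simp only [tri_zero]
        omega
      · rcases le_total d b with h | h
        · refine ⟨_, Or.inr (Or.inl ⟨⟨h, Or.inl hd0⟩, rfl⟩), ?_⟩
          have := stripValue_le' (a := b) (b := 0) (c := d) (d := a) (by omega) h
          rw [tri_sub] at this
          unfold compactValue
          simp only [tri_zero] at *
          have : b * 1 ≤ b * d := by gcongr; omega
          have : max (max (b - d) 0) 1 ≤ b - d + 1 := by omega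
          omega
        · refine ⟨_, Or.inr (Or.inr (Or.inr (Or.inl ⟨⟨h, Or.inl hb0⟩, rfl⟩))), ?_⟩
          have := stripValue_le' (a := d) (b := a) (c := b) (d := 0) (by omega) h
          rw [tri_sub] at this
          unfold compactValue
          simp only [tri_zero] at *
          have : 1 * d ≤ b * d := by gcongr; omega
          have := mul_comm b d
          omega
  -- The uneven strip of `stripValue_le'` is too large by one here, while the corner-filling polygon
  -- has exactly the compact value.
  · by_cases hall : a = b ∧ b = c ∧ c = d ∧ a ≤ 2
    · obtain ⟨rfl, rfl, rfl, h2⟩ := hall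
      refine ⟨_, Or.inr (Or.inr (Or.inr (Or.inr ⟨by unfold Collides; omega, rfl⟩))), ?_⟩
      obtain rfl | rfl : a = 1 ∨ a = 2 := by omega
      · decide
      · decide
    -- Again the uneven strip along `a` and `c` misses by one; the strip along the two equal stairs
    -- `b` and `d` is small enough.
    by_cases hone : a = b ∧ a = d ∧ c = 1
    · obtain ⟨rfl, rfl, rfl⟩ := hone
      refine ⟨_, Or.inr (Or.inl ⟨⟨le_rfl, Or.inl ha⟩, rfl⟩), ?_⟩
      have := stripValue_le' (a := a) (b := 1) (c := a) (d := a) (by omega) le_rfl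
      rw [sub_self] at this
      unfold compactValue
      have e : tri 1 = 1 := rfl
      rw [e, tri_zero] at this
      rw [e]
      have h1 := two_mul_tri a
      have : 2 * a ≤ a * a := by gcongr; omega
      have : max (max 0 1) 1 = (1 : ℤ) := rfl
      have : max 1 a = a := by omega
      have : a * (a + 1) = a * a + a := by ring
      omega
    · refine ⟨_, Or.inl ⟨⟨hca, Or.inl hc0⟩, rfl⟩, ?_⟩
      have := stripValue_le' (a := a) (b := b) (c := c) (d := d) (by omega) hca
      rw [tri_sub] at this
      unfold compactValue
      have key : max (max (a - c) b) 1 + max 1 d + c + min (a + b) (c + d) ≤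
          a * c + max a b + max c d + 1 := by
        -- The products `(a - k) * (c - k) ≥ 0` supply the linear lower bounds for `a * c` that the
        -- comparison needs.
        have p1 : 0 ≤ (a - 1) * (c - 1) := mul_nonneg (by omega) (by omega)
        have p1' : (a - 1) * (c - 1) = a * c - a - c + 1 := by ring
        by_cases hc1 : c = 1
        · subst hc1; omega
        · have p2 : 0 ≤ (a - 2) * (c - 2) := mul_nonneg (by omega) (by omega)
          have p2' : (a - 2) * (c - 2) = a * c - 2 * a - 2 * c + 4 := by ring
          by_cases hc2 : c = 2
          · subst hc2; omega
          · have p3 : 0 ≤ (a - 3) * (c - 3) := mul_nonneg (by omega) (by omega)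
            have p3' : (a - 3) * (c - 3) = a * c - 3 * a - 3 * c + 9 := by ring
            omega
      linarith

theorem exists_candidate_le_compactValue {a b c d : ℤ} (ha : 0 ≤ a) (hb : 0 ≤ b) (hc : 0 ≤ c)
    (hd : 0 ≤ d) : ∃ v, IsAreaCandidate a b c d v ∧ v ≤ compactValue a b c d := by
  have hflip : ∀ {a b c d : ℤ}, 0 ≤ a → 0 ≤ b → 0 ≤ c → 0 ≤ d →
      (∃ v, IsAreaCandidate b a d c v ∧ v ≤ compactValue b a d c) →
      ∃ v, IsAreaCandidate a b c d v ∧ v ≤ compactValue a b c d := by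
    rintro a b c d ha hb hc hd ⟨v, h1, h2⟩
    exact ⟨v, h1.flip ha hb hc hd, by rwa [compactValue_flip] at h2⟩
  have hrot : ∀ {a b c d : ℤ},
      (∃ v, IsAreaCandidate c d a b v ∧ v ≤ compactValue c d a b) →
      ∃ v, IsAreaCandidate a b c d v ∧ v ≤ compactValue a b c d := by
    rintro a b c d ⟨v, h1, h2⟩
    refine ⟨v, h1.rotate.rotate, h2.trans (le_of_eq ?_)⟩
    unfold compactValue
    rw [min_comm]; ring
  rcases le_total a b with h1 | h1 <;> rcases le_total c d with h2 | h2
  · rcases le_total b d with h3 | h3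
    · refine hrot (hflip hc hd ha hb (exists_candidate_le_compactValue_of_max ?_ ?_ ?_ ?_ ?_ ?_)) <;>
        omega
    · refine hflip ha hb hc hd (exists_candidate_le_compactValue_of_max ?_ ?_ ?_ ?_ ?_ ?_) <;> omega
  · rcases le_total b c with h3 | h3
    · refine hrot (exists_candidate_le_compactValue_of_max ?_ ?_ ?_ ?_ ?_ ?_) <;> omega
    · refine hflip ha hb hc hd (exists_candidate_le_compactValue_of_max ?_ ?_ ?_ ?_ ?_ ?_) <;> omega
  · rcases le_total a d with h3 | h3
    · refine hrot (hflip hc hd ha hb (exists_candidate_le_compactValue_of_max ?_ ?_ ?_ ?_ ?_ ?_)) <;>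
        omega
    · refine exists_candidate_le_compactValue_of_max ?_ ?_ ?_ ?_ ?_ ?_ <;> omega
  · rcases le_total a c with h3 | h3
    · refine hrot (exists_candidate_le_compactValue_of_max ?_ ?_ ?_ ?_ ?_ ?_) <;> omega
    · refine exists_candidate_le_compactValue_of_max ?_ ?_ ?_ ?_ ?_ ?_ <;> omega

/-! ### Every column profile lies above a candidate -/

namespace ColumnProfile

variable {a b c d : ℤ} {N : ℕ} {i j f g : ℕ → ℤ}

theorem sum_flip_horizontal (h : ℕ → ℤ) (N : ℕ) :
    ∑ y ∈ Finset.range (N + 1), h (N - y) = ∑ y ∈ Finset.range (N + 1), h y := by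
  simpa using Finset.sum_range_reflect h (N + 1)

/-- The longer of the two interleaved stairs supplies the steps and the shorter one the bays; if the
lower right stair is the longer one, a half turn exchanges them. -/
theorem exists_candidate_of_interleaved (H : ColumnProfile a b c d N i j f g) {x : ℕ} (hx : x < N)
    (hi : i x < a) (hj : b < j (x + 1)) :
    ∃ v, IsAreaCandidate a b c d v ∧ v ≤ ∑ y ∈ Finset.range (N + 1), (f y - g y) := by
  have hc : 0 < c := by
    have := H.mono_j (x := x + 1) (y := N) (by omega) le_rfl
    rw [H.j_last] at this; omega
  have ha : 0 < a := by
    have := H.mono_i (x := 0) (y := x) (by omega) hx.le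
    rw [H.i_zero] at this; omega
  rcases le_total c a with h | h
  · obtain ⟨p, hp, e⟩ := stripValue_eq_dual (a := a) (b := b) (c := c) (d := d) ha.le hc.le
    exact ⟨_, Or.inl ⟨⟨h, Or.inl hc⟩, rfl⟩, e.trans_le (H.strip_bound hp hx hi hj)⟩
  · obtain ⟨p, hp, e⟩ := stripValue_eq_dual (a := c) (b := d) (c := a) (d := b) hc.le ha.le
    refine ⟨_, Or.inr (Or.inr (Or.inl ⟨⟨h, Or.inl ha⟩, rfl⟩)), e.trans_le ?_⟩
    have := H.flip_horizontal.flip_vertical.strip_bound hp (x₀ := N - 1 - x) (by omega)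
      (by rw [show N - (N - 1 - x) = x + 1 by omega]; omega)
      (by rw [show N - (N - 1 - x + 1) = x by omega]; omega)
    refine this.trans (le_of_eq ?_)
    rw [← sum_flip_horizontal (fun y => f y - g y)]
    exact Finset.sum_congr rfl fun y _ => by ring

/-- Every column profile has at least the area of one of the candidates. -/
theorem exists_candidate_le (H : ColumnProfile a b c d N i j f g) :
    ∃ v, IsAreaCandidate a b c d v ∧ v ≤ ∑ y ∈ Finset.range (N + 1), (f y - g y) := by
  by_cases h1 : ∃ x < N, i x < a ∧ b < j (x + 1)
  · obtain ⟨x, hx, hi, hj⟩ := h1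
    exact H.exists_candidate_of_interleaved hx hi hj
  by_cases h2 : ∃ x < N, j x < b ∧ a < i (x + 1)
  · obtain ⟨x, hx, hi, hj⟩ := h2
    obtain ⟨v, hv, h⟩ := H.flip_vertical.exists_candidate_of_interleaved hx hi hj
    refine ⟨v, hv.flip H.a_nonneg H.b_nonneg H.c_nonneg H.d_nonneg, h.trans (le_of_eq ?_)⟩
    exact Finset.sum_congr rfl fun y _ => by ring
  · push Not at h1 h2
    obtain ⟨v, hv, h⟩ :=
      exists_candidate_le_compactValue H.a_nonneg H.b_nonneg H.c_nonneg H.d_nonneg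
    exact ⟨v, hv, h.trans (H.compact_bound h1 h2)⟩

end ColumnProfile

/-! ### Reading a polygon from an offset -/

theorem mem_uIcc_prod {u v w : ℤ × ℤ} : w ∈ Set.uIcc u v ↔
    (min u.1 v.1 ≤ w.1 ∧ w.1 ≤ max u.1 v.1) ∧ (min u.2 v.2 ≤ w.2 ∧ w.2 ≤ max u.2 v.2) := by
  simp only [Set.uIcc, Set.mem_Icc, Prod.le_def, Prod.fst_inf, Prod.snd_inf, Prod.fst_sup,
    Prod.snd_sup]
  tauto

theorem finRotate_ofNat {n : ℕ} [NeZero n] (k : ℕ) :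
    finRotate n (Fin.ofNat n k) = Fin.ofNat n (k + 1) := by
  obtain ⟨m, rfl⟩ := Nat.exists_eq_succ_of_ne_zero (NeZero.ne n)
  rw [finRotate_apply]
  ext
  simp [Fin.val_add, Fin.ofNat]

theorem ofNat_congr {n : ℕ} [NeZero n] {k l : ℕ} (h : k % n = l % n) :
    Fin.ofNat n k = Fin.ofNat n l := by
  ext; simpa [Fin.ofNat] using h

theorem exists_eq_ofNat {n : ℕ} [NeZero n] (o : ℕ) (i : Fin n) :
    ∃ k < n, i = Fin.ofNat n (o + k) := by
  have hn := Nat.pos_of_ne_zero (NeZero.ne n)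
  have ho := Nat.mod_lt o hn
  have hd := Nat.div_add_mod o n
  rcases le_or_gt (o % n) i with h | h
  · refine ⟨i - o % n, by omega, ?_⟩
    ext
    rw [Fin.val_ofNat, Nat.add_mod, Nat.mod_eq_of_lt (a := i - o % n) (by omega)]
    rw [show o % n + (i - o % n) = i by omega, Nat.mod_eq_of_lt i.2]
  · refine ⟨n + i - o % n, by omega, ?_⟩
    ext
    rw [Fin.val_ofNat, Nat.add_mod, Nat.mod_eq_of_lt (a := n + i - o % n) (by omega)]
    rw [show o % n + (n + i - o % n) = i + n by omega, Nat.add_mod_right, Nat.mod_eq_of_lt i.2]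

theorem ofNat_add_injective {n : ℕ} [NeZero n] {o k l : ℕ} (hk : k < n) (hl : l < n)
    (h : Fin.ofNat n (o + k) = Fin.ofNat n (o + l)) : k = l := by
  have h' : (o + k) % n = (o + l) % n := by simpa [Fin.ofNat] using h
  have : k ≡ l [MOD n] := Nat.ModEq.add_left_cancel' o h'
  exact this.eq_of_lt_of_lt hk hl

/-- The cross product of the vectors from `u` to `v` and from `v` to `w`. -/
def crossAt (u v w : ℤ × ℤ) : ℤ := (v.1 - u.1) * (w.2 - v.2) - (v.2 - u.2) * (w.1 - v.1)

/-- The conditions on a simple closed walk with `n` vertices, for a periodic parametrization. -/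
structure IsSimpleWalk (n : ℕ) (q : ℕ → ℤ × ℤ) : Prop where
  ne : ∀ k, q k ≠ q (k + 1)
  axis : ∀ k, (q k).1 = (q (k + 1)).1 ∨ (q k).2 = (q (k + 1)).2
  consecutive : ∀ k,
    Set.uIcc (q k) (q (k + 1)) ∩ Set.uIcc (q (k + 1)) (q (k + 2)) = {q (k + 1)}
  nonconsecutive : ∀ k l, l < n → k + 1 < l → ¬ (k = 0 ∧ l + 1 = n) →
    Disjoint (Set.uIcc (q k) (q (k + 1))) (Set.uIcc (q l) (q (l + 1)))

namespace GridCycle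

variable {n : ℕ} [NeZero n]

/-- The vertices of `P`, beginning with vertex `o`. -/
def walk (P : GridCycle n) (o k : ℕ) : ℤ × ℤ := P (Fin.ofNat n (o + k))

theorem walk_add_period (P : GridCycle n) (o k : ℕ) : P.walk o (k + n) = P.walk o k := by
  unfold walk
  rw [ofNat_congr]
  rw [← add_assoc, Nat.add_mod_right]

theorem walk_offset (P : GridCycle n) (o o' k : ℕ) : P.walk (o + o') k = P.walk o (o' + k) := by
  unfold walk; rw [add_assoc]

theorem succVertex_ofNat (P : GridCycle n) (o k : ℕ) :
    P.succVertex (Fin.ofNat n (o + k)) = P.walk o (k + 1) := by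
  unfold succVertex walk; rw [finRotate_ofNat, add_assoc]

theorem predVertex_ofNat (P : GridCycle n) (o k : ℕ) :
    P.predVertex (Fin.ofNat n (o + (k + 1))) = P.walk o k := by
  unfold predVertex walk
  rw [← add_assoc, ← finRotate_ofNat, Equiv.symm_apply_apply]

theorem edge_ofNat (P : GridCycle n) (o k : ℕ) :
    P.edge (Fin.ofNat n (o + k)) = Set.uIcc (P.walk o k) (P.walk o (k + 1)) := by
  unfold edge; rw [succVertex_ofNat]; rfl

theorem cross_ofNat (P : GridCycle n) (o k : ℕ) :
    P.cross (Fin.ofNat n (o + (k + 1))) =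
      crossAt (P.walk o k) (P.walk o (k + 1)) (P.walk o (k + 2)) := by
  unfold cross; rw [succVertex_ofNat, predVertex_ofNat]; rfl

/-- Replaces cyclic indices by a periodic walk with a free starting point. Pairs of edges are taken
in increasing order within one period, so the only wrap-around exception is the first edge paired
with the last. -/
theorem isSimpleRectilinear_iff (P : GridCycle n) (o : ℕ) :
    P.IsSimpleRectilinear ↔ 3 ≤ n ∧ IsSimpleWalk n (P.walk o) := by
  constructor
  · intro H
    refine ⟨H.three_le, ?_, ?_, ?_, ?_⟩
    · intro k
      have := H.ne_succ (Fin.ofNat n (o + k))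
      rwa [succVertex_ofNat] at this
    · intro k
      have := H.axis_parallel (Fin.ofNat n (o + k))
      rwa [succVertex_ofNat] at this
    · intro k
      have := H.consecutive (Fin.ofNat n (o + k))
      rwa [succVertex_ofNat, finRotate_ofNat, add_assoc, edge_ofNat, edge_ofNat] at this
    · intro k l hl hkl hkl'
      rw [← edge_ofNat, ← edge_ofNat]
      apply H.nonconsecutive
      · intro h
        have := ofNat_add_injective hl (by omega) h
        omega
      · rw [finRotate_ofNat, add_assoc]
        intro h
        have := ofNat_add_injective hl (by omega) h
        omega
      · rw [finRotate_ofNat, add_assoc]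
        intro h
        rcases (show l + 1 ≤ n by omega).eq_or_lt with h' | h'
        · rw [h', ofNat_congr (k := o + n) (l := o + 0) (by simp)] at h
          have := ofNat_add_injective (by omega) (by omega) h
          omega
        · have := ofNat_add_injective (by omega) h' h
          omega
  · rintro ⟨h3, H⟩
    refine ⟨h3, ?_, ?_, ?_, ?_⟩
    · intro i
      obtain ⟨k, -, rfl⟩ := exists_eq_ofNat o i
      rw [succVertex_ofNat]
      exact H.ne k
    · intro i
      obtain ⟨k, -, rfl⟩ := exists_eq_ofNat o i
      rw [succVertex_ofNat]
      exact H.axis k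
    · intro i
      obtain ⟨k, -, rfl⟩ := exists_eq_ofNat o i
      rw [succVertex_ofNat, finRotate_ofNat, add_assoc, edge_ofNat, edge_ofNat]
      exact H.consecutive k
    · intro i j h1 h2 h3
      obtain ⟨k, hk, rfl⟩ := exists_eq_ofNat o i
      obtain ⟨l, hl, rfl⟩ := exists_eq_ofNat o j
      rw [edge_ofNat, edge_ofNat]
      rw [finRotate_ofNat, add_assoc] at h2 h3
      have h1' : k ≠ l := fun h => h1 (by rw [h])
      have h2' : l ≠ k + 1 := fun h => h2 (by rw [h])
      have h3' : k ≠ l + 1 := fun h => h3 (by rw [h])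
      have h4 : ¬ (k = 0 ∧ l + 1 = n) := by
        rintro ⟨h, h'⟩
        exact h3 (ofNat_congr (by rw [h, h']; simp))
      have h5 : ¬ (l = 0 ∧ k + 1 = n) := by
        rintro ⟨h, h'⟩
        exact h2 (ofNat_congr (by rw [h, h']; simp))
      rcases lt_or_gt_of_ne h1' with h | h
      · exact H.nonconsecutive k l hl (by omega) h4
      · exact (H.nonconsecutive l k hk (by omega) h5).symm

theorem realizes_iff (P : GridCycle n) (S : Fin n → Turn) (o : ℕ) :
    P.Realizes S ↔ 3 ≤ n ∧ IsSimpleWalk n (P.walk o) ∧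
      (∀ k, (∀ l, (P.walk o (k + 1)).2 ≤ (P.walk o l).2) →
        0 < crossAt (P.walk o k) (P.walk o (k + 1)) (P.walk o (k + 2))) ∧
      ∀ k, match S (Fin.ofNat n (o + (k + 1))) with
        | Turn.left => 0 < crossAt (P.walk o k) (P.walk o (k + 1)) (P.walk o (k + 2))
        | Turn.right => crossAt (P.walk o k) (P.walk o (k + 1)) (P.walk o (k + 2)) < 0 := by
  have hn := Nat.pos_of_ne_zero (NeZero.ne n)
  have hsurj : ∀ i : Fin n, ∃ k, i = Fin.ofNat n (o + (k + 1)) := by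
    intro i
    obtain ⟨k, -, rfl⟩ := exists_eq_ofNat (o + 1) i
    exact ⟨k, by rw [add_assoc, add_comm 1 k]⟩
  constructor
  · intro H
    obtain ⟨h3, hs⟩ := (isSimpleRectilinear_iff P o).1 H.simple
    refine ⟨h3, hs, ?_, ?_⟩
    · intro k hk
      rw [← cross_ofNat]
      apply H.ccw
      intro j
      obtain ⟨l, -, rfl⟩ := exists_eq_ofNat o j
      exact hk l
    · intro k
      have := H.turns (Fin.ofNat n (o + (k + 1)))
      rw [← cross_ofNat]
      cases h : S (Fin.ofNat n (o + (k + 1))) <;> rw [h] at this <;> exact this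
  · rintro ⟨h3, hs, hc, ht⟩
    refine ⟨(isSimpleRectilinear_iff P o).2 ⟨h3, hs⟩, ?_, ?_⟩
    · intro i hi
      obtain ⟨k, rfl⟩ := hsurj i
      rw [cross_ofNat]
      exact hc k fun l => hi _
    · intro i
      obtain ⟨k, rfl⟩ := hsurj i
      have := ht k
      rw [← cross_ofNat] at this
      cases h : S (Fin.ofNat n (o + (k + 1))) <;> rw [h] at this <;> exact this

end GridCycle

/-! ### Closed walks that consist of two `x`-monotone chains -/

/-- The closed walk `q` runs leftwards along an upper chain with horizontal edges
`[X i, X (i + 1)] × {Y i}`, `i ≤ p`, and then rightwards along a lower chain with horizontal edges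
`[U j, U (j + 1)] × {Z j}`, `j ≤ r`. -/
structure Traces (p r : ℕ) (X Y U Z : ℕ → ℤ) (q : ℕ → ℤ × ℤ) : Prop where
  top : ∀ i e, i + e = p → q (2 * e) = (X (i + 1), Y i) ∧ q (2 * e + 1) = (X i, Y i)
  bot : ∀ j ≤ r, q (2 * p + 2 + 2 * j) = (U j, Z j) ∧ q (2 * p + 3 + 2 * j) = (U (j + 1), Z j)
  period : ∀ k, q (k + (2 * p + 2 * r + 4)) = q k
  X_lt : ∀ i ≤ p, X i < X (i + 1)
  U_lt : ∀ j ≤ r, U j < U (j + 1)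
  left : X 0 = U 0
  right : X (p + 1) = U (r + 1)

namespace Traces

variable {p r : ℕ} {X Y U Z : ℕ → ℤ} {q : ℕ → ℤ × ℤ}

theorem X_mono (H : Traces p r X Y U Z q) {i i' : ℕ} (h : i ≤ i') (h' : i' ≤ p + 1) :
    X i ≤ X i' := by
  induction i', h using Nat.le_induction with
  | base => rfl
  | succ k hk ih => exact (ih (by omega)).trans (H.X_lt k (by omega)).le

theorem U_mono (H : Traces p r X Y U Z q) {i i' : ℕ} (h : i ≤ i') (h' : i' ≤ r + 1) :
    U i ≤ U i' := by
  induction i', h using Nat.le_induction with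
  | base => rfl
  | succ k hk ih => exact (ih (by omega)).trans (H.U_lt k (by omega)).le

/-- Every overlapping pair is reached from the leftmost pair by passing one vertical edge at a time.
That edge lies in the horizontal range of the current edge of the other chain and misses it by
simplicity, so the vertical order of the two chains persists. -/
theorem no_crossing (H : Traces p r X Y U Z q) (hs : IsSimpleWalk (2 * p + 2 * r + 4) q) :
    ∀ m i j, i + j = m → i ≤ p → j ≤ r → X i ≤ U (j + 1) → U j ≤ X (i + 1) →
      (Z j < Y i ↔ Z 0 < Y 0) ∧ (Y i < Z j ↔ Y 0 < Z 0) := by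
  intro m
  induction m with
  | zero =>
    intro i j h
    obtain rfl : i = 0 := by omega
    obtain rfl : j = 0 := by omega
    simp
  | succ m ih =>
    intro i j h hi hj h1 h2
    by_cases hx : 1 ≤ i ∧ U j ≤ X i
    · obtain ⟨i, rfl⟩ : ∃ i', i = i' + 1 := ⟨i - 1, by omega⟩
      have hlt := H.X_lt i (by omega)
      have := ih i j (by omega) (by omega) hj (hlt.le.trans h1) hx.2
      rw [← this.1, ← this.2]
      obtain ⟨e, he⟩ : ∃ e, i + 1 + e = p := ⟨p - (i + 1), by omega⟩
      have hd := hs.nonconsecutive (2 * e + 1) (2 * p + 2 + 2 * j) (by omega) (by omega) (by omega)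
      rw [Set.disjoint_left] at hd
      have hd := @hd (X (i + 1), Z j)
      rw [mem_uIcc_prod, mem_uIcc_prod, (H.top (i + 1) e he).2, show 2 * e + 1 + 1 = 2 * (e + 1) by ring,
        (H.top i (e + 1) (by omega)).1, (H.bot j hj).1,
        show 2 * p + 2 + 2 * j + 1 = 2 * p + 3 + 2 * j by ring, (H.bot j hj).2] at hd
      dsimp only at hd
      omega
    · obtain ⟨j, rfl⟩ : ∃ j', j = j' + 1 := by
        refine ⟨j - 1, ?_⟩
        rcases Nat.eq_zero_or_pos j with h0 | h0
        · subst h0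
          have := H.left
          have := H.X_mono (i := 0) (i' := i) (by omega) (by omega)
          omega
        · omega
      have hlt := H.U_lt j (by omega)
      have hxu : X i ≤ U (j + 1) := by
        rcases Nat.eq_zero_or_pos i with h0 | h0
        · subst h0
          rw [H.left]; exact H.U_mono (by omega) (by omega)
        · omega
      have := ih i j (by omega) hi (by omega) hxu (hlt.le.trans h2)
      rw [← this.1, ← this.2]
      obtain ⟨e, he⟩ : ∃ e, i + e = p := ⟨p - i, by omega⟩
      have hd := hs.nonconsecutive (2 * e) (2 * p + 3 + 2 * j) (by omega) (by omega) (by omega)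
      rw [Set.disjoint_left] at hd
      have hd := @hd (U (j + 1), Y i)
      rw [mem_uIcc_prod, mem_uIcc_prod, (H.top i e he).1, (H.top i e he).2, (H.bot j (by omega)).2,
        show 2 * p + 3 + 2 * j + 1 = 2 * p + 2 + 2 * (j + 1) by ring, (H.bot (j + 1) hj).1] at hd
      dsimp only at hd
      omega

/-- Each upper edge overlaps some lower edge. -/
theorem exists_below (H : Traces p r X Y U Z q) {i : ℕ} (hi : i ≤ p) :
    ∃ j ≤ r, X i ≤ U (j + 1) ∧ U j ≤ X (i + 1) := by
  have hex : ∃ j, j ≤ r ∧ X i ≤ U (j + 1) :=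
    ⟨r, le_rfl, by rw [← H.right]; exact H.X_mono (by omega) le_rfl⟩
  classical
  have hmin := @Nat.find_min _ _ hex
  obtain ⟨h1, h2⟩ := Nat.find_spec hex
  generalize Nat.find hex = j at *
  refine ⟨j, h1, h2, ?_⟩
  rcases Nat.eq_zero_or_pos j with h0 | h0
  · subst h0
    rw [← H.left]; exact H.X_mono (by omega) (by omega)
  · have := hmin (m := j - 1) (by omega)
    rw [show j - 1 + 1 = j by omega] at this
    have := H.X_lt i hi
    omega

/-- Each lower edge overlaps some upper edge. -/
theorem exists_above (H : Traces p r X Y U Z q) {j : ℕ} (hj : j ≤ r) :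
    ∃ i ≤ p, X i ≤ U (j + 1) ∧ U j ≤ X (i + 1) := by
  have hex : ∃ i, i ≤ p ∧ U j ≤ X (i + 1) :=
    ⟨p, le_rfl, by rw [H.right]; exact H.U_mono (by omega) le_rfl⟩
  classical
  have hmin := @Nat.find_min _ _ hex
  obtain ⟨h1, h2⟩ := Nat.find_spec hex
  generalize Nat.find hex = i at *
  refine ⟨i, h1, ?_, h2⟩
  rcases Nat.eq_zero_or_pos i with h0 | h0
  · subst h0
    rw [H.left]; exact H.U_mono (by omega) (by omega)
  · have := hmin (m := i - 1) (by omega)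
    rw [show i - 1 + 1 = i by omega] at this
    have := H.U_lt j hj
    omega

/-- A closed walk traces two chains if its edges are horizontal and vertical in turns, and the
horizontal ones first go to the left and then to the right. -/
theorem of_edges (hper : ∀ k, q (k + (2 * p + 2 * r + 4)) = q k)
    (htop : ∀ e ≤ p, (q (2 * e + 1)).1 < (q (2 * e)).1 ∧ (q (2 * e + 1)).2 = (q (2 * e)).2)
    (htop' : ∀ e ≤ p, (q (2 * e + 2)).1 = (q (2 * e + 1)).1)
    (hbot : ∀ e ≤ r, (q (2 * p + 2 + 2 * e)).1 < (q (2 * p + 3 + 2 * e)).1 ∧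
      (q (2 * p + 3 + 2 * e)).2 = (q (2 * p + 2 + 2 * e)).2)
    (hbot' : ∀ e ≤ r, (q (2 * p + 4 + 2 * e)).1 = (q (2 * p + 3 + 2 * e)).1) :
    Traces p r (fun i => (q (2 * (p + 1 - i))).1) (fun i => (q (2 * (p - i))).2)
      (fun j => (q (2 * p + 2 + 2 * j)).1) (fun j => (q (2 * p + 2 + 2 * j)).2) q where
  top i e h := by
    rw [show p + 1 - (i + 1) = e by omega, show p - i = e by omega, show p + 1 - i = e + 1 by omega,
      show 2 * (e + 1) = 2 * e + 2 by ring, htop' e (by omega), ← (htop e (by omega)).2]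
    exact ⟨by rw [(htop e (by omega)).2], rfl⟩
  bot j h := by
    rw [show 2 * p + 2 + 2 * (j + 1) = 2 * p + 4 + 2 * j by ring, hbot' j h, ← (hbot j h).2]
    exact ⟨by rw [(hbot j h).2], rfl⟩
  period := hper
  X_lt i h := by
    obtain ⟨e, he⟩ : ∃ e, i + e = p := ⟨p - i, by omega⟩
    rw [show p + 1 - (i + 1) = e by omega, show p + 1 - i = e + 1 by omega,
      show 2 * (e + 1) = 2 * e + 2 by ring, htop' e (by omega)]
    exact (htop e (by omega)).1
  U_lt j h := by
    rw [show 2 * p + 2 + 2 * (j + 1) = 2 * p + 4 + 2 * j by ring, hbot' j h]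
    exact (hbot j h).1
  left := by simp [mul_add]
  right := by
    rw [Nat.sub_self, ← hper (2 * 0)]
    congr 2; ring

end Traces

/-! ### Directions of the edges, and the profile of a realization -/

/-- The conditions on the coordinates of two chains that bound a polygon whose four stairs have
`a`, `b`, `c` and `d` reflex vertices. -/
structure IsProfile (a b c d : ℕ) (X Y U Z : ℕ → ℤ) : Prop where
  X_lt : ∀ i ≤ a + d, X i < X (i + 1)
  U_lt : ∀ j ≤ b + c, U j < U (j + 1)
  left : X 0 = U 0
  right : X (a + d + 1) = U (b + c + 1)
  Y_up : ∀ i < a, Y i < Y (i + 1)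
  Y_down : ∀ i, a ≤ i → i < a + d → Y (i + 1) < Y i
  Z_down : ∀ j < b, Z (j + 1) < Z j
  Z_up : ∀ j, b ≤ j → j < b + c → Z j < Z (j + 1)
  separated : ∀ i j, i ≤ a + d → j ≤ b + c → X i ≤ U (j + 1) → U j ≤ X (i + 1) → Z j < Y i

/-- The turn at vertex `k` of a polygon with four stairs, starting at the right end of the upper
chain. -/
def stairTurn (a b _c d k : ℕ) : Turn :=
  if k < 2 * (a + d) + 2 then
    if k % 2 = 0 then if k / 2 ≤ d then Turn.left else Turn.right
    else if d ≤ k / 2 then Turn.left else Turn.right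
  else
    if k % 2 = 0 then if (k - (2 * (a + d) + 2)) / 2 ≤ b then Turn.left else Turn.right
    else if b ≤ (k - (2 * (a + d) + 2)) / 2 then Turn.left else Turn.right

theorem stairTurn_top_even {a b c d e : ℕ} (he : e ≤ a + d) :
    stairTurn a b c d (2 * e) = if e ≤ d then Turn.left else Turn.right := by
  unfold stairTurn
  rw [if_pos (by omega), if_pos (by omega), Nat.mul_div_cancel_left e two_pos]

theorem stairTurn_top_odd {a b c d e : ℕ} (he : e ≤ a + d) :
    stairTurn a b c d (2 * e + 1) = if d ≤ e then Turn.left else Turn.right := by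
  unfold stairTurn
  rw [if_pos (by omega), if_neg (by omega), show (2 * e + 1) / 2 = e by omega]

theorem stairTurn_bot_even {a b c d : ℕ} (e : ℕ) :
    stairTurn a b c d (2 * (a + d) + 2 + 2 * e) = if e ≤ b then Turn.left else Turn.right := by
  unfold stairTurn
  rw [if_neg (by omega), if_pos (by omega),
    show (2 * (a + d) + 2 + 2 * e - (2 * (a + d) + 2)) / 2 = e by omega]

theorem stairTurn_bot_odd {a b c d : ℕ} (e : ℕ) :
    stairTurn a b c d (2 * (a + d) + 3 + 2 * e) = if b ≤ e then Turn.left else Turn.right := by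
  unfold stairTurn
  rw [if_neg (by omega), if_neg (by omega),
    show (2 * (a + d) + 3 + 2 * e - (2 * (a + d) + 2)) / 2 = e by omega]

/-- Case distinction for a position on the closed walk along two chains with `p + 1` and `r + 1`
horizontal edges. -/
theorem chain_cases (p : ℕ) {r k : ℕ} (hk : k < 2 * p + 2 * r + 4) :
    (∃ e ≤ p, k = 2 * e) ∨ (∃ e ≤ p, k = 2 * e + 1) ∨
    (∃ e ≤ r, k = 2 * p + 2 + 2 * e) ∨ (∃ e ≤ r, k = 2 * p + 3 + 2 * e) := by
  rcases lt_or_ge k (2 * p + 2) with h | h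
  · rcases Nat.even_or_odd' k with ⟨e, he | he⟩
    · exact Or.inl ⟨e, by omega, he⟩
    · exact Or.inr (Or.inl ⟨e, by omega, he⟩)
  · rcases Nat.even_or_odd' (k - (2 * p + 2)) with ⟨e, he | he⟩
    · exact Or.inr (Or.inr (Or.inl ⟨e, by omega, by omega⟩))
    · exact Or.inr (Or.inr (Or.inr ⟨e, by omega, by omega⟩))

/-- The reading begins with the `2 * d` vertices of one stair and a separator; the position after
them starts the stair with `a` reflex vertices. -/
theorem stairTurn_rotate {a b c d k : ℕ} (hk : k < 2 * (a + b + c + d) + 4) :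
    stairTurn a b c d ((k + (2 * d + 1)) % (2 * (a + b + c + d) + 4)) = stairTurn b c d a k := by
  rcases chain_cases (b + a) (r := c + d) (k := k) (by omega) with
    ⟨e, he, rfl⟩ | ⟨e, he, rfl⟩ | ⟨e, he, rfl⟩ | ⟨e, he, rfl⟩
  · rw [stairTurn_top_even he, Nat.mod_eq_of_lt (by omega)]
    by_cases h : e ≤ a
    · rw [if_pos h, show 2 * e + (2 * d + 1) = 2 * (e + d) + 1 by ring,
        stairTurn_top_odd (by omega), if_pos (by omega)]
    · obtain ⟨f, rfl⟩ : ∃ f, e = a + 1 + f := ⟨e - (a + 1), by omega⟩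
      rw [if_neg h, show 2 * (a + 1 + f) + (2 * d + 1) = 2 * (a + d) + 3 + 2 * f by ring,
        stairTurn_bot_odd, if_neg (by omega)]
  · rw [stairTurn_top_odd he, Nat.mod_eq_of_lt (by omega)]
    by_cases h : a ≤ e
    · obtain ⟨f, rfl⟩ : ∃ f, e = a + f := ⟨e - a, by omega⟩
      rw [if_pos h, show 2 * (a + f) + 1 + (2 * d + 1) = 2 * (a + d) + 2 + 2 * f by ring,
        stairTurn_bot_even, if_pos (by omega)]
    · rw [if_neg h, show 2 * e + 1 + (2 * d + 1) = 2 * (e + d + 1) by ring,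
        stairTurn_top_even (by omega), if_neg (by omega)]
  · rw [stairTurn_bot_even]
    by_cases h : e ≤ c
    · rw [if_pos h, Nat.mod_eq_of_lt (by omega),
        show 2 * (b + a) + 2 + 2 * e + (2 * d + 1) = 2 * (a + d) + 3 + 2 * (b + e) by ring,
        stairTurn_bot_odd, if_pos (by omega)]
    · obtain ⟨f, rfl⟩ : ∃ f, e = c + 1 + f := ⟨e - (c + 1), by omega⟩
      rw [if_neg h, show 2 * (b + a) + 2 + 2 * (c + 1 + f) + (2 * d + 1) =
        2 * f + 1 + (2 * (a + b + c + d) + 4) by ring, Nat.add_mod_right,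
        Nat.mod_eq_of_lt (by omega), stairTurn_top_odd (by omega), if_neg (by omega)]
  · rw [stairTurn_bot_odd]
    by_cases h : c ≤ e
    · obtain ⟨f, rfl⟩ : ∃ f, e = c + f := ⟨e - c, by omega⟩
      rw [if_pos h, show 2 * (b + a) + 3 + 2 * (c + f) + (2 * d + 1) =
        2 * f + (2 * (a + b + c + d) + 4) by ring, Nat.add_mod_right,
        Nat.mod_eq_of_lt (by omega), stairTurn_top_even (by omega), if_pos (by omega)]
    · rw [if_neg h, Nat.mod_eq_of_lt (by omega),
        show 2 * (b + a) + 3 + 2 * e + (2 * d + 1) = 2 * (a + d) + 2 + 2 * (b + e + 1) by ring,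
        stairTurn_bot_even, if_neg (by omega)]

/-! ### Edge directions determined by the turns -/

/-- Rotation by a quarter turn. -/
def quarter (u : ℤ × ℤ) : ℤ × ℤ := (-u.2, u.1)

theorem quarter_neg (u : ℤ × ℤ) : quarter (-u) = -quarter u := by simp [quarter]

theorem quarter_quarter (u : ℤ × ℤ) : quarter (quarter u) = -u := by
  ext <;> simp [quarter]

/-- The four axis directions. -/
def IsAxisDir (u : ℤ × ℤ) : Prop := u = (-1, 0) ∨ u = (0, -1) ∨ u = (1, 0) ∨ u = (0, 1)

theorem IsAxisDir.quarter {u : ℤ × ℤ} (h : IsAxisDir u) : IsAxisDir (quarter u) := by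
  rcases h with rfl | rfl | rfl | rfl <;> simp [IsAxisDir, _root_.quarter]

theorem IsAxisDir.neg {u : ℤ × ℤ} (h : IsAxisDir u) : IsAxisDir (-u) := by
  rcases h with rfl | rfl | rfl | rfl <;> simp [IsAxisDir]

/-- The segment from `v` to `w` has direction `u`. -/
def Heads (u v w : ℤ × ℤ) : Prop :=
  0 < u.1 * (w.1 - v.1) + u.2 * (w.2 - v.2) ∧ u.1 * (w.2 - v.2) = u.2 * (w.1 - v.1)

theorem exists_heads {v w : ℤ × ℤ} (hne : v ≠ w) (hax : v.1 = w.1 ∨ v.2 = w.2) :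
    ∃ u, IsAxisDir u ∧ Heads u v w := by
  have : v.1 ≠ w.1 ∨ v.2 ≠ w.2 := by
    by_contra h; push Not at h; exact hne (Prod.ext h.1 h.2)
  unfold IsAxisDir Heads
  rcases lt_trichotomy v.1 w.1 with h | h | h
  · exact ⟨(1, 0), by simp, by simp; omega⟩
  · rcases lt_or_gt_of_ne (show v.2 ≠ w.2 by omega) with h' | h'
    · exact ⟨(0, 1), by simp, by simp; omega⟩
    · exact ⟨(0, -1), by simp, by simp; omega⟩
  · exact ⟨(-1, 0), by simp, by simp; omega⟩

theorem Heads.left_turn {u v w z : ℤ × ℤ} (hu : IsAxisDir u) (h : Heads u v w)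
    (hax : w.1 = z.1 ∨ w.2 = z.2) (hc : 0 < crossAt v w z) : Heads (quarter u) w z := by
  unfold crossAt at hc
  unfold Heads quarter at *
  replace hax : z.1 - w.1 = 0 ∨ z.2 - w.2 = 0 := by omega
  generalize z.1 - w.1 = y₁, z.2 - w.2 = y₂, w.1 - v.1 = x₁, w.2 - v.2 = x₂ at *
  rcases hu with rfl | rfl | rfl | rfl <;> rcases hax with rfl | rfl <;> simp at * <;>
    obtain ⟨h1, h2⟩ := h <;> first | (subst h2; simp at hc) | nlinarith

theorem Heads.right_turn {u v w z : ℤ × ℤ} (hu : IsAxisDir u) (h : Heads u v w)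
    (hax : w.1 = z.1 ∨ w.2 = z.2) (hc : crossAt v w z < 0) : Heads (-quarter u) w z := by
  unfold crossAt at hc
  unfold Heads quarter at *
  replace hax : z.1 - w.1 = 0 ∨ z.2 - w.2 = 0 := by omega
  generalize z.1 - w.1 = y₁, z.2 - w.2 = y₂, w.1 - v.1 = x₁, w.2 - v.2 = x₂ at *
  rcases hu with rfl | rfl | rfl | rfl <;> rcases hax with rfl | rfl <;> simp at * <;>
    obtain ⟨h1, h2⟩ := h <;> first | (subst h2; simp at hc) | nlinarith

/-- The direction of the edge from vertex `k` of a polygon with four stairs whose first edge has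
direction `u`. -/
def stairDir (a b d : ℕ) (u : ℤ × ℤ) (k : ℕ) : ℤ × ℤ :=
  if k < 2 * (a + d) + 2 then
    if k % 2 = 0 then u else if k / 2 < d then -quarter u else quarter u
  else
    if k % 2 = 0 then -u
    else if (k - (2 * (a + d) + 2)) / 2 < b then quarter u else -quarter u

theorem isAxisDir_stairDir {a b d : ℕ} {u : ℤ × ℤ} (hu : IsAxisDir u) (k : ℕ) :
    IsAxisDir (stairDir a b d u k) := by
  unfold stairDir
  split_ifs
  exacts [hu, hu.quarter.neg, hu.quarter, hu.neg, hu.quarter, hu.quarter.neg]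

theorem stairDir_top_even {a b d e : ℕ} (u : ℤ × ℤ) (he : e ≤ a + d) :
    stairDir a b d u (2 * e) = u := by
  unfold stairDir
  rw [if_pos (by omega), if_pos (by omega)]

theorem stairDir_top_odd {a b d e : ℕ} (u : ℤ × ℤ) (he : e ≤ a + d) :
    stairDir a b d u (2 * e + 1) = if e < d then -quarter u else quarter u := by
  unfold stairDir
  rw [if_pos (by omega), if_neg (by omega), show (2 * e + 1) / 2 = e by omega]

theorem stairDir_bot_even {a b d : ℕ} (u : ℤ × ℤ) (e : ℕ) :
    stairDir a b d u (2 * (a + d) + 2 + 2 * e) = -u := by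
  unfold stairDir
  rw [if_neg (by omega), if_pos (by omega)]

theorem stairDir_bot_odd {a b d : ℕ} (u : ℤ × ℤ) (e : ℕ) :
    stairDir a b d u (2 * (a + d) + 3 + 2 * e) = if e < b then quarter u else -quarter u := by
  unfold stairDir
  rw [if_neg (by omega), if_neg (by omega),
    show (2 * (a + d) + 3 + 2 * e - (2 * (a + d) + 2)) / 2 = e by omega]

theorem stairDir_succ {a b c d : ℕ} (u : ℤ × ℤ) {k : ℕ} (hk : k + 1 < 2 * (a + b + c + d) + 4) :
    stairDir a b d u (k + 1) = match stairTurn a b c d (k + 1) with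
      | Turn.left => quarter (stairDir a b d u k)
      | Turn.right => -quarter (stairDir a b d u k) := by
  rcases chain_cases (a + d) (r := b + c) (k := k) (by omega) with
    ⟨e, he, rfl⟩ | ⟨e, he, rfl⟩ | ⟨e, he, rfl⟩ | ⟨e, he, rfl⟩
  · rw [stairDir_top_even u he, stairDir_top_odd u he, stairTurn_top_odd he]
    by_cases h : e < d
    · rw [if_pos h, if_neg (by omega)]
    · rw [if_neg h, if_pos (by omega)]
  · rw [stairDir_top_odd u he]
    rcases he.eq_or_lt with rfl | he'
    · rw [show 2 * (a + d) + 1 + 1 = 2 * (a + d) + 2 + 2 * 0 by ring, stairDir_bot_even,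
        stairTurn_bot_even, if_pos (by omega), if_neg (by omega), quarter_quarter]
    · rw [show 2 * e + 1 + 1 = 2 * (e + 1) by ring, stairDir_top_even u he', stairTurn_top_even he']
      by_cases h : e < d
      · rw [if_pos h, if_pos (by omega), quarter_neg, quarter_quarter, neg_neg]
      · rw [if_neg h, if_neg (by omega), quarter_quarter, neg_neg]
  · rw [stairDir_bot_even, show 2 * (a + d) + 2 + 2 * e + 1 = 2 * (a + d) + 3 + 2 * e by ring,
      stairDir_bot_odd, stairTurn_bot_odd, quarter_neg]
    by_cases h : e < b
    · rw [if_pos h, if_neg (by omega), neg_neg]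
    · rw [if_neg h, if_pos (by omega)]
  · rw [stairDir_bot_odd, show 2 * (a + d) + 3 + 2 * e + 1 = 2 * (a + d) + 2 + 2 * (e + 1) by ring,
      stairDir_bot_even, stairTurn_bot_even]
    by_cases h : e < b
    · rw [if_pos h, if_pos (by omega), quarter_quarter]
    · rw [if_neg h, if_neg (by omega), quarter_neg, quarter_quarter, neg_neg]

/-- A turn and the direction of the entering edge determine the direction of the leaving edge, so
the first direction propagates along the whole walk. -/
theorem heads_stairDir {n : ℕ} {a b c d : ℕ} (hn : n = 2 * (a + b + c + d) + 4)
    {q : ℕ → ℤ × ℤ} (hs : IsSimpleWalk n q)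
    (ht : ∀ k, k + 1 < n → match stairTurn a b c d (k + 1) with
        | Turn.left => 0 < crossAt (q k) (q (k + 1)) (q (k + 2))
        | Turn.right => crossAt (q k) (q (k + 1)) (q (k + 2)) < 0)
    {u : ℤ × ℤ} (hu : IsAxisDir u) (h0 : Heads u (q 0) (q 1)) :
    ∀ k < n, Heads (stairDir a b d u k) (q k) (q (k + 1)) := by
  intro k
  induction k with
  | zero => intro _; simpa [stairDir] using h0
  | succ k ih =>
    intro hk
    have := ht k hk
    rw [stairDir_succ (c := c) u (hn ▸ hk)]
    cases h : stairTurn a b c d (k + 1) <;> rw [h] at this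
    · exact (ih (by omega)).left_turn (isAxisDir_stairDir hu k) (hs.axis (k + 1)) this
    · exact (ih (by omega)).right_turn (isAxisDir_stairDir hu k) (hs.axis (k + 1)) this

/-- The two chains of a simple closed walk with standard edge directions form a profile. -/
theorem exists_profile_of_heads {a b c d : ℕ} {q : ℕ → ℤ × ℤ}
    (hs : IsSimpleWalk (2 * (a + b + c + d) + 4) q)
    (hper : ∀ k, q (k + (2 * (a + b + c + d) + 4)) = q k)
    (hd : ∀ k < 2 * (a + b + c + d) + 4, Heads (stairDir a b d (-1, 0) k) (q k) (q (k + 1))) :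
    ∃ X Y U Z, IsProfile a b c d X Y U Z ∧ Traces (a + d) (b + c) X Y U Z q := by
  have hn : 2 * (a + b + c + d) + 4 = 2 * (a + d) + 2 * (b + c) + 4 := by ring
  have htop : ∀ e ≤ a + d,
      (q (2 * e + 1)).1 < (q (2 * e)).1 ∧ (q (2 * e + 1)).2 = (q (2 * e)).2 := by
    intro e he
    have := hd (2 * e) (by omega)
    rw [stairDir_top_even _ he] at this
    simp [Heads] at this
    omega
  have htop1 : ∀ e < d,
      (q (2 * e + 2)).1 = (q (2 * e + 1)).1 ∧ (q (2 * e + 1)).2 < (q (2 * e + 2)).2 := by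
    intro e he
    have := hd (2 * e + 1) (by omega)
    rw [stairDir_top_odd _ (by omega), if_pos (by omega)] at this
    simp [Heads, quarter, add_assoc] at this
    omega
  have htop2 : ∀ e ≤ a + d, d ≤ e →
      (q (2 * e + 2)).1 = (q (2 * e + 1)).1 ∧ (q (2 * e + 2)).2 < (q (2 * e + 1)).2 := by
    intro e he he'
    have := hd (2 * e + 1) (by omega)
    rw [stairDir_top_odd _ (by omega), if_neg (by omega)] at this
    simp [Heads, quarter, add_assoc] at this
    omega
  have hbot : ∀ e ≤ b + c, (q (2 * (a + d) + 2 + 2 * e)).1 < (q (2 * (a + d) + 3 + 2 * e)).1 ∧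
      (q (2 * (a + d) + 3 + 2 * e)).2 = (q (2 * (a + d) + 2 + 2 * e)).2 := by
    intro e he
    have := hd (2 * (a + d) + 2 + 2 * e) (by omega)
    rw [stairDir_bot_even,
      show 2 * (a + d) + 2 + 2 * e + 1 = 2 * (a + d) + 3 + 2 * e by ring] at this
    simp [Heads] at this
    omega
  have hbot1 : ∀ e < b, (q (2 * (a + d) + 4 + 2 * e)).1 = (q (2 * (a + d) + 3 + 2 * e)).1 ∧
      (q (2 * (a + d) + 4 + 2 * e)).2 < (q (2 * (a + d) + 3 + 2 * e)).2 := by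
    intro e he
    have := hd (2 * (a + d) + 3 + 2 * e) (by omega)
    rw [stairDir_bot_odd, if_pos (by omega),
      show 2 * (a + d) + 3 + 2 * e + 1 = 2 * (a + d) + 4 + 2 * e by ring] at this
    simp [Heads, quarter] at this
    omega
  have hbot2 : ∀ e ≤ b + c, b ≤ e →
      (q (2 * (a + d) + 4 + 2 * e)).1 = (q (2 * (a + d) + 3 + 2 * e)).1 ∧
      (q (2 * (a + d) + 3 + 2 * e)).2 < (q (2 * (a + d) + 4 + 2 * e)).2 := by
    intro e he he'
    have := hd (2 * (a + d) + 3 + 2 * e) (by omega)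
    rw [stairDir_bot_odd, if_neg (by omega),
      show 2 * (a + d) + 3 + 2 * e + 1 = 2 * (a + d) + 4 + 2 * e by ring] at this
    simp [Heads, quarter] at this
    omega
  have tr := Traces.of_edges (p := a + d) (r := b + c) (q := q) (by rw [← hn]; exact hper) htop
    (fun e he => by
      rcases lt_or_ge e d with h | h
      · exact (htop1 e h).1
      · exact (htop2 e he h).1) hbot
    (fun e he => by
      rcases lt_or_ge e b with h | h
      · exact (hbot1 e h).1
      · exact (hbot2 e he h).1)
  -- The vertical edge at the left end descends. This orders the two leftmost edges, and
  -- `no_crossing` carries the order to all overlapping pairs.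
  have hyz : (q (2 * (a + d) + 2 + 2 * 0)).2 < (q (2 * (a + d - 0))).2 := by
    have h1 := htop2 (a + d) le_rfl (by omega)
    have h2 := htop (a + d) le_rfl
    simp only [mul_zero, add_zero, Nat.sub_zero]
    omega
  refine ⟨_, _, _, _, ⟨tr.X_lt, tr.U_lt, tr.left, tr.right, ?_, ?_, ?_, ?_, ?_⟩, tr⟩
  · intro i hi
    obtain ⟨e, he⟩ : ∃ e, i + 1 + e = a + d := ⟨a + d - (i + 1), by omega⟩
    rw [show a + d - i = e + 1 by omega, show a + d - (i + 1) = e by omega]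
    have h1 := htop2 e (by omega) (by omega)
    have h2 := htop e (by omega)
    rw [show 2 * (e + 1) = 2 * e + 2 by ring]
    omega
  · intro i hi hi'
    obtain ⟨e, he⟩ : ∃ e, i + 1 + e = a + d := ⟨a + d - (i + 1), by omega⟩
    rw [show a + d - i = e + 1 by omega, show a + d - (i + 1) = e by omega]
    have h1 := htop1 e (by omega)
    have h2 := htop e (by omega)
    rw [show 2 * (e + 1) = 2 * e + 2 by ring]
    omega
  · intro e he
    have h1 := hbot1 e he
    have h2 := hbot e (by omega)
    rw [show 2 * (a + d) + 2 + 2 * (e + 1) = 2 * (a + d) + 4 + 2 * e by ring]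
    omega
  · intro e he he'
    have h1 := hbot2 e (by omega) he
    have h2 := hbot e (by omega)
    rw [show 2 * (a + d) + 2 + 2 * (e + 1) = 2 * (a + d) + 4 + 2 * e by ring]
    omega
  · intro i j hi hj h1 h2
    exact (tr.no_crossing (by rw [← hn]; exact hs) (i + j) i j rfl hi hj h1 h2).1.2 hyz

/-- `(a', b', c', d')` arises from `(a, b, c, d)` by a cyclic rotation. -/
def IsCyclicShift (a b c d a' b' c' d' : ℕ) : Prop :=
  (a' = a ∧ b' = b ∧ c' = c ∧ d' = d) ∨ (a' = b ∧ b' = c ∧ c' = d ∧ d' = a) ∨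
  (a' = c ∧ b' = d ∧ c' = a ∧ d' = b) ∨ (a' = d ∧ b' = a ∧ c' = b ∧ d' = c)

/-- `S`, read from position `o`, consists of four stairs with `a`, `b`, `c`, `d` reflex vertices. -/
def StairsFrom {n : ℕ} [NeZero n] (S : Fin n → Turn) (o a b c d : ℕ) : Prop :=
  n = 2 * (a + b + c + d) + 4 ∧ ∀ k < n, S (Fin.ofNat n (o + k)) = stairTurn a b c d k

theorem StairsFrom.rotate {n : ℕ} [NeZero n] {S : Fin n → Turn} {o a b c d : ℕ}
    (h : StairsFrom S o a b c d) : StairsFrom S (o + (2 * d + 1)) b c d a := by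
  obtain ⟨hn, hS⟩ := h
  refine ⟨by omega, fun k hk => ?_⟩
  rw [← stairTurn_rotate (hn ▸ hk), ← hS _ (by rw [hn]; exact Nat.mod_lt _ (by omega))]
  congr 1
  apply ofNat_congr
  rw [← hn, Nat.add_mod_mod]
  congr 1; ring

namespace GridCycle

variable {n : ℕ} [NeZero n] {P : GridCycle n} {S : Fin n → Turn}

theorem Realizes.heads (hP : P.Realizes S) {o a b c d : ℕ} (h : StairsFrom S o a b c d)
    {u : ℤ × ℤ} (hu : IsAxisDir u) (h0 : Heads u (P.walk o 0) (P.walk o 1)) :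
    ∀ k < n, Heads (stairDir a b d u k) (P.walk o k) (P.walk o (k + 1)) := by
  obtain ⟨-, hs, -, ht⟩ := (realizes_iff P S o).1 hP
  refine heads_stairDir h.1 hs (fun k hk => ?_) hu h0
  rw [← h.2 (k + 1) hk]
  exact ht k

theorem Realizes.exists_profile_of_left (hP : P.Realizes S) {o a b c d : ℕ}
    (h : StairsFrom S o a b c d) (h0 : Heads (-1, 0) (P.walk o 0) (P.walk o 1)) :
    ∃ X Y U Z, IsProfile a b c d X Y U Z ∧ Traces (a + d) (b + c) X Y U Z (P.walk o) := by
  obtain ⟨-, hs, -, -⟩ := (realizes_iff P S o).1 hP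
  have := hP.heads h (Or.inl rfl) h0
  refine exists_profile_of_heads (h.1 ▸ hs) (fun k => ?_) (h.1 ▸ this)
  rw [← h.1]; exact walk_add_period P o k

theorem Realizes.heads_rotate (hP : P.Realizes S) {o a b c d : ℕ} (h : StairsFrom S o a b c d)
    {u : ℤ × ℤ} (hu : IsAxisDir u) (h0 : Heads u (P.walk o 0) (P.walk o 1)) :
    Heads (quarter u) (P.walk (o + (2 * d + 1)) 0) (P.walk (o + (2 * d + 1)) 1) := by
  have := hP.heads h hu h0 (2 * d + 1) (by have := h.1; omega)
  rw [walk_offset, walk_offset]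
  rwa [stairDir_top_odd _ (by omega), if_neg (by omega)] at this

/-- Every realization of an angle sequence with four stairs is bounded by two chains that form a
profile. -/
theorem Realizes.exists_profile (hP : P.Realizes S) {o a b c d : ℕ}
    (h : StairsFrom S o a b c d) :
    ∃ a' b' c' d' o' X Y U Z, IsCyclicShift a b c d a' b' c' d' ∧ StairsFrom S o' a' b' c' d' ∧
      IsProfile a' b' c' d' X Y U Z ∧ Traces (a' + d') (b' + c') X Y U Z (P.walk o') := by
  obtain ⟨-, hs, -, -⟩ := (realizes_iff P S o).1 hP
  -- Moving the start of the reading to the next stair turns the direction of the first edge by a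
  -- quarter, so one of the four readings starts with an edge to the left.
  obtain ⟨u, hu, h0⟩ := exists_heads (hs.ne 0) (hs.axis 0)
  have h1 := hP.heads_rotate h hu h0
  have h2 := hP.heads_rotate h.rotate hu.quarter h1
  have h3 := hP.heads_rotate h.rotate.rotate hu.quarter.quarter h2
  rcases hu with rfl | rfl | rfl | rfl
  · obtain ⟨X, Y, U, Z, H⟩ := hP.exists_profile_of_left h h0
    exact ⟨_, _, _, _, _, X, Y, U, Z, by unfold IsCyclicShift; omega, h, H⟩
  · obtain ⟨X, Y, U, Z, H⟩ := hP.exists_profile_of_left h.rotate.rotate.rotate h3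
    exact ⟨_, _, _, _, _, X, Y, U, Z, by unfold IsCyclicShift; omega, h.rotate.rotate.rotate, H⟩
  · obtain ⟨X, Y, U, Z, H⟩ := hP.exists_profile_of_left h.rotate.rotate h2
    exact ⟨_, _, _, _, _, X, Y, U, Z, by unfold IsCyclicShift; omega, h.rotate.rotate, H⟩
  · obtain ⟨X, Y, U, Z, H⟩ := hP.exists_profile_of_left h.rotate h1
    exact ⟨_, _, _, _, _, X, Y, U, Z, by unfold IsCyclicShift; omega, h.rotate, H⟩

end GridCycle

/-! ### Profiles bound simple polygons -/

theorem uIcc_inter_uIcc_of_perp {u v w : ℤ × ℤ}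
    (h : (u.2 = v.2 ∧ v.1 = w.1) ∨ (u.1 = v.1 ∧ v.2 = w.2)) :
    Set.uIcc u v ∩ Set.uIcc v w = {v} := by
  ext z
  rw [Set.mem_inter_iff, mem_uIcc_prod, mem_uIcc_prod, Set.mem_singleton_iff, Prod.ext_iff]
  omega

namespace Traces

variable {p r : ℕ} {X Y U Z : ℕ → ℤ} {q : ℕ → ℤ × ℤ}

theorem map_mod (H : Traces p r X Y U Z q) (k : ℕ) : q (k % (2 * p + 2 * r + 4)) = q k :=
  Function.Periodic.map_mod_nat H.period k

theorem top_eq (H : Traces p r X Y U Z q) {k : ℕ} (hk : k < 2 * p + 2) :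
    q k = (X (p + 1 - (k + 1) / 2), Y (p - k / 2)) := by
  rcases Nat.even_or_odd' k with ⟨e, rfl | rfl⟩
  · rw [(H.top (p - e) e (by omega)).1]
    congr 2 <;> omega
  · rw [(H.top (p - e) e (by omega)).2]
    congr 2 <;> omega

theorem bot_eq (H : Traces p r X Y U Z q) {k : ℕ} (hk : k < 2 * r + 2) :
    q (2 * p + 2 + k) = (U ((k + 1) / 2), Z (k / 2)) := by
  rcases Nat.even_or_odd' k with ⟨e, rfl | rfl⟩
  · rw [(H.bot e (by omega)).1]
    congr 2 <;> omega
  · rw [show 2 * p + 2 + (2 * e + 1) = 2 * p + 3 + 2 * e by ring, (H.bot e (by omega)).2]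
    congr 2 <;> omega

theorem last_eq (H : Traces p r X Y U Z q) : q (2 * p + 2 * r + 4) = (X (p + 1), Y p) := by
  have := H.period 0
  rw [zero_add] at this
  rw [this, H.top_eq (by omega)]; simp

theorem horizontal (H : Traces p r X Y U Z q) (k : ℕ) :
    (q (2 * k)).2 = (q (2 * k + 1)).2 ∧ (q (2 * k)).1 ≠ (q (2 * k + 1)).1 := by
  set n := 2 * p + 2 * r + 4 with hn
  have h1 : (2 * k) % n = 2 * (k % (p + r + 2)) := by
    rw [hn, show 2 * p + 2 * r + 4 = 2 * (p + r + 2) by ring, Nat.mul_mod_mul_left]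
  have h2 : (2 * k + 1) % n = 2 * (k % (p + r + 2)) + 1 := by
    rw [Nat.add_mod, h1, Nat.mod_eq_of_lt (a := 1) (by omega), Nat.mod_eq_of_lt]
    have := Nat.mod_lt k (show 0 < p + r + 2 by omega)
    omega
  rw [← H.map_mod (2 * k), ← H.map_mod (2 * k + 1), ← hn, h1, h2]
  have hlt := Nat.mod_lt k (show 0 < p + r + 2 by omega)
  generalize k % (p + r + 2) = e at *
  by_cases he : e ≤ p
  · have hX := H.X_lt (p - e) (by omega)
    rw [(H.top (p - e) e (by omega)).1, (H.top (p - e) e (by omega)).2]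
    exact ⟨rfl, hX.ne'⟩
  · obtain ⟨f, rfl⟩ : ∃ f, e = p + 1 + f := ⟨e - (p + 1), by omega⟩
    have hU := H.U_lt f (by omega)
    rw [show 2 * (p + 1 + f) = 2 * p + 2 + 2 * f by ring, (H.bot f (by omega)).1,
      show 2 * p + 2 + 2 * f + 1 = 2 * p + 3 + 2 * f by ring, (H.bot f (by omega)).2]
    exact ⟨rfl, hU.ne⟩

theorem vertical (H : Traces p r X Y U Z q) (hY : ∀ i < p, Y i ≠ Y (i + 1))
    (hZ : ∀ j < r, Z j ≠ Z (j + 1)) (h0 : Y 0 ≠ Z 0) (h1 : Y p ≠ Z r) (k : ℕ) :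
    (q (2 * k + 1)).1 = (q (2 * k + 2)).1 ∧ (q (2 * k + 1)).2 ≠ (q (2 * k + 2)).2 := by
  have h3 : ∀ e < p + r + 2,
      (q (2 * e + 1)).1 = (q (2 * e + 2)).1 ∧ (q (2 * e + 1)).2 ≠ (q (2 * e + 2)).2 := by
    intro e he
    rcases lt_trichotomy e p with h | h | h
    · rw [(H.top (p - e) e (by omega)).2, show 2 * e + 2 = 2 * (e + 1) by ring,
        (H.top (p - (e + 1)) (e + 1) (by omega)).1, show p - e = p - (e + 1) + 1 by omega]
      exact ⟨rfl, (hY _ (by omega)).symm⟩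
    · subst h
      rw [(H.top 0 e (by omega)).2, show 2 * e + 2 = 2 * e + 2 + 2 * 0 by ring,
        (H.bot 0 (by omega)).1]
      exact ⟨H.left, h0⟩
    · obtain ⟨f, rfl⟩ : ∃ f, e = p + 1 + f := ⟨e - (p + 1), by omega⟩
      rw [show 2 * (p + 1 + f) + 1 = 2 * p + 3 + 2 * f by ring, (H.bot f (by omega)).2]
      rcases (show f ≤ r by omega).eq_or_lt with rfl | h
      · rw [show 2 * (p + 1 + f) + 2 = 2 * p + 2 * f + 4 by ring, H.last_eq]
        exact ⟨H.right.symm, h1.symm⟩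
      · rw [show 2 * (p + 1 + f) + 2 = 2 * p + 2 + 2 * (f + 1) by ring, (H.bot (f + 1) (by omega)).1]
        exact ⟨rfl, hZ f h⟩
  have hd := Nat.div_add_mod k (p + r + 2)
  have hlt := Nat.mod_lt k (show 0 < p + r + 2 by omega)
  have hper : ∀ c k, q (k + c * (2 * p + 2 * r + 4)) = q k := fun c k =>
    Function.Periodic.nat_mul H.period c k
  have := h3 (k % (p + r + 2)) hlt
  rw [← hper (k / (p + r + 2)) (2 * _ + 1), ← hper (k / (p + r + 2)) (2 * _ + 2)] at this
  have e1 : 2 * (k % (p + r + 2)) + k / (p + r + 2) * (2 * p + 2 * r + 4) = 2 * k := by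
    conv_rhs => rw [← hd]
    ring
  rw [add_right_comm, e1, add_right_comm, e1] at this
  exact this

/-- A point of a vertical edge is charged to the lower of the two adjacent horizontal edges and lies
weakly above it. Together with `mem_bot` this reduces disjointness of the chains to the separation
of their horizontal edges. -/
theorem mem_top (H : Traces p r X Y U Z q) {k : ℕ} (hk : k < 2 * p + 1) {w : ℤ × ℤ}
    (hw : w ∈ Set.uIcc (q k) (q (k + 1))) : ∃ i ≤ p, X i ≤ w.1 ∧ w.1 ≤ X (i + 1) ∧ Y i ≤ w.2 := by
  rw [mem_uIcc_prod] at hw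
  rcases Nat.even_or_odd' k with ⟨e, rfl | rfl⟩
  · have := H.X_lt (p - e) (by omega)
    rw [(H.top (p - e) e (by omega)).1, (H.top (p - e) e (by omega)).2] at hw
    exact ⟨p - e, by omega, by omega, by omega, by omega⟩
  · obtain ⟨i, hi⟩ : ∃ i, i + 1 + e = p := ⟨p - (e + 1), by omega⟩
    have h1 := H.X_lt i (by omega)
    have h2 := H.X_lt (i + 1) (by omega)
    rw [show 2 * e + 1 + 1 = 2 * (e + 1) by ring, (H.top (i + 1) e (by omega)).2,
      (H.top i (e + 1) (by omega)).1] at hw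
    dsimp only at hw
    rcases le_total (Y i) (Y (i + 1)) with h | h
    · exact ⟨i, by omega, by omega, by omega, by omega⟩
    · exact ⟨i + 1, by omega, by omega, by omega, by omega⟩

theorem mem_bot (H : Traces p r X Y U Z q) {k : ℕ} (hk : k < 2 * r + 1) {w : ℤ × ℤ}
    (hw : w ∈ Set.uIcc (q (2 * p + 2 + k)) (q (2 * p + 2 + k + 1))) :
    ∃ j ≤ r, U j ≤ w.1 ∧ w.1 ≤ U (j + 1) ∧ w.2 ≤ Z j := by
  rw [mem_uIcc_prod] at hw
  rcases Nat.even_or_odd' k with ⟨e, rfl | rfl⟩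
  · have := H.U_lt e (by omega)
    rw [(H.bot e (by omega)).1, show 2 * p + 2 + 2 * e + 1 = 2 * p + 3 + 2 * e by ring,
      (H.bot e (by omega)).2] at hw
    exact ⟨e, by omega, by omega, by omega, by omega⟩
  · have h1 := H.U_lt e (by omega)
    have h2 := H.U_lt (e + 1) (by omega)
    rw [show 2 * p + 2 + (2 * e + 1) = 2 * p + 3 + 2 * e by ring, (H.bot e (by omega)).2,
      show 2 * p + 3 + 2 * e + 1 = 2 * p + 2 + 2 * (e + 1) by ring,
      (H.bot (e + 1) (by omega)).1] at hw
    dsimp only at hw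
    rcases le_total (Z e) (Z (e + 1)) with h | h
    · exact ⟨e + 1, by omega, by omega, by omega, by omega⟩
    · exact ⟨e, by omega, by omega, by omega, by omega⟩

theorem X_strict (H : Traces p r X Y U Z q) {i i' : ℕ} (h : i < i') (h' : i' ≤ p + 1) :
    X i < X i' :=
  (H.X_lt i (by omega)).trans_le (H.X_mono h h')

theorem U_strict (H : Traces p r X Y U Z q) {i i' : ℕ} (h : i < i') (h' : i' ≤ r + 1) :
    U i < U i' :=
  (H.U_lt i (by omega)).trans_le (H.U_mono h h')

/-- Edges of one chain have disjoint `x`-ranges, apart from two horizontal edges that meet the same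
vertical edge; these differ in height. Edges of different chains are kept apart by `sep`, and the
two end edges by their extreme abscissae. -/
theorem isSimpleWalk (H : Traces p r X Y U Z q) (hY : ∀ i < p, Y i ≠ Y (i + 1))
    (hZ : ∀ j < r, Z j ≠ Z (j + 1))
    (sep : ∀ i j, i ≤ p → j ≤ r → X i ≤ U (j + 1) → U j ≤ X (i + 1) → Z j < Y i) :
    IsSimpleWalk (2 * p + 2 * r + 4) q := by
  have h00 : Z 0 < Y 0 := sep 0 0 (by omega) (by omega)
    (by rw [H.left]; exact (H.U_lt 0 (by omega)).le) (by rw [← H.left]; exact (H.X_lt 0 (by omega)).le)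
  have hpr : Z r < Y p := sep p r le_rfl le_rfl
    (by rw [← H.right]; exact (H.X_lt p le_rfl).le) (by rw [H.right]; exact (H.U_lt r le_rfl).le)
  have hv := H.vertical hY hZ h00.ne' hpr.ne'
  have hh := H.horizontal
  refine ⟨?_, ?_, ?_, ?_⟩
  · intro k h
    rcases Nat.even_or_odd' k with ⟨e, rfl | rfl⟩
    · exact (hh e).2 (by rw [h])
    · exact (hv e).2 (by rw [h])
  · intro k
    rcases Nat.even_or_odd' k with ⟨e, rfl | rfl⟩
    · exact Or.inr (hh e).1
    · exact Or.inl (hv e).1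
  · intro k
    apply uIcc_inter_uIcc_of_perp
    rcases Nat.even_or_odd' k with ⟨e, rfl | rfl⟩
    · exact Or.inl ⟨(hh e).1, (hv e).1⟩
    · exact Or.inr ⟨(hv e).1, (hh (e + 1)).1⟩
  · intro k l hl hkl hne
    rw [Set.disjoint_left]
    intro w hk hw
    -- the vertical edge at the left end
    have hleft : ∀ w ∈ Set.uIcc (q (2 * p + 1)) (q (2 * p + 1 + 1)), w.1 = X 0 := by
      intro w hw
      rw [mem_uIcc_prod, H.top_eq (by omega), show 2 * p + 1 + 1 = 2 * p + 2 + 0 by ring,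
        H.bot_eq (by omega)] at hw
      have : p + 1 - (2 * p + 1 + 1) / 2 = 0 := by omega
      rw [this] at hw
      have := H.left
      simp only [zero_add, Nat.reduceDiv] at hw
      omega
    have hright : ∀ w ∈ Set.uIcc (q (2 * p + 2 * r + 3)) (q (2 * p + 2 * r + 3 + 1)),
        w.1 = X (p + 1) := by
      intro w hw
      rw [mem_uIcc_prod, show 2 * p + 2 * r + 3 + 1 = 2 * p + 2 * r + 4 by ring, H.last_eq,
        show 2 * p + 2 * r + 3 = 2 * p + 2 + (2 * r + 1) by ring, H.bot_eq (by omega)] at hw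
      have : (2 * r + 1 + 1) / 2 = r + 1 := by omega
      rw [this, ← H.right] at hw
      dsimp only at hw
      omega
    have htopx : ∀ k < 2 * p + 1, ∀ w ∈ Set.uIcc (q k) (q (k + 1)),
        X (p + 1 - (k + 2) / 2) ≤ w.1 ∧ w.1 ≤ X (p + 1 - (k + 1) / 2) := by
      intro k hk w hw
      rw [mem_uIcc_prod, H.top_eq (by omega), H.top_eq (by omega)] at hw
      have := H.X_mono (i := p + 1 - (k + 2) / 2) (i' := p + 1 - (k + 1) / 2) (by omega) (by omega)
      dsimp only at hw
      rw [show k + 1 + 1 = k + 2 by ring] at hw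
      omega
    have hbotx : ∀ k < 2 * r + 1, ∀ w ∈ Set.uIcc (q (2 * p + 2 + k)) (q (2 * p + 2 + k + 1)),
        U ((k + 1) / 2) ≤ w.1 ∧ w.1 ≤ U ((k + 2) / 2) := by
      intro k hk w hw
      rw [mem_uIcc_prod, H.bot_eq (by omega), show 2 * p + 2 + k + 1 = 2 * p + 2 + (k + 1) by ring,
        H.bot_eq (by omega)] at hw
      have := H.U_mono (i := (k + 1) / 2) (i' := (k + 2) / 2) (by omega) (by omega)
      dsimp only at hw
      rw [show k + 1 + 1 = k + 2 by ring] at hw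
      omega
    rcases lt_trichotomy k (2 * p + 1) with hk1 | rfl | hk1
    · have k1 := htopx k hk1 w hk
      rcases lt_trichotomy l (2 * p + 1) with hl1 | rfl | hl1
      · have l1 := htopx l hl1 w hw
        by_cases hex : k % 2 = 0 ∧ l = k + 2
        · obtain ⟨hk2, rfl⟩ := hex
          obtain ⟨e, rfl⟩ : ∃ e, k = 2 * e := ⟨k / 2, by omega⟩
          obtain ⟨i, hi⟩ : ∃ i, i + 1 + e = p := ⟨p - (e + 1), by omega⟩
          have := hY i (by omega)
          rw [mem_uIcc_prod, (H.top (i + 1) e (by omega)).1, (H.top (i + 1) e (by omega)).2] at hk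
          rw [show 2 * e + 2 = 2 * (e + 1) by ring, mem_uIcc_prod, (H.top i (e + 1) (by omega)).1,
            (H.top i (e + 1) (by omega)).2] at hw
          dsimp only at hk hw
          omega
        · have := H.X_strict (i := p + 1 - (l + 1) / 2) (i' := p + 1 - (k + 2) / 2) (by omega)
            (by omega)
          omega
      · have l1 := hleft w hw
        have := H.X_strict (i := 0) (i' := p + 1 - (k + 2) / 2) (by omega) (by omega)
        omega
      · obtain ⟨m, rfl⟩ : ∃ m, l = 2 * p + 2 + m := ⟨l - (2 * p + 2), by omega⟩
        rcases (show m ≤ 2 * r + 1 by omega).eq_or_lt with rfl | hm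
        · have l1 := hright w (by rwa [show 2 * p + 2 * r + 3 = 2 * p + 2 + (2 * r + 1) by ring])
          have := H.X_strict (i := p + 1 - (k + 1) / 2) (i' := p + 1) (by omega) (by omega)
          omega
        · obtain ⟨i, hi, i1, i2, i3⟩ := H.mem_top hk1 hk
          obtain ⟨j, hj, j1, j2, j3⟩ := H.mem_bot hm hw
          have := sep i j hi hj (by omega) (by omega)
          omega
    · have k1 := hleft w hk
      obtain ⟨m, rfl⟩ : ∃ m, l = 2 * p + 2 + m := ⟨l - (2 * p + 2), by omega⟩
      rcases (show m ≤ 2 * r + 1 by omega).eq_or_lt with rfl | hm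
      · have l1 := hright w (by rwa [show 2 * p + 2 * r + 3 = 2 * p + 2 + (2 * r + 1) by ring])
        have := H.X_strict (i := 0) (i' := p + 1) (by omega) (by omega)
        omega
      · have l1 := hbotx m hm w hw
        have := H.U_strict (i := 0) (i' := (m + 1) / 2) (by omega) (by omega)
        have := H.left
        omega
    · obtain ⟨m', rfl⟩ : ∃ m, k = 2 * p + 2 + m := ⟨k - (2 * p + 2), by omega⟩
      have k1 := hbotx m' (by omega) w hk
      obtain ⟨m, rfl⟩ : ∃ m, l = 2 * p + 2 + m := ⟨l - (2 * p + 2), by omega⟩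
      rcases (show m ≤ 2 * r + 1 by omega).eq_or_lt with rfl | hm
      · have l1 := hright w (by rwa [show 2 * p + 2 * r + 3 = 2 * p + 2 + (2 * r + 1) by ring])
        have := H.U_strict (i := (m' + 2) / 2) (i' := r + 1) (by omega) (by omega)
        have := H.right
        omega
      · have l1 := hbotx m hm w hw
        by_cases hex : m' % 2 = 0 ∧ m = m' + 2
        · obtain ⟨hk2, rfl⟩ := hex
          obtain ⟨e, rfl⟩ : ∃ e, m' = 2 * e := ⟨m' / 2, by omega⟩
          have := hZ e (by omega)
          rw [mem_uIcc_prod, (H.bot e (by omega)).1,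
            show 2 * p + 2 + 2 * e + 1 = 2 * p + 3 + 2 * e by ring, (H.bot e (by omega)).2] at hk
          rw [show 2 * p + 2 + (2 * e + 2) = 2 * p + 2 + 2 * (e + 1) by ring, mem_uIcc_prod,
            (H.bot (e + 1) (by omega)).1,
            show 2 * p + 2 + 2 * (e + 1) + 1 = 2 * p + 3 + 2 * (e + 1) by ring,
            (H.bot (e + 1) (by omega)).2] at hw
          dsimp only at hk hw
          omega
        · have := H.U_strict (i := (m' + 2) / 2) (i' := (m + 1) / 2) (by omega)
            (by omega)
          omega

end Traces

theorem crossAt_vertical_horizontal (x x' y y' : ℤ) :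
    crossAt (x, y') (x, y) (x', y) = (y - y') * (x - x') := by
  simp [crossAt]; ring

theorem crossAt_horizontal_vertical (x x' y y' : ℤ) :
    crossAt (x', y) (x, y) (x, y') = (x - x') * (y' - y) := by
  simp [crossAt]

namespace IsProfile

variable {a b c d : ℕ} {X Y U Z : ℕ → ℤ} {q : ℕ → ℤ × ℤ}

theorem left_pos (H : IsProfile a b c d X Y U Z) : Z 0 < Y 0 :=
  H.separated 0 0 (by omega) (by omega) (by rw [H.left]; exact (H.U_lt 0 (by omega)).le)
    (by rw [← H.left]; exact (H.X_lt 0 (by omega)).le)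

theorem right_pos (H : IsProfile a b c d X Y U Z) : Z (b + c) < Y (a + d) :=
  H.separated _ _ le_rfl le_rfl (by rw [← H.right]; exact (H.X_lt _ le_rfl).le)
    (by rw [H.right]; exact (H.U_lt _ le_rfl).le)

theorem isSimpleWalk (H : IsProfile a b c d X Y U Z) (T : Traces (a + d) (b + c) X Y U Z q) :
    IsSimpleWalk (2 * (a + d) + 2 * (b + c) + 4) q := by
  refine T.isSimpleWalk (fun i hi => ?_) (fun j hj => ?_) H.separated
  · rcases lt_or_ge i a with h | h
    · exact (H.Y_up i h).ne
    · exact (H.Y_down i h hi).ne'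
  · rcases lt_or_ge j b with h | h
    · exact (H.Z_down j h).ne'
    · exact (H.Z_up j h hj).ne

/-- The turns of the walk along a profile; moreover, right turns do not occur at lowest vertices. -/
theorem turn_spec (H : IsProfile a b c d X Y U Z) (T : Traces (a + d) (b + c) X Y U Z q) {k : ℕ}
    (hk : k < 2 * (a + d) + 2 * (b + c) + 4) {u : ℤ × ℤ}
    (hu : u = if k = 0 then q (2 * (a + d) + 2 * (b + c) + 3) else q (k - 1)) :
    (stairTurn a b c d k = Turn.left ∧ 0 < crossAt u (q k) (q (k + 1))) ∨
    (stairTurn a b c d k = Turn.right ∧ crossAt u (q k) (q (k + 1)) < 0 ∧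
      ∃ l, (q l).2 < (q k).2) := by
  have habove : ∀ i ≤ a + d, ∃ l, (q l).2 < Y i := by
    intro i hi
    obtain ⟨j, hj, h1, h2⟩ := T.exists_below hi
    refine ⟨2 * (a + d) + 2 + 2 * j, ?_⟩
    rw [(T.bot j hj).1]
    exact H.separated i j hi hj h1 h2
  rcases chain_cases (a + d) (r := b + c) hk with
    ⟨e, he, rfl⟩ | ⟨e, he, rfl⟩ | ⟨e, he, rfl⟩ | ⟨e, he, rfl⟩
  · obtain ⟨i, hi⟩ : ∃ i, i + e = a + d := ⟨a + d - e, by omega⟩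
    have hX := T.X_lt i (by omega)
    rw [stairTurn_top_even he, (T.top i e hi).1, (T.top i e hi).2]
    rcases Nat.eq_zero_or_pos e with rfl | he0
    · obtain rfl : i = a + d := by omega
      left
      rw [if_pos rfl, show 2 * (a + d) + 2 * (b + c) + 3 = 2 * (a + d) + 3 + 2 * (b + c) by ring,
        (T.bot _ le_rfl).2, ← T.right] at hu
      rw [hu, crossAt_vertical_horizontal]
      exact ⟨if_pos (by omega), mul_pos (by have := H.right_pos; omega) (by omega)⟩
    · rw [if_neg (by omega), show 2 * e - 1 = 2 * (e - 1) + 1 by omega,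
        (T.top (i + 1) (e - 1) (by omega)).2] at hu
      rw [hu, crossAt_vertical_horizontal]
      by_cases h : e ≤ d
      · left
        exact ⟨if_pos h, mul_pos (by have := H.Y_down i (by omega) (by omega); omega) (by omega)⟩
      · right
        exact ⟨if_neg h, mul_neg_of_neg_of_pos
          (by have := H.Y_up i (by omega); omega) (by omega), habove i (by omega)⟩
  · obtain ⟨i, hi⟩ : ∃ i, i + e = a + d := ⟨a + d - e, by omega⟩
    have hX := T.X_lt i (by omega)
    rw [if_neg (by omega), Nat.add_sub_cancel, (T.top i e hi).1] at hu
    rw [stairTurn_top_odd he, (T.top i e hi).2, hu]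
    rcases he.eq_or_lt with rfl | he'
    · obtain rfl : i = 0 := by omega
      left
      rw [show 2 * (a + d) + 1 + 1 = 2 * (a + d) + 2 + 2 * 0 by ring, (T.bot 0 (by omega)).1,
        ← T.left, crossAt_horizontal_vertical]
      exact ⟨if_pos (by omega), mul_pos_of_neg_of_neg (by omega) (by have := H.left_pos; omega)⟩
    · obtain ⟨i, rfl⟩ : ∃ i', i = i' + 1 := ⟨i - 1, by omega⟩
      rw [show 2 * e + 1 + 1 = 2 * (e + 1) by ring, (T.top i (e + 1) (by omega)).1,
        crossAt_horizontal_vertical]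
      by_cases h : d ≤ e
      · left
        exact ⟨if_pos h, mul_pos_of_neg_of_neg (by omega)
          (by have := H.Y_up i (by omega); omega)⟩
      · right
        exact ⟨if_neg h, mul_neg_of_neg_of_pos (by omega)
          (by have := H.Y_down i (by omega) (by omega); omega), habove (i + 1) (by omega)⟩
  · have hU := T.U_lt e he
    rw [stairTurn_bot_even, (T.bot e he).1,
      show 2 * (a + d) + 2 + 2 * e + 1 = 2 * (a + d) + 3 + 2 * e by ring, (T.bot e he).2]
    rcases Nat.eq_zero_or_pos e with rfl | he0
    · left
      rw [if_neg (by omega), show 2 * (a + d) + 2 + 2 * 0 - 1 = 2 * (a + d) + 1 by omega,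
        (T.top 0 (a + d) (by omega)).2, T.left] at hu
      rw [hu, crossAt_vertical_horizontal]
      exact ⟨if_pos (by omega), mul_pos_of_neg_of_neg (by have := H.left_pos; omega) (by omega)⟩
    · obtain ⟨e, rfl⟩ : ∃ e', e = e' + 1 := ⟨e - 1, by omega⟩
      rw [if_neg (by omega),
        show 2 * (a + d) + 2 + 2 * (e + 1) - 1 = 2 * (a + d) + 3 + 2 * e by omega,
        (T.bot e (by omega)).2] at hu
      rw [hu, crossAt_vertical_horizontal]
      by_cases h : e + 1 ≤ b
      · left
        exact ⟨if_pos h, mul_pos_of_neg_of_neg (by have := H.Z_down e (by omega); omega)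
          (by omega)⟩
      · right
        have hz := H.Z_up e (by omega) (by omega)
        refine ⟨if_neg h, mul_neg_of_pos_of_neg (by omega) (by omega), 2 * (a + d) + 2 + 2 * e, ?_⟩
        rw [(T.bot e (by omega)).1]
        exact hz
  · have hU := T.U_lt e he
    rw [if_neg (by omega), show 2 * (a + d) + 3 + 2 * e - 1 = 2 * (a + d) + 2 + 2 * e by omega,
      (T.bot e he).1] at hu
    rw [stairTurn_bot_odd, (T.bot e he).2, hu]
    rcases he.eq_or_lt with rfl | he'
    · left
      rw [show 2 * (a + d) + 3 + 2 * (b + c) + 1 = 2 * (a + d) + 2 * (b + c) + 4 by ring, T.last_eq,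
        T.right, crossAt_horizontal_vertical]
      exact ⟨if_pos (by omega), mul_pos (by omega) (by have := H.right_pos; omega)⟩
    · rw [show 2 * (a + d) + 3 + 2 * e + 1 = 2 * (a + d) + 2 + 2 * (e + 1) by ring,
        (T.bot (e + 1) (by omega)).1, crossAt_horizontal_vertical]
      by_cases h : b ≤ e
      · left
        exact ⟨if_pos h, mul_pos (by omega) (by have := H.Z_up e (by omega) (by omega); omega)⟩
      · right
        have hz := H.Z_down e (by omega)
        refine ⟨if_neg h, mul_neg_of_pos_of_neg (by omega) (by omega),
          2 * (a + d) + 2 + 2 * (e + 1), ?_⟩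
        rw [(T.bot (e + 1) (by omega)).1]
        exact hz

end IsProfile

/-- A walk along a profile realizes the angle sequence with the corresponding stairs. -/
theorem GridCycle.realizes_of_profile {n : ℕ} [NeZero n] {P : GridCycle n} {S : Fin n → Turn}
    {o a b c d : ℕ} {X Y U Z : ℕ → ℤ} (hS : StairsFrom S o a b c d)
    (H : IsProfile a b c d X Y U Z) (T : Traces (a + d) (b + c) X Y U Z (P.walk o)) :
    P.Realizes S := by
  obtain ⟨hn, hS⟩ := hS
  have hn' : n = 2 * (a + d) + 2 * (b + c) + 4 := by omega
  have hn0 : 0 < n := by omega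
  have key : ∀ k, (S (Fin.ofNat n (o + (k + 1))) = Turn.left ∧
        0 < crossAt (P.walk o k) (P.walk o (k + 1)) (P.walk o (k + 2))) ∨
      (S (Fin.ofNat n (o + (k + 1))) = Turn.right ∧
        crossAt (P.walk o k) (P.walk o (k + 1)) (P.walk o (k + 2)) < 0 ∧
      ∃ l, (P.walk o l).2 < (P.walk o (k + 1)).2) := by
    intro k
    have hm := Nat.mod_lt (k + 1) hn0
    have e0 : S (Fin.ofNat n (o + (k + 1))) = stairTurn a b c d ((k + 1) % n) := by
      rw [← hS _ hm]
      congr 1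
      exact ofNat_congr (by rw [Nat.add_mod_mod])
    have per : ∀ k l, k % n = l % n → P.walk o k = P.walk o l := fun k l h => by
      unfold GridCycle.walk
      rw [ofNat_congr (k := o + k) (l := o + l)]
      rw [Nat.add_mod, h, ← Nat.add_mod]
    have e1 := per (k + 1) ((k + 1) % n) (by rw [Nat.mod_mod])
    have e2 := per (k + 2) ((k + 1) % n + 1) (by rw [Nat.mod_add_mod])
    rw [e0, e1, e2]
    apply H.turn_spec T (hn' ▸ hm)
    have hdm := Nat.div_add_mod (k + 1) n
    split_ifs with h
    · rw [h, add_zero] at hdm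
      apply per
      have : 2 * (a + d) + 2 * (b + c) + 3 = n - 1 := by omega
      rw [this]
      obtain ⟨m, hm⟩ : ∃ m, (k + 1) / n = m + 1 := by
        refine Nat.exists_eq_succ_of_ne_zero fun h0 => ?_
        rw [h0, mul_zero] at hdm; omega
      rw [hm] at hdm
      have : k = n - 1 + n * m := by
        rw [mul_add] at hdm; omega
      rw [this, Nat.add_mul_mod_self_left]
    · apply per
      have : k = (k + 1) % n - 1 + n * ((k + 1) / n) := by omega
      conv_lhs => rw [this]
      rw [Nat.add_mul_mod_self_left]
  have hw := H.isSimpleWalk T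
  rw [← hn'] at hw
  rw [GridCycle.realizes_iff P S o]
  refine ⟨by omega, hw, fun k hk => ?_, fun k => ?_⟩
  · rcases key k with h | ⟨-, -, l, hl⟩
    · exact h.2
    · exact absurd (hk l) (by omega)
  · rcases key k with h | h
    · rw [h.1]; exact h.2
    · rw [h.1]; exact h.2.1

/-! ### Area and bounding box of a polygon between two chains -/

/-- The index `i ≤ p` of the interval `[X i, X (i + 1))` that contains `x`. -/
def colIndex (X : ℕ → ℤ) (p : ℕ) (x : ℤ) : ℕ := Nat.findGreatest (fun i => X i ≤ x) p

theorem colIndex_spec {X : ℕ → ℤ} {p : ℕ} {x : ℤ} (h0 : X 0 ≤ x) (h1 : x < X (p + 1)) :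
    colIndex X p x ≤ p ∧ X (colIndex X p x) ≤ x ∧ x < X (colIndex X p x + 1) := by
  have hle : colIndex X p x ≤ p := Nat.findGreatest_le p
  refine ⟨hle, Nat.findGreatest_spec (P := fun i => X i ≤ x) (Nat.zero_le p) h0, ?_⟩
  rcases hle.eq_or_lt with h | h
  · rw [h]; exact h1
  · exact not_le.1 (Nat.findGreatest_is_greatest (P := fun i => X i ≤ x) (Nat.lt_succ_self _) h)

theorem eq_of_mem_Ico_of_mem_Ico {X : ℕ → ℤ} {p : ℕ} (hX : ∀ i ≤ p, X i < X (i + 1)) {i j : ℕ}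
    {x : ℤ} (hi : i ≤ p) (hj : j ≤ p) (hi' : X i ≤ x ∧ x < X (i + 1))
    (hj' : X j ≤ x ∧ x < X (j + 1)) : i = j := by
  have mono : ∀ {i j : ℕ}, i ≤ j → j ≤ p + 1 → X i ≤ X j := by
    intro i j h
    induction j, h using Nat.le_induction with
    | base => intro _; rfl
    | succ k hk ih => intro h; exact (ih (by omega)).trans (hX k (by omega)).le
  rcases lt_trichotomy i j with h | h | h
  · have := mono (i := i + 1) (j := j) h (by omega); omega
  · exact h
  · have := mono (i := j + 1) (j := i) h (by omega); omega

theorem colIndex_eq {X : ℕ → ℤ} {p : ℕ} (hX : ∀ i ≤ p, X i < X (i + 1)) {i : ℕ} {x : ℤ}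
    (hi : i ≤ p) (hi' : X i ≤ x ∧ x < X (i + 1)) (h0 : X 0 ≤ x) (h1 : x < X (p + 1)) :
    colIndex X p x = i :=
  have h := colIndex_spec h0 h1
  eq_of_mem_Ico_of_mem_Ico hX h.1 hi h.2 hi'

theorem colIndex_zero {X : ℕ → ℤ} {p : ℕ} (hX : ∀ i ≤ p, X i < X (i + 1)) (h1 : X 0 < X (p + 1)) :
    colIndex X p (X 0) = 0 :=
  colIndex_eq hX (Nat.zero_le p) ⟨le_rfl, hX 0 (Nat.zero_le p)⟩ le_rfl h1

theorem colIndex_succ {X : ℕ → ℤ} {p : ℕ} (hX : ∀ i ≤ p, X i < X (i + 1)) {x : ℤ}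
    (h0 : X 0 ≤ x) (h1 : x + 1 < X (p + 1)) :
    colIndex X p (x + 1) = colIndex X p x ∨ colIndex X p (x + 1) = colIndex X p x + 1 := by
  have h := colIndex_spec h0 (by omega : x < X (p + 1))
  by_cases hx : x + 1 < X (colIndex X p x + 1)
  · left
    exact colIndex_eq hX h.1 ⟨by omega, hx⟩ (by omega) h1
  · right
    have hlt : colIndex X p x + 1 ≤ p := by
      by_contra hc
      rw [show colIndex X p x = p by omega] at hx
      exact hx h1
    have := hX _ hlt
    exact colIndex_eq hX hlt ⟨by omega, by omega⟩ (by omega) h1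

/-- Groups the unit columns by the edge that bounds them; each edge occurs as often as its length.
-/
theorem sum_colIndex {X : ℕ → ℤ} {p : ℕ} (hX : ∀ i ≤ p, X i < X (i + 1)) (F : ℕ → ℤ) :
    ∑ x ∈ Finset.range (X (p + 1) - X 0).toNat, F (colIndex X p (X 0 + x)) =
      ∑ i ∈ Finset.range (p + 1), F i * (X (i + 1) - X i) := by
  have mono : ∀ {i j : ℕ}, i ≤ j → j ≤ p + 1 → X i ≤ X j := by
    intro i j h
    induction j, h using Nat.le_induction with
    | base => intro _; rfl
    | succ k hk ih => intro h; exact (ih (by omega)).trans (hX k (by omega)).le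
  have key : ∀ k ≤ p + 1, ∑ x ∈ Finset.range (X k - X 0).toNat, F (colIndex X p (X 0 + x)) =
      ∑ i ∈ Finset.range k, F i * (X (i + 1) - X i) := by
    intro k
    induction k with
    | zero => intro _; simp
    | succ k ih =>
      intro hk
      have h0 := mono (i := 0) (j := k) (by omega) (by omega)
      have h1 := hX k (by omega)
      have h2 := mono (i := k + 1) (j := p + 1) hk le_rfl
      rw [show (X (k + 1) - X 0).toNat = (X k - X 0).toNat + (X (k + 1) - X k).toNat by omega,
        Finset.sum_range_add, ih (by omega), Finset.sum_range_succ]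
      congr 1
      rw [Finset.sum_congr rfl (g := fun _ => F k), Finset.sum_const, Finset.card_range,
        nsmul_eq_mul, Int.toNat_of_nonneg (by omega), mul_comm]
      intro x hx
      rw [Finset.mem_range] at hx
      congr 1
      apply colIndex_eq hX (by omega) <;> omega
  exact key (p + 1) le_rfl

/-! ### Inner cells and area of a region between two chains -/

namespace Traces

variable {n : ℕ} [NeZero n] {P : GridCycle n} {p r o : ℕ} {X Y U Z : ℕ → ℤ}

theorem edgeAbove_iff (T : Traces p r X Y U Z (P.walk o)) (hn : n = 2 * p + 2 * r + 4)
    (c : ℤ × ℤ) (v : Fin n) : P.EdgeAbove c v ↔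
      (∃ i ≤ p, v = Fin.ofNat n (o + 2 * (p - i)) ∧ (X i ≤ c.1 ∧ c.1 < X (i + 1)) ∧ c.2 < Y i) ∨
      (∃ j ≤ r, v = Fin.ofNat n (o + (2 * p + 2 + 2 * j)) ∧ (U j ≤ c.1 ∧ c.1 < U (j + 1)) ∧
        c.2 < Z j) := by
  have hE : ∀ k, P.EdgeAbove c (Fin.ofNat n (o + k)) ↔
      (P.walk o k).2 = (P.walk o (k + 1)).2 ∧ c.2 < (P.walk o k).2 ∧
      min (P.walk o k).1 (P.walk o (k + 1)).1 ≤ c.1 ∧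
      c.1 < max (P.walk o k).1 (P.walk o (k + 1)).1 := by
    intro k
    unfold GridCycle.EdgeAbove
    rw [GridCycle.succVertex_ofNat]; rfl
  constructor
  · intro h
    obtain ⟨k, hk, rfl⟩ := exists_eq_ofNat o v
    rw [hE] at h
    rcases chain_cases p (hn ▸ hk) with ⟨e, he, rfl⟩ | ⟨e, he, rfl⟩ | ⟨e, he, rfl⟩ | ⟨e, he, rfl⟩
    · left
      have hX := T.X_lt (p - e) (by omega)
      rw [(T.top (p - e) e (by omega)).1, (T.top (p - e) e (by omega)).2] at h
      dsimp only at h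
      exact ⟨p - e, by omega, by rw [show p - (p - e) = e by omega], by omega, h.2.1⟩
    · exfalso
      rcases he.eq_or_lt with rfl | he'
      · rw [(T.top 0 e (by omega)).2, show 2 * e + 1 + 1 = 2 * e + 2 + 2 * 0 by ring,
          (T.bot 0 (by omega)).1, T.left] at h
        dsimp only at h; omega
      · rw [(T.top (p - e) e (by omega)).2, show 2 * e + 1 + 1 = 2 * (e + 1) by ring,
          (T.top (p - (e + 1)) (e + 1) (by omega)).1, show p - (e + 1) + 1 = p - e by omega] at h
        dsimp only at h; omega
    · right
      have hU := T.U_lt e he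
      rw [show 2 * p + 2 + 2 * e + 1 = 2 * p + 3 + 2 * e by ring, (T.bot e he).1,
        (T.bot e he).2] at h
      dsimp only at h
      exact ⟨e, he, rfl, by omega, h.2.1⟩
    · exfalso
      rw [(T.bot e he).2] at h
      rcases he.eq_or_lt with rfl | he'
      · rw [show 2 * p + 3 + 2 * e + 1 = 2 * p + 2 * e + 4 by ring, T.last_eq, T.right] at h
        dsimp only at h; omega
      · rw [show 2 * p + 3 + 2 * e + 1 = 2 * p + 2 + 2 * (e + 1) by ring,
          (T.bot (e + 1) he').1] at h
        dsimp only at h; omega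
  · rintro (⟨i, hi, rfl, h, h'⟩ | ⟨j, hj, rfl, h, h'⟩)
    · rw [hE, (T.top i (p - i) (by omega)).1, (T.top i (p - i) (by omega)).2]
      dsimp only; omega
    · rw [hE, (T.bot j hj).1, show 2 * p + 2 + 2 * j + 1 = 2 * p + 3 + 2 * j by ring,
        (T.bot j hj).2]
      dsimp only; omega

/-- Each chain has exactly one horizontal edge over the column of the cell. The upward ray crosses
the upper one if the cell is below `Y` and the lower one if it is below `Z`; since `Z < Y`, the
parity is odd just between the two heights. -/
theorem cellInside_iff (T : Traces p r X Y U Z (P.walk o)) (hn : n = 2 * p + 2 * r + 4)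
    (sep : ∀ i j, i ≤ p → j ≤ r → X i ≤ U (j + 1) → U j ≤ X (i + 1) → Z j < Y i) (c : ℤ × ℤ) :
    P.CellInside c ↔ (X 0 ≤ c.1 ∧ c.1 < X (p + 1)) ∧
      Z (colIndex U r c.1) ≤ c.2 ∧ c.2 < Y (colIndex X p c.1) := by
  unfold GridCycle.CellInside
  by_cases hc : X 0 ≤ c.1 ∧ c.1 < X (p + 1)
  · obtain ⟨hi, hi'⟩ := colIndex_spec hc.1 hc.2
    obtain ⟨hj, hj'⟩ := colIndex_spec (X := U) (p := r) (T.left ▸ hc.1) (T.right ▸ hc.2)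
    have hiu : ∀ i ≤ p, X i ≤ c.1 ∧ c.1 < X (i + 1) → i = colIndex X p c.1 := fun i h h' =>
      eq_of_mem_Ico_of_mem_Ico T.X_lt h hi h' hi'
    have hju : ∀ j ≤ r, U j ≤ c.1 ∧ c.1 < U (j + 1) → j = colIndex U r c.1 := fun i h h' =>
      eq_of_mem_Ico_of_mem_Ico T.U_lt h hj h' hj'
    have hsep := sep _ _ hi hj (by omega) (by omega)
    generalize colIndex X p c.1 = i at *
    generalize colIndex U r c.1 = j at *
    have hset : {v | P.EdgeAbove c v} =
        (if c.2 < Y i then {Fin.ofNat n (o + 2 * (p - i))} else ∅) ∪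
        (if c.2 < Z j then {Fin.ofNat n (o + (2 * p + 2 + 2 * j))} else (∅ : Set (Fin n))) := by
      ext v
      rw [Set.mem_ofPred_eq, T.edgeAbove_iff hn, Set.mem_union]
      constructor
      · rintro (⟨k, hk, rfl, h, h'⟩ | ⟨k, hk, rfl, h, h'⟩)
        · obtain rfl := hiu k hk h
          left; rw [if_pos h']; rfl
        · obtain rfl := hju k hk h
          right; rw [if_pos h']; rfl
      · rintro (h | h)
        · split_ifs at h with h'
          · exact Or.inl ⟨i, hi, h, hi', h'⟩
          · exact absurd h (Set.notMem_empty _)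
        · split_ifs at h with h'
          · exact Or.inr ⟨j, hj, h, hj', h'⟩
          · exact absurd h (Set.notMem_empty _)
    rw [hset]
    have hne : Fin.ofNat n (o + 2 * (p - i)) ≠ Fin.ofNat n (o + (2 * p + 2 + 2 * j)) := by
      intro h
      have := ofNat_add_injective (by omega) (by omega) h
      omega
    by_cases h1 : c.2 < Z j
    · rw [if_pos h1, if_pos (by omega), Set.singleton_union, Set.ncard_pair hne]
      have h2 : ¬ Odd 2 := by decide
      simp only [h2, false_iff]
      omega
    · rw [if_neg h1, Set.union_empty]
      by_cases h2 : c.2 < Y i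
      · rw [if_pos h2, Set.ncard_singleton]
        simp [hc, h2]; omega
      · rw [if_neg h2, Set.ncard_empty]
        simp [h2]
  · have hset : {v | P.EdgeAbove c v} = ∅ := by
      ext v
      rw [Set.mem_ofPred_eq, T.edgeAbove_iff hn]
      simp only [Set.mem_empty_iff_false, iff_false]
      rintro (⟨i, hi, -, h, -⟩ | ⟨j, hj, -, h, -⟩)
      · have := T.X_mono (i := 0) (i' := i) (by omega) (by omega)
        have := T.X_mono (i := i + 1) (i' := p + 1) (by omega) (by omega)
        omega
      · have := T.U_mono (i := 0) (i' := j) (by omega) (by omega)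
        have := T.U_mono (i := j + 1) (i' := r + 1) (by omega) (by omega)
        have := T.left
        have := T.right
        omega
    rw [hset, Set.ncard_empty]
    simp [hc]

theorem area_eq (T : Traces p r X Y U Z (P.walk o)) (hn : n = 2 * p + 2 * r + 4)
    (sep : ∀ i j, i ≤ p → j ≤ r → X i ≤ U (j + 1) → U j ≤ X (i + 1) → Z j < Y i) :
    P.area = ∑ x ∈ Finset.range (X (p + 1) - X 0).toNat,
      (Y (colIndex X p (X 0 + x)) - Z (colIndex U r (X 0 + x))) := by
  unfold GridCycle.area
  set F : Finset (Σ _ : ℕ, ℤ) := (Finset.range (X (p + 1) - X 0).toNat).sigma fun x =>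
    Finset.Ico (Z (colIndex U r (X 0 + x))) (Y (colIndex X p (X 0 + x))) with hF
  have hset : {c | P.CellInside c} = (fun s : (Σ _ : ℕ, ℤ) => (X 0 + (s.1 : ℤ), s.2)) '' F := by
    ext c
    rw [Set.mem_ofPred_eq, T.cellInside_iff hn sep, Set.mem_image]
    constructor
    · rintro ⟨h1, h2⟩
      have e : X 0 + ((c.1 - X 0).toNat : ℤ) = c.1 := by omega
      refine ⟨⟨(c.1 - X 0).toNat, c.2⟩, ?_, Prod.ext e rfl⟩
      simp only [hF, Finset.mem_coe, Finset.mem_sigma, Finset.mem_range, Finset.mem_Ico, e]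
      exact ⟨by omega, h2⟩
    · rintro ⟨⟨x, y⟩, h, rfl⟩
      simp only [hF, Finset.mem_coe, Finset.mem_sigma, Finset.mem_range, Finset.mem_Ico] at h
      exact ⟨⟨by dsimp only; omega, by dsimp only; omega⟩, h.2⟩
  rw [hset, Set.ncard_image_of_injective, Set.ncard_coe_finset, hF, Finset.card_sigma]
  · push_cast
    refine Finset.sum_congr rfl fun x hx => ?_
    rw [Finset.mem_range] at hx
    rw [Int.card_Ico, Int.toNat_of_nonneg]
    obtain ⟨hi, hi'⟩ := colIndex_spec (X := X) (p := p) (x := X 0 + x) (by omega) (by omega)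
    have := T.left
    have := T.right
    obtain ⟨hj, hj'⟩ := colIndex_spec (X := U) (p := r) (x := X 0 + x) (by omega) (by omega)
    have := sep _ _ hi hj (by omega) (by omega)
    omega
  · rintro ⟨x, y⟩ ⟨x', y'⟩ h
    simp only [Prod.mk.injEq] at h
    obtain ⟨h1, h2⟩ := h
    obtain rfl : x = x' := by omega
    subst h2; rfl

theorem area_eq_sum (T : Traces p r X Y U Z (P.walk o)) (hn : n = 2 * p + 2 * r + 4)
    (sep : ∀ i j, i ≤ p → j ≤ r → X i ≤ U (j + 1) → U j ≤ X (i + 1) → Z j < Y i) :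
    P.area = ∑ i ∈ Finset.range (p + 1), Y i * (X (i + 1) - X i) -
      ∑ j ∈ Finset.range (r + 1), Z j * (U (j + 1) - U j) := by
  rw [T.area_eq hn sep, Finset.sum_sub_distrib, sum_colIndex T.X_lt, ← sum_colIndex T.U_lt, T.left,
    T.right]

/-- The coordinates of the vertices are those of the chains. -/
theorem walk_mem (T : Traces p r X Y U Z (P.walk o)) (hn : n = 2 * p + 2 * r + 4) (v : Fin n) :
    (∃ i ≤ p, ((P v).1 = X i ∨ (P v).1 = X (i + 1)) ∧ (P v).2 = Y i) ∨
    (∃ j ≤ r, ((P v).1 = U j ∨ (P v).1 = U (j + 1)) ∧ (P v).2 = Z j) := by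
  obtain ⟨k, hk, rfl⟩ := exists_eq_ofNat o v
  change (∃ i ≤ p, ((P.walk o k).1 = X i ∨ (P.walk o k).1 = X (i + 1)) ∧ (P.walk o k).2 = Y i) ∨
    (∃ j ≤ r, ((P.walk o k).1 = U j ∨ (P.walk o k).1 = U (j + 1)) ∧ (P.walk o k).2 = Z j)
  rcases chain_cases p (hn ▸ hk) with ⟨e, he, rfl⟩ | ⟨e, he, rfl⟩ | ⟨e, he, rfl⟩ | ⟨e, he, rfl⟩
  · left; rw [(T.top (p - e) e (by omega)).1]; exact ⟨p - e, by omega, Or.inr rfl, rfl⟩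
  · left; rw [(T.top (p - e) e (by omega)).2]; exact ⟨p - e, by omega, Or.inl rfl, rfl⟩
  · right; rw [(T.bot e he).1]; exact ⟨e, he, Or.inl rfl, rfl⟩
  · right; rw [(T.bot e he).2]; exact ⟨e, he, Or.inr rfl, rfl⟩

end Traces

theorem ciSup_eq_of_forall_le {ι : Type*} [Finite ι] {f : ι → ℤ} {m : ℤ} (h : ∀ i, f i ≤ m)
    (h' : ∃ i, f i = m) : ⨆ i, f i = m := by
  obtain ⟨i, hi⟩ := h'
  have : Nonempty ι := ⟨i⟩
  exact le_antisymm (ciSup_le h) (hi ▸ le_ciSup (Set.finite_range f).bddAbove i)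

theorem ciInf_eq_of_forall_ge {ι : Type*} [Finite ι] {f : ι → ℤ} {m : ℤ} (h : ∀ i, m ≤ f i)
    (h' : ∃ i, f i = m) : ⨅ i, f i = m := by
  obtain ⟨i, hi⟩ := h'
  have : Nonempty ι := ⟨i⟩
  exact le_antisymm (hi ▸ ciInf_le (Set.finite_range f).bddBelow i) (le_ciInf h)

/-! ### Bounding box and columns of a profile -/

namespace IsProfile

variable {n : ℕ} [NeZero n] {P : GridCycle n} {o a b c d : ℕ} {X Y U Z : ℕ → ℤ}

/-- Each of the steps between edge `i` and the topmost edge `a` descends by at least one unit. -/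
theorem Y_le (H : IsProfile a b c d X Y U Z) {i : ℕ} (hi : i ≤ a + d) :
    Y i ≤ Y a - |(a : ℤ) - i| := by
  rcases le_total i a with h | h
  · have : ∀ k, k ≤ a → Y (a - k) ≤ Y a - k := by
      intro k
      induction k with
      | zero => intro _; simp
      | succ k ih =>
        intro hk
        have h1 := H.Y_up (a - (k + 1)) (by omega)
        have h2 := ih (by omega)
        rw [show a - (k + 1) + 1 = a - k by omega] at h1
        push_cast; omega
    have := this (a - i) (by omega)
    rw [Nat.sub_sub_self h] at this
    rw [abs_of_nonneg (by omega)]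
    omega
  · have : ∀ k, k ≤ d → Y (a + k) ≤ Y a - k := by
      intro k
      induction k with
      | zero => intro _; simp
      | succ k ih =>
        intro hk
        have h1 := H.Y_down (a + k) (by omega) (by omega)
        have h2 := ih (by omega)
        rw [← add_assoc]
        push_cast; omega
    have := this (i - a) (by omega)
    rw [show a + (i - a) = i by omega] at this
    rw [abs_of_nonpos (by omega)]
    omega

theorem le_Z (H : IsProfile a b c d X Y U Z) {j : ℕ} (hj : j ≤ b + c) :
    Z b + |(b : ℤ) - j| ≤ Z j := by
  rcases le_total j b with h | h
  · have : ∀ k, k ≤ b → Z b + k ≤ Z (b - k) := by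
      intro k
      induction k with
      | zero => intro _; simp
      | succ k ih =>
        intro hk
        have h1 := H.Z_down (b - (k + 1)) (by omega)
        have h2 := ih (by omega)
        rw [show b - (k + 1) + 1 = b - k by omega] at h1
        push_cast; omega
    have := this (b - j) (by omega)
    rw [Nat.sub_sub_self h] at this
    rw [abs_of_nonneg (by omega)]
    omega
  · have : ∀ k, k ≤ c → Z b + k ≤ Z (b + k) := by
      intro k
      induction k with
      | zero => intro _; simp
      | succ k ih =>
        intro hk
        have h1 := H.Z_up (b + k) (by omega) (by omega)
        have h2 := ih (by omega)
        rw [← add_assoc]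
        push_cast; omega
    have := this (j - b) (by omega)
    rw [show b + (j - b) = j by omega] at this
    rw [abs_of_nonpos (by omega)]
    omega

theorem add_le_X (H : IsProfile a b c d X Y U Z) {i j : ℕ} (hij : i ≤ j) (hj : j ≤ a + d + 1) :
    X i + (j - i : ℤ) ≤ X j := by
  induction j, hij using Nat.le_induction with
  | base => simp
  | succ k hk ih =>
    have := ih (by omega)
    have := H.X_lt k (by omega)
    push_cast; omega

theorem add_le_U (H : IsProfile a b c d X Y U Z) {i j : ℕ} (hij : i ≤ j) (hj : j ≤ b + c + 1) :
    U i + (j - i : ℤ) ≤ U j := by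
  induction j, hij using Nat.le_induction with
  | base => simp
  | succ k hk ih =>
    have := ih (by omega)
    have := H.U_lt k (by omega)
    push_cast; omega

/-- The edges `a` and `b` are the extreme ones of their own chains. A vertex of the other chain is
compared with them through an edge that overlaps its own. -/
theorem boxArea_eq (H : IsProfile a b c d X Y U Z)
    (T : Traces (a + d) (b + c) X Y U Z (P.walk o))
    (hn : n = 2 * (a + b + c + d) + 4) :
    P.boxArea = (X (a + d + 1) - X 0) * (Y a - Z b) := by
  have hmem := T.walk_mem (by omega)
  have hx : ∀ v, X 0 ≤ (P v).1 ∧ (P v).1 ≤ X (a + d + 1) := by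
    intro v
    have := T.left
    have := T.right
    rcases hmem v with ⟨i, hi, h, -⟩ | ⟨j, hj, h, -⟩
    · have := T.X_mono (i := 0) (i' := i) (by omega) (by omega)
      have := T.X_mono (i := i + 1) (i' := a + d + 1) (by omega) (by omega)
      have := T.X_lt i hi
      omega
    · have := T.U_mono (i := 0) (i' := j) (by omega) (by omega)
      have := T.U_mono (i := j + 1) (i' := b + c + 1) (by omega) (by omega)
      have := T.U_lt j hj
      omega
  have hy : ∀ v, Z b ≤ (P v).2 ∧ (P v).2 ≤ Y a := by
    intro v
    rcases hmem v with ⟨i, hi, -, h⟩ | ⟨j, hj, -, h⟩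
    · obtain ⟨j, hj, h1, h2⟩ := T.exists_below hi
      have := H.separated i j hi hj h1 h2
      have := H.le_Z hj
      have := H.Y_le hi
      have := abs_nonneg ((b : ℤ) - j)
      have := abs_nonneg ((a : ℤ) - i)
      omega
    · obtain ⟨i, hi, h1, h2⟩ := T.exists_above hj
      have := H.separated i j hi hj h1 h2
      have := H.le_Z hj
      have := H.Y_le hi
      have := abs_nonneg ((b : ℤ) - j)
      have := abs_nonneg ((a : ℤ) - i)
      omega
  unfold GridCycle.boxArea
  have e1 : P.walk o 0 = (X (a + d + 1), Y (a + d)) := by rw [T.top_eq (by omega)]; simp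
  have e2 : P.walk o (2 * (a + d) + 1) = (X 0, Y 0) := (T.top 0 (a + d) (by omega)).2
  have e3 : P.walk o (2 * d) = (X (a + 1), Y a) := (T.top a d rfl).1
  have e4 : P.walk o (2 * (a + d) + 2 + 2 * b) = (U b, Z b) := (T.bot b (by omega)).1
  rw [ciSup_eq_of_forall_le (fun v => (hx v).2) ⟨_, congrArg Prod.fst e1⟩,
    ciInf_eq_of_forall_ge (fun v => (hx v).1) ⟨_, congrArg Prod.fst e2⟩,
    ciSup_eq_of_forall_le (fun v => (hy v).2) ⟨_, congrArg Prod.snd e3⟩,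
    ciInf_eq_of_forall_ge (fun v => (hy v).1) ⟨_, congrArg Prod.snd e4⟩]

/-- The columns of a profile. -/
theorem columnProfile (H : IsProfile a b c d X Y U Z) :
    ColumnProfile a b c d ((X (a + d + 1) - X 0).toNat - 1)
      (fun x => colIndex X (a + d) (X 0 + x)) (fun x => colIndex U (b + c) (X 0 + x))
      (fun x => Y (colIndex X (a + d) (X 0 + x))) (fun x => Z (colIndex U (b + c) (X 0 + x))) := by
  have hW : X 0 + (a + d + 1) ≤ X (a + d + 1) := by
    have := H.add_le_X (i := 0) (j := a + d + 1) (by omega) le_rfl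
    push_cast at this; omega
  have hl := H.left
  have hr := H.right
  have sp : ∀ x : ℕ, x ≤ (X (a + d + 1) - X 0).toNat - 1 →
      (colIndex X (a + d) (X 0 + x) ≤ a + d ∧ X (colIndex X (a + d) (X 0 + x)) ≤ X 0 + x ∧
        X 0 + x < X (colIndex X (a + d) (X 0 + x) + 1)) ∧
      (colIndex U (b + c) (X 0 + x) ≤ b + c ∧ U (colIndex U (b + c) (X 0 + x)) ≤ X 0 + x ∧
        X 0 + x < U (colIndex U (b + c) (X 0 + x) + 1)) := by
    intro x hx
    exact ⟨colIndex_spec (by omega) (by omega), colIndex_spec (by omega) (by omega)⟩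
  refine ⟨by omega, by omega, by omega, by omega, ?_, ?_, ?_, ?_, ?_, ?_, ?_, ?_⟩
  · simp only [Nat.cast_zero, add_zero, colIndex_zero H.X_lt (by omega : X 0 < X (a + d + 1))]
  · simp only [Nat.cast_zero, add_zero]
    rw [hl, colIndex_zero H.U_lt (by omega : U 0 < U (b + c + 1))]; rfl
  · rw [colIndex_eq H.X_lt (i := a + d) le_rfl ?_ (by omega) (by omega)]
    · push_cast; rfl
    · have := H.X_lt (a + d) le_rfl
      omega
  · rw [colIndex_eq H.U_lt (i := b + c) le_rfl ?_ (by omega) (by omega)]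
    · push_cast; rfl
    · have := H.U_lt (b + c) le_rfl
      omega
  · intro x hx
    obtain ⟨⟨h1, h2, h3⟩, h4, h5, h6⟩ := sp x hx
    exact H.separated _ _ h1 h4 (by omega) (by omega)
  -- Adjacent columns meet along a vertical line, so the upper edge of one and the lower edge of the
  -- other overlap at least in an endpoint. `separated` covers this case because its inequalities
  -- are weak.
  · intro x hx
    obtain ⟨⟨h1, h2, h3⟩, h4, h5, h6⟩ := sp x (by omega)
    obtain ⟨⟨g1, g2, g3⟩, g4, g5, g6⟩ := sp (x + 1) (by omega)
    push_cast at *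
    exact ⟨H.separated _ _ h1 g4 (by omega) (by omega), H.separated _ _ g1 h4 (by omega) (by omega)⟩
  · intro x hx
    have h := colIndex_succ (p := a + d) H.X_lt (x := X 0 + x) (by omega) (by omega)
    have h1 := (sp x (by omega)).1.1
    have h2 := (sp (x + 1) (by omega)).1.1
    push_cast at *
    rw [← add_assoc] at *
    generalize colIndex X (a + d) (X 0 + x) = i at *
    generalize colIndex X (a + d) (X 0 + x + 1) = i' at *
    rcases h with rfl | rfl
    · left; simp
    · right
      exact ⟨by push_cast; ring, fun h => H.Y_up i (by omega), fun h => H.Y_down i (by omega) (by omega)⟩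
  · intro x hx
    have h := colIndex_succ (p := b + c) H.U_lt (x := X 0 + x) (by omega) (by omega)
    have h1 := (sp x (by omega)).2.1
    have h2 := (sp (x + 1) (by omega)).2.1
    push_cast at *
    rw [← add_assoc] at *
    generalize colIndex U (b + c) (X 0 + x) = i at *
    generalize colIndex U (b + c) (X 0 + x + 1) = i' at *
    rcases h with rfl | rfl
    · left; simp
    · right
      exact ⟨by push_cast; ring, fun h => H.Z_down i (by omega), fun h => H.Z_up i (by omega) (by omega)⟩

theorem exists_candidate_le_area (H : IsProfile a b c d X Y U Z)
    (T : Traces (a + d) (b + c) X Y U Z (P.walk o)) (hn : n = 2 * (a + b + c + d) + 4) :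
    ∃ v, IsAreaCandidate a b c d v ∧ v ≤ P.area := by
  obtain ⟨v, h1, h2⟩ := H.columnProfile.exists_candidate_le
  refine ⟨v, h1, h2.trans (le_of_eq ?_)⟩
  rw [T.area_eq (by omega) H.separated, Nat.sub_add_cancel]
  have := H.add_le_X (i := 0) (j := a + d + 1) (by omega) le_rfl
  push_cast at this
  omega

end IsProfile

/-! ### Lower bound for the bounding box -/

open Classical in
/-- The smallest area of a bounding box. -/
noncomputable def boxOptimum (a b c d : ℤ) : ℤ :=
  boxSide a b c d * boxSide b c d a +
    if Collides a b c d ∨ Collides b c d a then boxSide a b c d else 0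

/-- If stairs collide, the two sides of the smallest box are equal, so the additional term does not
depend on the order of the sides. -/
theorem boxOptimum_rotate (a b c d : ℤ) : boxOptimum b c d a = boxOptimum a b c d := by
  unfold boxOptimum
  rw [boxSide_rotate a b c d, mul_comm]
  congr 1
  have : boxSide b c d a = boxSide a b c d ∨ ¬ (Collides a b c d ∨ Collides b c d a) := by
    unfold boxSide Collides; omega
  have hc : (Collides b c d a ∨ Collides c d a b) ↔ (Collides a b c d ∨ Collides b c d a) := by
    unfold Collides; omega
  rcases this with h | h
  · rw [h]; split_ifs <;> tauto
  · rw [if_neg h, if_neg (mt hc.1 h)]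

theorem IsCyclicShift.boxOptimum_eq {a b c d a' b' c' d' : ℕ}
    (h : IsCyclicShift a b c d a' b' c' d') : boxOptimum a' b' c' d' = boxOptimum a b c d := by
  rcases h with ⟨rfl, rfl, rfl, rfl⟩ | ⟨rfl, rfl, rfl, rfl⟩ | ⟨rfl, rfl, rfl, rfl⟩ |
    ⟨rfl, rfl, rfl, rfl⟩
  · rfl
  · exact boxOptimum_rotate _ _ _ _
  · rw [boxOptimum_rotate, boxOptimum_rotate]
  · rw [boxOptimum_rotate, boxOptimum_rotate, boxOptimum_rotate]

theorem IsCyclicShift.isAreaCandidate {a b c d a' b' c' d' : ℕ} {v : ℤ}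
    (h : IsCyclicShift a b c d a' b' c' d') (hv : IsAreaCandidate a' b' c' d' v) :
    IsAreaCandidate a b c d v := by
  rcases h with ⟨rfl, rfl, rfl, rfl⟩ | ⟨rfl, rfl, rfl, rfl⟩ | ⟨rfl, rfl, rfl, rfl⟩ |
    ⟨rfl, rfl, rfl, rfl⟩
  exacts [hv, hv.rotate, hv.rotate.rotate, hv.rotate.rotate.rotate]

namespace IsProfile

variable {a b c d : ℕ} {X Y U Z : ℕ → ℤ}

theorem boxSide_le_width (H : IsProfile a b c d X Y U Z) :
    boxSide a b c d ≤ X (a + d + 1) - X 0 := by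
  have h1 := H.add_le_X (i := 0) (j := a + d + 1) (by omega) le_rfl
  have h2 := H.add_le_U (i := 0) (j := b + c + 1) (by omega) le_rfl
  have := H.left
  have := H.right
  push_cast at h1 h2
  unfold boxSide
  omega

theorem boxSide_le_height (H : IsProfile a b c d X Y U Z) : boxSide b c d a ≤ Y a - Z b := by
  have h1 := H.Y_le (i := 0) (by omega)
  have h2 := H.Y_le (i := a + d) (by omega)
  have h3 := H.le_Z (j := 0) (by omega)
  have h4 := H.le_Z (j := b + c) (by omega)
  have := H.left_pos
  have := H.right_pos
  unfold boxSide
  push_cast [sub_zero, sub_add_cancel_left, abs_neg, Nat.abs_cast] at *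
  omega

/-- In a box of the smallest size all relevant edges have unit length, and the first reflex vertices
of the two opposite stairs are forced to the same grid point. -/
theorem not_minimal_of_collides (H : IsProfile a b c d X Y U Z)
    (h : Collides a b c d ∨ Collides b c d a) (hw : X (a + d + 1) - X 0 ≤ boxSide a b c d)
    (hh : Y a - Z b ≤ boxSide b c d a) : False := by
  have x1 := H.add_le_X (i := 0) (j := 1) (by omega) (by omega)
  have x2 := H.add_le_X (i := 1) (j := a + d + 1) (by omega) (by omega)
  have u1 := H.add_le_U (i := 0) (j := 1) (by omega) (by omega)
  have u2 := H.add_le_U (i := 1) (j := b + c + 1) (by omega) (by omega)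
  have hl := H.left
  have hr := H.right
  have h0 := H.left_pos
  have h1 := H.right_pos
  unfold Collides at h
  unfold boxSide at hw hh
  rcases h with ⟨h2, h3, h4, h5⟩ | ⟨h2, h3, h4, h5⟩
  · obtain rfl : b = 0 := by omega
    obtain rfl : d = 0 := by omega
    obtain rfl : a = c := by omega
    have y := H.Y_le (i := 0) (by omega)
    have z1 := H.le_Z (j := 1) (by omega)
    have u3 := H.add_le_U (i := 1) (j := 2) (by omega) (by omega)
    have := H.separated 0 1 (by omega) (by omega) (by push_cast at *; omega)
      (by push_cast at *; simp at *; omega)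
    push_cast at *
    simp at *
    omega
  · obtain rfl : c = 0 := by omega
    obtain rfl : a = 0 := by omega
    obtain rfl : b = d := by omega
    have y := H.Y_le (i := 1) (by omega)
    have z1 := H.le_Z (j := 0) (by omega)
    have x3 := H.add_le_X (i := 1) (j := 2) (by omega) (by omega)
    have := H.separated 1 0 (by omega) (by omega) (by push_cast at *; simp at *; omega)
      (by push_cast at *; simp at *; omega)
    push_cast at *
    simp at *
    omega

variable {n : ℕ} [NeZero n] {P : GridCycle n} {o : ℕ}

theorem boxOptimum_le (H : IsProfile a b c d X Y U Z)
    (T : Traces (a + d) (b + c) X Y U Z (P.walk o)) (hn : n = 2 * (a + b + c + d) + 4) :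
    boxOptimum a b c d ≤ P.boxArea := by
  rw [H.boxArea_eq T hn]
  have h1 := H.boxSide_le_width
  have h2 := H.boxSide_le_height
  have h3 := H.not_minimal_of_collides
  have p1 : 0 < boxSide a b c d := by unfold boxSide; omega
  have p2 : 0 < boxSide b c d a := by unfold boxSide; omega
  unfold boxOptimum
  generalize X (a + d + 1) - X 0 = w at *
  generalize Y a - Z b = h at *
  split_ifs with hc
  · have e : boxSide a b c d = boxSide b c d a := by
      unfold boxSide
      unfold Collides at hc
      omega
    rw [← e] at h2 h3
    rw [← e]
    clear p2
    generalize boxSide a b c d = s at *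
    rcases lt_or_ge s w with hw | hw
    · nlinarith
    · rcases lt_or_ge s h with hh | hh
      · nlinarith
      · exact (h3 hc hw hh).elim
  · rw [add_zero]
    exact mul_le_mul h1 h2 p2.le (p1.le.trans h1)

end IsProfile

/-! ### A family of polygons -/

/-- Integer parameters that describe the position of four stairs. -/
structure StairParams : Type where
  x0 : ℤ
  xT : ℤ
  yT : ℤ
  yR : ℤ
  uB : ℤ
  zB : ℤ
  uC : ℤ
  zC : ℤ
  q : ℤ
  r : ℤ

namespace StairParams

/-- Steps of height `q`, the first `r` of which are extended by one. -/
def ramp (q r t : ℤ) : ℤ := t * q + min t r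

variable (p : StairParams) (a b c d : ℕ)

/-- Left and right ends of the edges of the upper chain. -/
def X (i : ℕ) : ℤ := if i = 0 then p.x0 else if i ≤ a then i else p.xT + (i - a)

/-- Heights of the edges of the upper chain. -/
def Y (i : ℕ) : ℤ := if i < a then i else if i = a then p.yT else p.yR - (i - a)

/-- Left and right ends of the edges of the lower chain. -/
def U (j : ℕ) : ℤ :=
  if j = 0 then p.x0 else if j ≤ b then p.uB + j else
    if j ≤ b + c then p.uC + ramp p.q p.r (j - b - 1) else p.xT + d + 1

/-- Heights of the edges of the lower chain. -/
def Z (j : ℕ) : ℤ := if j ≤ b then p.zB - j else p.zC + ramp p.q p.r (j - b - 1)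

theorem ramp_succ {q r : ℤ} (t : ℤ) : ramp q r (t + 1) = ramp q r t + q + if t < r then 1 else 0 := by
  unfold ramp
  rw [add_mul]
  split_ifs <;> omega

theorem ramp_zero {q r : ℤ} (hr : 0 ≤ r) : ramp q r 0 = 0 := by
  unfold ramp; simp [hr]

theorem ramp_mono {q r s t : ℤ} (hq : 0 ≤ q) (h : s ≤ t) : ramp q r s ≤ ramp q r t := by
  unfold ramp
  have := mul_le_mul_of_nonneg_right h hq
  omega

/-- Inequalities that ensure that the chains of the family form a profile, up to their separation. -/
structure IsValid : Prop where
  x0_lt : p.x0 < 1 ∧ p.x0 < p.xT + 1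
  le_xT : a ≤ p.xT
  uB : 0 < b → p.x0 ≤ p.uB
  uC : (if b = 0 then p.x0 else p.uB + b) < if c = 0 then p.xT + d + 1 else p.uC
  last : 0 < c → p.uC + ramp p.q p.r (c - 1) < p.xT + d + 1
  yT : a - 1 < p.yT
  yR : 0 < d → p.yR - 1 < p.yT
  zC : 0 < c → p.zB - b < p.zC
  step : ∀ t : ℤ, 0 ≤ t → t < c - 1 → 0 < p.q + if t < p.r then 1 else 0
  r_nonneg : 0 ≤ p.r

theorem isProfile (h : p.IsValid a b c d)
    (sep : ∀ i j, i ≤ a + d → j ≤ b + c → p.X a i ≤ p.U b c d (j + 1) → p.U b c d j ≤ p.X a (i + 1) →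
      p.Z b j < p.Y a i) :
    IsProfile a b c d (p.X a) (p.Y a) (p.U b c d) (p.Z b) := by
  obtain ⟨⟨h1, h1'⟩, h2, h3, h4, h5, h6, h7, h8, h9, h10⟩ := h
  have hr : ∀ j : ℕ, b < j → j < b + c → ramp p.q p.r (j - b - 1) < ramp p.q p.r (j + 1 - b - 1) := by
    intro j hj hj'
    have := h9 (j - b - 1) (by omega) (by omega)
    rw [show (j + 1 - b - 1 : ℤ) = (j - b - 1) + 1 by ring, ramp_succ]
    omega
  refine ⟨?_, ?_, rfl, ?_, ?_, ?_, ?_, ?_, sep⟩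
  · intro i hi
    unfold X
    rw [if_neg (Nat.succ_ne_zero i)]
    push_cast
    split_ifs <;> omega
  · intro j hj
    unfold U
    rw [if_neg (Nat.succ_ne_zero j)]
    push_cast
    rcases Nat.lt_trichotomy j b with h | rfl | h
    · rw [if_pos (by omega : j + 1 ≤ b)]
      split_ifs <;> omega
    · rw [if_neg (by omega : ¬ j + 1 ≤ j), if_pos (le_refl j)]
      rw [show (j + 1 - j - 1 : ℤ) = 0 by ring, ramp_zero h10]
      split_ifs at * <;> omega
    · rw [if_neg (by omega : ¬ j + 1 ≤ b), if_neg (by omega : ¬ j = 0), if_neg (by omega : ¬ j ≤ b),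
        if_pos (by omega : j ≤ b + c)]
      by_cases hj' : j < b + c
      · rw [if_pos (by omega)]
        have := hr j h hj'
        omega
      · rw [if_neg (by omega), show (j - b - 1 : ℤ) = c - 1 by omega]
        exact h5 (by omega)
  · unfold X U
    rw [if_neg (by omega), if_neg (by omega), if_neg (by omega), if_neg (by omega), if_neg (by omega)]
    push_cast; ring
  · intro i hi
    unfold Y
    rw [if_pos hi]
    push_cast
    split_ifs <;> omega
  · intro i hi hi'
    unfold Y
    push_cast
    rw [if_neg (by omega), if_neg (by omega), if_neg (by omega)]
    split_ifs <;> omega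
  · intro j hj
    unfold Z
    rw [if_pos (by omega), if_pos (by omega)]
    push_cast; omega
  · intro j hj hj'
    unfold Z
    rw [if_neg (by omega : ¬ j + 1 ≤ b)]
    push_cast
    rcases hj.eq_or_lt with rfl | h
    · rw [if_pos le_rfl, show (b + 1 - b - 1 : ℤ) = 0 by ring, ramp_zero h10]
      have := h8 (by omega)
      omega
    · rw [if_neg (by omega)]
      have := hr j h hj'
      omega

/-- The area below the upper chain. -/
theorem sum_top : ∑ i ∈ Finset.range (a + d + 1), p.Y a i * (p.X a (i + 1) - p.X a i) =
    tri a - a + p.yT * (p.xT + 1 - if a = 0 then p.x0 else a) + d * p.yR - tri d := by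
  rw [show a + d + 1 = a + 1 + d by ring, Finset.sum_range_add, Finset.sum_range_succ]
  have e1 : ∑ i ∈ Finset.range a, p.Y a i * (p.X a (i + 1) - p.X a i) = tri a - a := by
    have : ∀ k : ℕ, ∑ i ∈ Finset.range k, (i : ℤ) = tri k - k := by
      intro k
      induction k with
      | zero => simp [tri_zero]
      | succ k ih => rw [Finset.sum_range_succ, ih]; push_cast; rw [tri_succ]; ring
    rw [← this]
    refine Finset.sum_congr rfl fun i hi => ?_
    have := Finset.mem_range.1 hi
    unfold Y X
    rw [if_pos this, if_neg (Nat.succ_ne_zero i), if_pos (by omega)]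
    by_cases h0 : i = 0
    -- Edge `0` starts at `x0` instead of `0`, but it has height `0` and contributes nothing.
    · simp [h0]
    · rw [if_neg h0, if_pos (by omega)]; push_cast; ring
  have e2 : ∀ k : ℕ, ∑ i ∈ Finset.range k, p.Y a (a + 1 + i) * (p.X a (a + 1 + i + 1) - p.X a (a + 1 + i)) =
      k * p.yR - tri k := by
    intro k
    induction k with
    | zero => simp [tri_zero]
    | succ k ih =>
      rw [Finset.sum_range_succ, ih]
      unfold Y X
      rw [if_neg (by omega), if_neg (by omega), if_neg (by omega), if_neg (by omega),
        if_neg (by omega), if_neg (by omega)]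
      push_cast
      rw [tri_succ]
      ring
  rw [e1, e2]
  unfold Y X
  rw [if_neg (by omega), if_pos rfl, if_neg (by omega), if_neg (by omega)]
  rw [if_pos le_rfl]
  push_cast
  ring

/-- Twice the area below the part of the lower chain that belongs to the right stair. -/
theorem two_mul_sum_ramp {q r : ℤ} (z : ℤ) (hr : 0 ≤ r) (k : ℕ) :
    2 * ∑ t ∈ Finset.range k, (z + ramp q r t) * (ramp q r (t + 1) - ramp q r t) =
      2 * z * ramp q r k + ramp q r k ^ 2 - k * q ^ 2 - min (k : ℤ) r * (2 * q + 1) := by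
  -- With `R t = ramp q r t`, summation by parts rests on `2 * R t * (R (t + 1) - R t) = R (t + 1) ^
  -- 2 - R t ^ 2 - (R (t + 1) - R t) ^ 2`; the square of a step is `q ^ 2`, and `2 * q + 1` more for
  -- each of the first `r` steps.
  induction k with
  | zero => simp [ramp_zero hr]; omega
  | succ k ih =>
    rw [Finset.sum_range_succ, mul_add, ih]
    push_cast
    rw [ramp_succ]
    split_ifs with h
    · rw [show min (k : ℤ) r = k by omega, show min ((k : ℤ) + 1) r = k + 1 by omega]
      ring
    · rw [show min (k : ℤ) r = r by omega, show min ((k : ℤ) + 1) r = r by omega]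
      ring

theorem sum_bot_left : ∑ j ∈ Finset.range b, p.Z b j * (p.U b c d (j + 1) - p.U b c d j) =
    p.zB * ((if b = 0 then p.x0 else p.uB + b) - p.x0) - tri b + b := by
  rcases Nat.eq_zero_or_pos b with rfl | hb
  · simp [tri_zero]
  have : ∀ k : ℕ, 0 < k → k ≤ b → ∑ j ∈ Finset.range k, p.Z b j * (p.U b c d (j + 1) - p.U b c d j) =
      p.zB * (p.uB + k - p.x0) - tri k + k := by
    intro k hk
    induction k, hk using Nat.le_induction with
    | base =>
      intro _
      simp [Z, U, hb.ne', show tri 1 = 1 from rfl]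
    | succ k hk ih =>
      intro hk'
      rw [Finset.sum_range_succ, ih (by omega)]
      unfold Z U
      rw [if_pos (by omega), if_neg (by omega), if_pos (by omega), if_neg (by omega),
        if_pos (by omega)]
      push_cast
      rw [tri_succ]
      ring
  rw [if_neg (by omega), this b hb le_rfl]

theorem U_self : p.U b c d b = if b = 0 then p.x0 else p.uB + b := by
  unfold U; rw [if_pos le_rfl]

/-- The area below the lower chain, when the right stair is empty. -/
theorem sum_bot_zero : ∑ j ∈ Finset.range (b + 0 + 1), p.Z b j * (p.U b 0 d (j + 1) - p.U b 0 d j) =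
    p.zB * ((if b = 0 then p.x0 else p.uB + b) - p.x0) - tri b + b +
      (p.zB - b) * (p.xT + d + 1 - if b = 0 then p.x0 else p.uB + b) := by
  rw [add_zero, Finset.sum_range_succ, sum_bot_left, U_self]
  have e1 : p.Z b b = p.zB - b := by unfold Z; rw [if_pos le_rfl]
  have e2 : p.U b 0 d (b + 1) = p.xT + d + 1 := by
    unfold U
    rw [if_neg (by omega), if_neg (by omega), if_neg (by omega)]
  rw [e1, e2]

/-- Twice the area below the lower chain, when the right stair is nonempty. -/
theorem two_mul_sum_bot (hr : 0 ≤ p.r) (k : ℕ) :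
    2 * ∑ j ∈ Finset.range (b + (k + 1) + 1), p.Z b j * (p.U b (k + 1) d (j + 1) - p.U b (k + 1) d j) =
    2 * (p.zB * ((if b = 0 then p.x0 else p.uB + b) - p.x0) - tri b + b +
      (p.zB - b) * (p.uC - if b = 0 then p.x0 else p.uB + b)) +
    (2 * p.zC * ramp p.q p.r k + ramp p.q p.r k ^ 2 - k * p.q ^ 2 - min (k : ℤ) p.r * (2 * p.q + 1)) +
    2 * (p.zC + ramp p.q p.r k) * (p.xT + d + 1 - p.uC - ramp p.q p.r k) := by
  rw [show b + (k + 1) + 1 = b + 1 + k + 1 by ring, Finset.sum_range_succ, Finset.sum_range_add,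
    Finset.sum_range_succ, sum_bot_left, U_self, ← two_mul_sum_ramp _ hr]
  have e : ∑ x ∈ Finset.range k,
      p.Z b (b + 1 + x) * (p.U b (k + 1) d (b + 1 + x + 1) - p.U b (k + 1) d (b + 1 + x)) =
      ∑ t ∈ Finset.range k, (p.zC + ramp p.q p.r t) * (ramp p.q p.r (t + 1) - ramp p.q p.r t) := by
    refine Finset.sum_congr rfl fun x hx => ?_
    have := Finset.mem_range.1 hx
    unfold Z U
    rw [if_neg (by omega), if_neg (by omega), if_neg (by omega), if_pos (by omega),
      if_neg (by omega), if_neg (by omega), if_pos (by omega)]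
    push_cast
    rw [show (b + 1 + x - b - 1 : ℤ) = x by ring, show (b + 1 + x + 1 - b - 1 : ℤ) = x + 1 by ring]
    ring
  rw [e]
  have e1 : p.Z b b = p.zB - b := by unfold Z; rw [if_pos le_rfl]
  have e2 : p.U b (k + 1) d (b + 1) = p.uC := by
    unfold U
    rw [if_neg (by omega), if_neg (by omega), if_pos (by omega)]
    push_cast
    rw [show (b + 1 - b - 1 : ℤ) = 0 by ring, ramp_zero hr, add_zero]
  have e3 : p.Z b (b + 1 + k) = p.zC + ramp p.q p.r k := by
    unfold Z
    rw [if_neg (by omega)]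
    push_cast
    rw [show (b + 1 + k - b - 1 : ℤ) = k by ring]
  have e4 : p.U b (k + 1) d (b + 1 + k + 1) = p.xT + d + 1 := by
    unfold U
    rw [if_neg (by omega), if_neg (by omega), if_neg (by omega)]
  have e5 : p.U b (k + 1) d (b + 1 + k) = p.uC + ramp p.q p.r k := by
    unfold U
    rw [if_neg (by omega), if_neg (by omega), if_pos (by omega)]
    push_cast
    rw [show (b + 1 + k - b - 1 : ℤ) = k by ring]
  rw [e1, e2, e3, e4, e5]
  ring

end StairParams

/-! ### The optimal members of the family -/

/-- The parameters of a polygon whose stairs consist of unit steps in the corners of its bounding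
box. -/
def boxParams (a b c d : ℤ) : StairParams where
  x0 := 0
  xT := boxSide a b c d - 1 - d
  yT := a
  yR := a
  uB := 0
  zB := b - boxSide b c d a + a
  uC := boxSide a b c d - c
  zC := 1 - boxSide b c d a + a
  q := 1
  r := 0

section Box

variable (a b c d : ℕ)

theorem ramp_one_zero {t : ℤ} (ht : 0 ≤ t) : StairParams.ramp 1 0 t = t := by
  unfold StairParams.ramp; omega

theorem boxParams_isValid : (boxParams a b c d).IsValid a b c d := by
  refine ⟨⟨?_, ?_⟩, ?_, ?_, ?_, ?_, ?_, ?_, ?_, ?_, ?_⟩ <;> simp only [boxParams, boxSide]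
  · omega
  · omega
  · omega
  · omega
  · split_ifs <;> omega
  · intro hc
    rw [ramp_one_zero (by omega)]; omega
  · omega
  · omega
  · omega
  · intros; split_ifs <;> omega
  · omega

/-- Unit stairs in opposite corners of the smallest box stay apart, unless they fill the box and the
other two stairs are empty. -/
theorem boxParams_isProfile (h1 : ¬ Collides a b c d) (h2 : ¬ Collides b c d a) :
    IsProfile a b c d ((boxParams a b c d).X a) ((boxParams a b c d).Y a)
      ((boxParams a b c d).U b c d) ((boxParams a b c d).Z b) := by
  refine StairParams.isProfile _ _ _ _ _ (boxParams_isValid a b c d) ?_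
  intro i j hi hj
  unfold Collides at h1 h2
  unfold StairParams.X StairParams.Y StairParams.U StairParams.Z
  simp only [boxParams, boxSide]
  rw [if_neg (Nat.succ_ne_zero i), if_neg (Nat.succ_ne_zero j)]
  push_cast
  rcases le_or_gt j b with hjb | hjb
  · rw [if_pos hjb, if_pos hjb]
    rcases lt_or_ge b (j + 1) with hb | hb
    · split_ifs <;> omega
    · rw [if_pos hb]
      split_ifs <;> omega
  · have e : ∀ t : ℤ, 0 ≤ t → StairParams.ramp 1 0 t = t := fun _ => ramp_one_zero
    rw [e (j - b - 1) (by omega), if_neg (by omega : ¬ j ≤ b)]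
    simp only [if_neg (by omega : ¬ j = 0), if_neg (by omega : ¬ j + 1 ≤ b), if_pos hj,
      if_neg (by omega : ¬ j ≤ b)]
    split_ifs <;> omega

theorem boxParams_area : ∑ i ∈ Finset.range (a + d + 1), (boxParams a b c d).Y a i *
      ((boxParams a b c d).X a (i + 1) - (boxParams a b c d).X a i) -
    ∑ j ∈ Finset.range (b + c + 1), (boxParams a b c d).Z b j *
      ((boxParams a b c d).U b c d (j + 1) - (boxParams a b c d).U b c d j) = boxValue a b c d := by
  have e : ∀ k : ℕ, (if k = 0 then (0 : ℤ) else 0 + k) = k := by intro k; split_ifs <;> simp [*]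
  have e' : (a : ℤ) * (if a = 0 then 0 else (a : ℤ)) = a * a := by split_ifs <;> simp [*]
  have ta := two_mul_tri a
  have tb := two_mul_tri b
  have tc := two_mul_tri c
  refine mul_left_cancel₀ (two_ne_zero (α := ℤ)) ?_
  rw [StairParams.sum_top, mul_sub 2]
  unfold boxValue
  rcases c with _ | k
  · rw [StairParams.sum_bot_zero]
    simp only [boxParams, e]
    push_cast at *
    rw [mul_sub (a : ℤ), e']
    simp only [tri_zero]
    linear_combination 2 * ta + 2 * tb
  · rw [StairParams.two_mul_sum_bot _ _ _ (by simp [boxParams])]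
    simp only [boxParams, ramp_one_zero (Int.natCast_nonneg k), e]
    rw [min_eq_right (Int.natCast_nonneg k), mul_sub (a : ℤ) _ (if a = 0 then _ else _), e']
    push_cast at *
    linear_combination 2 * ta + 2 * tb + tc

end Box

/-! The parameters of the strip-shaped polygons. -/

section Strip

variable (a b c d : ℤ)

/-- Whether the first bay of a strip has an additional step. -/
def extraFirst : ℤ :=
  if a / (c + 1) < b ∧ 0 < a - a / (c + 1) * (c + 1) ∧ 0 < a / (c + 1) then 1 else 0

/-- Whether the last bay of a strip has an additional step. -/
def extraLast : ℤ :=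
  if extraFirst a b c < a - a / (c + 1) * (c + 1) ∧
    (a / (c + 1) < d ∨ c ≤ a - a / (c + 1) * (c + 1) - extraFirst a b c) then 1 else 0

/-- The parameters of a strip-shaped polygon with `m` steps in the first bay, `l` steps in the last
bay, and `q` or (`r` times) `q + 1` steps in the other ones. -/
def bayParams (q r m l : ℤ) : StairParams where
  x0 := min 0 (m - b)
  xT := a
  yT := a + max 0 (d - l)
  yR := a - l + d
  uB := m - b
  -- The lower right stair starts one unit below the top of the last column of the first bay, at `zC
  -- = m - 1`. The bottom edge `zB - b` must lie below that, which excludes `-1` when `m = b = 0`.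
  zB := if 0 < m + b then -1 else -2
  uC := m + 1
  zC := m - 1
  q := q
  r := r

/-- The parameters of an optimal strip-shaped polygon. -/
def stripParams : StairParams :=
  bayParams a b d (a / (c + 1))
    (a - a / (c + 1) * (c + 1) - extraFirst a b c - extraLast a b c d)
    (a / (c + 1) + extraFirst a b c) (a / (c + 1) + extraLast a b c d)

end Strip

/-- The properties of the parameters of a strip: its bays have `m`, `q` or `q + 1`, and `l` steps. -/
structure IsStripSplit (a b c d q r m l : ℤ) : Prop where
  q_nonneg : 0 ≤ q
  r_nonneg : 0 ≤ r
  first : m = q ∨ m = q + 1 ∧ q < b ∧ 0 < q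
  last : l = q ∨ l = q + 1
  r_le : 0 < c → r ≤ c - 1
  ramp_last : 0 < c → m + ((c - 1) * q + r) + l = a
  step : ∀ t, 0 ≤ t → t < c - 1 → 0 < q + if t < r then 1 else 0
  last_pos : 0 < c → 0 < l
  empty : c = 0 → m = a ∧ l = a ∧ q = a

/-- A leftover step enters the first bay only where it is cheap. It enters the last bay if it is
cheap there or if the `c - 1` inner bays cannot take all that remain. If the quotient is `0`, then
`c ≤ a` forces `a = c`: the first bay is empty and all other bays get one step, so no edge
degenerates. -/
theorem isStripSplit {a b c d : ℤ} (ha : 0 ≤ a) (hc : 0 ≤ c)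
    (h : StripAdmissible a b c d) : IsStripSplit a b c d (a / (c + 1))
      (a - a / (c + 1) * (c + 1) - extraFirst a b c - extraLast a b c d) (a / (c + 1) + extraFirst a b c) (a / (c + 1) + extraLast a b c d) := by
  have hq : 0 ≤ a / (c + 1) := Int.ediv_nonneg ha (by omega)
  have hr := Int.emod_nonneg a (show c + 1 ≠ 0 by omega)
  have hr' := Int.emod_lt_of_pos a (show 0 < c + 1 by omega)
  have hqr := Int.mul_ediv_add_emod a (c + 1)
  have hq0 : a / (c + 1) = 0 → a % (c + 1) = c := by
    intro h0
    rw [h0] at hqr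
    have := h.1
    omega
  have hcq : c = 0 → a / (c + 1) = a := by rintro rfl; simp
  have e1 : a - a / (c + 1) * (c + 1) = a % (c + 1) := by linarith
  have e2 : a / (c + 1) * (c + 1) = c * (a / (c + 1)) + a / (c + 1) := by ring
  have h1 : extraFirst a b c = 0 ∨
      (extraFirst a b c = 1 ∧ a / (c + 1) < b ∧ 0 < a % (c + 1) ∧ 0 < a / (c + 1)) := by
    unfold extraFirst
    rw [e1]
    split_ifs with h <;> simp [h]
  have h2 : (extraLast a b c d = 0 ∧ (a % (c + 1) ≤ extraFirst a b c ∨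
      a % (c + 1) - extraFirst a b c < c)) ∨
      (extraLast a b c d = 1 ∧ extraFirst a b c < a % (c + 1)) := by
    unfold extraLast
    rw [e1]
    split_ifs with h
    · exact Or.inr ⟨rfl, h.1⟩
    · exact Or.inl ⟨rfl, by omega⟩
  rw [e1]
  have e3 : (c - 1) * (a / (c + 1)) = c * (a / (c + 1)) - a / (c + 1) := by ring
  have h3 := h.1
  generalize extraLast a b c d = y at *
  generalize extraFirst a b c = x at *
  generalize a % (c + 1) = r at *
  generalize a / (c + 1) = q at *
  refine ⟨hq, by omega, by omega, by omega, fun _ => by omega, fun _ => ?_, fun t h0 ht => ?_,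
    fun _ => by omega, fun _ => by omega⟩
  · rw [e3]; omega
  · split_ifs <;> omega

section Strip

variable {a b c d : ℕ} {q r m l : ℤ}

theorem IsStripSplit.first_nonneg (H : IsStripSplit a b c d q r m l) : 0 ≤ m := by
  have := H.q_nonneg
  have := H.first
  omega

theorem IsStripSplit.ramp_eq (H : IsStripSplit a b c d q r m l) (hc : 0 < c) :
    StairParams.ramp q r (c - 1) = a - l - m := by
  unfold StairParams.ramp
  rw [min_eq_right (H.r_le (by omega)), ← H.ramp_last (by omega)]
  ring

theorem IsStripSplit.last_le (H : IsStripSplit a b c d q r m l) : l ≤ a := by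
  have h1 := H.first_nonneg
  rcases Nat.eq_zero_or_pos c with h0 | h0
  · exact (H.empty (by omega)).2.1.le
  · have h2 := H.ramp_eq h0
    have : 0 ≤ StairParams.ramp q r (c - 1) := by
      rw [← StairParams.ramp_zero (q := q) H.r_nonneg]
      exact StairParams.ramp_mono H.q_nonneg (by omega)
    omega

theorem bayParams_isValid (H : IsStripSplit a b c d q r m l) :
    (bayParams a b d q r m l).IsValid a b c d := by
  have hm := H.first_nonneg
  have hq := H.q_nonneg
  have h9 := H.empty
  refine ⟨⟨?_, ?_⟩, ?_, ?_, ?_, ?_, ?_, ?_, ?_, H.step, H.r_nonneg⟩ <;> simp only [bayParams]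
  · omega
  · omega
  · omega
  · omega
  · split_ifs <;> omega
  · intro hc
    rw [H.ramp_eq hc]
    have := H.last_pos (by omega)
    omega
  · omega
  · omega
  · intro hc
    split_ifs <;> omega

/-- Along the diagonal part, the right ends of the upper edges lie on `y = x - 1` and the left ends
of the lower edges on `y = x - 2`, so an overlap of two edges already puts the lower one strictly
below. -/
theorem bayParams_isProfile (H : IsStripSplit a b c d q r m l) :
    IsProfile a b c d ((bayParams a b d q r m l).X a) ((bayParams a b d q r m l).Y a)
      ((bayParams a b d q r m l).U b c d) ((bayParams a b d q r m l).Z b) := by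
  refine StairParams.isProfile _ _ _ _ _ (bayParams_isValid H) ?_
  intro i j hi hj _ h
  have hm := H.first_nonneg
  have hl := H.last_le
  unfold StairParams.U StairParams.X at h
  unfold StairParams.Y StairParams.Z
  rw [if_neg (Nat.succ_ne_zero i)] at h
  simp only [bayParams] at *
  rcases le_or_gt j b with hjb | hjb
  · rw [if_pos hjb]
    clear h
    split_ifs <;> omega
  · have hr : StairParams.ramp q r (j - b - 1) ≤ a - l - m := by
      rw [← H.ramp_eq (by omega)]
      exact StairParams.ramp_mono H.q_nonneg (by omega)
    rw [if_neg (by omega : ¬ j = 0), if_neg (by omega : ¬ j ≤ b), if_pos hj] at h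
    rw [if_neg (by omega : ¬ j ≤ b)]
    generalize StairParams.ramp _ _ _ = R at *
    rcases Nat.lt_trichotomy i a with h' | h' | h'
    · rw [if_pos (by omega : i + 1 ≤ a)] at h
      rw [if_pos h']
      push_cast at h
      omega
    · rw [if_neg (by omega : ¬ i < a), if_pos h']
      omega
    · rw [if_neg (by omega : ¬ i < a), if_neg (by omega : ¬ i = a)]
      omega

/-- The area splits into bay costs. Inner bays are nonempty, so one with `q` steps costs `tri q +
q`, and the additional step in `r` of them costs `q + 2` each. For `c = 0` there is only one bay. -/
theorem bayParams_area (H : IsStripSplit a b c d q r m l) (hd : c = 0 → d = 0) (ha : a = 0 → c = 0) :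
    ∑ i ∈ Finset.range (a + d + 1), (bayParams a b d q r m l).Y a i *
      ((bayParams a b d q r m l).X a (i + 1) - (bayParams a b d q r m l).X a i) -
    ∑ j ∈ Finset.range (b + c + 1), (bayParams a b d q r m l).Z b j *
      ((bayParams a b d q r m l).U b c d (j + 1) - (bayParams a b d q r m l).U b c d j) =
    tri b + tri d + 1 + bayCost b m +
      if c = 0 then 0 else (c - 1) * (tri q + q) + r * (q + 2) + bayCost d l := by
  have hm := H.first_nonneg
  have ta := two_mul_tri a
  have tq := two_mul_tri q
  have tm := two_mul_tri m
  have tl := two_mul_tri l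
  have td := two_mul_tri d
  have e1 : ∀ x : ℤ, (a + max 0 (d - l)) * (a + 1 - if a = 0 then x else a) = a + max 0 (d - l) := by
    intro x
    split_ifs with h
    · have h1 := H.empty (by have := ha h; omega)
      have h2 := hd (ha h)
      have : (a : ℤ) + max 0 (d - l) = 0 := by omega
      rw [this, zero_mul]
    · ring
  have e2 : ∀ z x : ℤ, z * ((if b = 0 then min 0 (m - b) else m - b + b) - min 0 (m - b)) - tri b + b +
      (z - b) * (x - if b = 0 then min 0 (m - b) else m - b + b) =
      z * (m - min 0 (m - b) + 1) + (z - b) * (x - m - 1) - tri b := by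
    intro z x
    split_ifs with hb
    · subst hb
      have : min 0 (m - (0 : ℕ)) = 0 := by omega
      rw [this]
      push_cast
      ring
    · ring
  have e3 : (if 0 < m + b then (-1 : ℤ) else -2) * (m - min 0 (m - b) + 1) =
      - max (max m b) 1 - 1 := by
    split_ifs with h'
    · omega
    · obtain rfl : b = 0 := by omega
      obtain rfl : m = 0 := by omega
      simp
  refine mul_left_cancel₀ (two_ne_zero (α := ℤ)) ?_
  rw [StairParams.sum_top, mul_sub 2]
  unfold bayCost
  rcases c with _ | k
  · rw [StairParams.sum_bot_zero]
    obtain ⟨rfl, rfl, -⟩ := H.empty rfl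
    obtain rfl := hd rfl
    simp only [bayParams]
    rw [if_pos trivial, e1, e2, e3]
    have : max 0 (((0 : ℕ) : ℤ) - a) = 0 := by omega
    rw [this]
    push_cast
    rw [tri_zero]
    ring
  · rw [StairParams.two_mul_sum_bot _ _ _ H.r_nonneg, if_neg (Nat.succ_ne_zero k)]
    simp only [bayParams]
    rw [e1, e2, e3]
    have h5 := H.r_le (by omega)
    have h6 := H.ramp_last (by omega)
    have h8 := H.last_pos (by omega)
    have e5 : max (max l d) 1 = l + max 0 (d - l) := by omega
    push_cast at h5 h6 ⊢
    rw [add_sub_cancel_right] at *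
    have e4 : StairParams.ramp q r k = k * q + r := by
      unfold StairParams.ramp; rw [min_eq_right h5]
    rw [e4, min_eq_right h5, e5]
    have h7 : l = a - m - (k * q + r) := by omega
    clear e1 e2 e3 e4 e5 h5 h6 h8
    generalize max (max m b) 1 = M at *
    generalize max 0 (d - l) = D at *
    have h9 : 2 * tri a = 2 * tri l + (m + (k * q + r)) * (m + (k * q + r) + 1 + 2 * l) := by
      rw [ta, tl, h7]; ring
    linear_combination h9 - (k : ℤ) * tq - tm - 2 * td + (2 * (m + (k * q + r)) - 2 - 2 * d) * h7

theorem stripParams_isProfile (h : StripAdmissible a b c d) :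
    IsProfile a b c d ((stripParams a b c d).X a) ((stripParams a b c d).Y a)
      ((stripParams a b c d).U b c d) ((stripParams a b c d).Z b) :=
  bayParams_isProfile (isStripSplit (by omega) (by omega) h)

theorem stripParams_area (h : StripAdmissible a b c d) :
    ∑ i ∈ Finset.range (a + d + 1), (stripParams a b c d).Y a i *
      ((stripParams a b c d).X a (i + 1) - (stripParams a b c d).X a i) -
    ∑ j ∈ Finset.range (b + c + 1), (stripParams a b c d).Z b j *
      ((stripParams a b c d).U b c d (j + 1) - (stripParams a b c d).U b c d j) =
    stripValue a b c d := by
  have hd : c = 0 → d = 0 := fun h0 => by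
    rcases h.2 with h | h <;> omega
  have H := isStripSplit (by omega) (by omega) h
  have h1 := h.1
  unfold stripParams
  rw [bayParams_area H hd (by omega)]
  have hx : extraFirst a b c = 0 ∨ extraFirst a b c = 1 := by
    unfold extraFirst; split_ifs <;> simp
  have hy : extraLast a b c d = 0 ∨ extraLast a b c d = 1 := by
    unfold extraLast; split_ifs <;> simp
  have hx' : extraFirst a b c = 1 ↔ (a : ℤ) / (c + 1) < b ∧ 0 < a - (a : ℤ) / (c + 1) * (c + 1) ∧
      0 < (a : ℤ) / (c + 1) := by
    unfold extraFirst; split_ifs with h <;> simp only [h] <;> simp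
  have hy' : extraLast a b c d = 1 ↔ extraFirst a b c < a - (a : ℤ) / (c + 1) * (c + 1) ∧
      ((a : ℤ) / (c + 1) < d ∨ (c : ℤ) ≤ a - (a : ℤ) / (c + 1) * (c + 1) - extraFirst a b c) := by
    unfold extraLast; split_ifs with h <;> simp only [h] <;> simp
  have hr : 0 ≤ a - (a : ℤ) / (c + 1) * (c + 1) ∧ a - (a : ℤ) / (c + 1) * (c + 1) ≤ c := by
    have := Int.emod_nonneg a (show (c : ℤ) + 1 ≠ 0 by omega)
    have := Int.emod_lt_of_pos a (show (0 : ℤ) < c + 1 by omega)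
    have := Int.mul_ediv_add_emod a (c + 1)
    rw [mul_comm] at this
    omega
  have hq := H.q_nonneg
  have hq0 : (a : ℤ) / (c + 1) = 0 → a - (a : ℤ) / (c + 1) * (c + 1) = c := by
    intro h0; rw [h0] at hr ⊢; omega
  by_cases hc : c = 0
  · obtain rfl := hc
    obtain rfl := hd rfl
    rw [if_pos rfl, (H.empty rfl).1]
    push_cast
    rw [stripValue_zero (Int.natCast_nonneg a), tri_zero]
    unfold bayCost
    ring
  unfold stripValue bayCost
  rw [if_neg hc]
  clear H
  have hc' : 0 < c := by omega
  generalize extraFirst a b c = x at *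
  generalize extraLast a b c d = y at *
  generalize a - (a : ℤ) / (c + 1) * (c + 1) = R at *
  generalize (a : ℤ) / (c + 1) = q at *
  have e : tri (q + x) = tri q + x * (q + 1) := by
    rcases hx with rfl | rfl
    · simp
    · rw [tri_succ]; ring
  have e' : tri (q + y) = tri q + y * (q + 1) := by
    rcases hy with rfl | rfl
    · simp
    · rw [tri_succ]; ring
  rw [e, e']
  clear e e'
  -- With quotient `0` the maxima with `1` matter; here the remainder is `c`, the first bay takes no
  -- additional step and the last bay takes one.
  rcases hq.eq_or_lt with rfl | hq
  · have := hq0 rfl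
    obtain rfl : x = 0 := by omega
    obtain rfl : y = 1 := by omega
    rw [if_neg (lt_irrefl _), tri_zero, show max (0 : ℤ) 1 = 1 from rfl]
    have : max (max (0 + 1) (d : ℤ)) 1 = max (max 0 (d : ℤ)) 1 := by omega
    rw [this, add_zero (0 : ℤ)]
    linear_combination hq0 rfl
  · rw [if_pos hq, show max q 1 = q by omega]
    have : R - x - y + max (max (q + x) b) 1 + max (max (q + y) d) 1 =
        max (max q b) 1 + max (max q d) 1 +
        max 0 (R - ((if q < b then 1 else 0) + if q < d then 1 else 0)) := by
      have e1 : max (max (q + x) b) 1 = max (max q b) 1 + if q < b then 0 else x := by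
        split_ifs with hb
        · have := hq; omega
        · omega
      have e2 : max (max (q + y) d) 1 = max (max q d) 1 + if q < d then 0 else y := by
        split_ifs with hb
        · have := hq; omega
        · omega
      rw [e1, e2]
      clear e1 e2 hq0
      generalize max (max q (b : ℤ)) 1 = B
      generalize max (max q (d : ℤ)) 1 = D
      by_cases hb : q < b
      · by_cases hd : q < d
        · simp only [hb, hd, if_true]
          omega
        · simp only [hb, hd, if_true, if_false]
          omega
      · by_cases hd : q < d
        · simp only [hb, hd, if_true, if_false]
          omega
        · simp only [hb, hd, if_false]
          omega
    linear_combination this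

end Strip

/-! ### Monotone polygons have four stairs -/

theorem exists_block (A : ℕ → Prop) (N : ℕ)
    (h : ∀ e₁ e₂, e₁ < e₂ → e₂ < N → ¬ A e₁ → A e₂ → False) :
    ∃ p ≤ N, ∀ e < N, A e ↔ e < p := by
  classical
  have hex : ∃ p, p = N ∨ ¬ A p := ⟨N, Or.inl rfl⟩
  refine ⟨Nat.find hex, Nat.find_le (Or.inl rfl), fun e he => ⟨fun hA => ?_, fun hlt => ?_⟩⟩
  · by_contra hlt
    rcases Nat.find_spec hex with h' | h'
    · omega
    · rcases (not_lt.1 hlt).eq_or_lt with heq | hlt'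
      · exact h' (heq ▸ hA)
      · exact h _ _ hlt' he h' hA
  · have := Nat.find_min hex hlt
    tauto

theorem exists_lt_succ_of_periodic {F : ℕ → ℤ} {n : ℕ} (hper : ∀ k, F (k + n) = F k)
    {k : ℕ} (hk : F k ≠ F (k + 1)) (hn : 0 < n) : ∃ l, F l < F (l + 1) := by
  by_contra! h
  have hanti : Antitone F := antitone_nat_of_succ_le h
  have h1 := hanti (show k + 1 ≤ k + n by omega)
  have h2 := h k
  rw [hper] at h1
  omega

namespace GridCycle

variable {n : ℕ} [NeZero n]

theorem finRotate_iterate_ofNat (o t : ℕ) :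
    (finRotate n)^[t] (Fin.ofNat n o) = Fin.ofNat n (o + t) := by
  induction t with
  | zero => rfl
  | succ t ih => rw [Function.iterate_succ_apply', ih, finRotate_ofNat]; rfl

/-- Along a closed walk that splits into two chains, increasing and decreasing steps do not
alternate twice. -/
theorem SplitsIntoTwoChains.not_alternating {f : Fin n → ℤ} (h : SplitsIntoTwoChains f) (o : ℕ)
    {k₁ k₂ k₃ k₄ : ℕ} (h₁₂ : k₁ < k₂) (h₂₃ : k₂ < k₃) (h₃₄ : k₃ < k₄) (h₄ : k₄ < n) {F : ℕ → ℤ}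
    (hF : ∀ k, F k = f (Fin.ofNat n (o + k))) :
    ¬ (F k₁ < F (k₁ + 1) ∧ F (k₂ + 1) < F k₂ ∧ F k₃ < F (k₃ + 1) ∧ F (k₄ + 1) < F k₄) ∧
    ¬ (F (k₁ + 1) < F k₁ ∧ F k₂ < F (k₂ + 1) ∧ F (k₃ + 1) < F k₃ ∧ F k₄ < F (k₄ + 1)) := by
  obtain ⟨i, m, hup, hdown⟩ := h
  obtain ⟨s, hs, rfl⟩ := exists_eq_ofNat o i
  -- `t` is the position of `k` counted from the start of the rising chain. Strict ascents have `t <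
  -- m` and strict descents `m ≤ t`, and a cyclic order cannot alternate twice between an initial
  -- segment and its complement.
  have key : ∀ k < n, ∃ t < n, (k = t + s ∨ k + n = t + s) ∧ (t < m → F k ≤ F (k + 1)) ∧
      (m ≤ t → F (k + 1) ≤ F k) := by
    intro k hk
    obtain ⟨t, ht, h⟩ : ∃ t < n, k = t + s ∨ k + n = t + s := by
      rcases le_or_gt s k with h | h
      · exact ⟨k - s, by omega, by omega⟩
      · exact ⟨k + n - s, by omega, by omega⟩
    have e : ∀ j, (finRotate n)^[t + j] (Fin.ofNat n (o + s)) = Fin.ofNat n (o + (k + j)) := by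
      intro j
      rw [finRotate_iterate_ofNat]
      apply ofNat_congr
      rcases h with h | h
      · congr 1; omega
      · rw [show o + s + (t + j) = o + (k + j) + n by omega, Nat.add_mod_right]
    have e0 := e 0
    rw [add_zero, add_zero] at e0
    refine ⟨t, ht, h, fun htm => ?_, fun htm => ?_⟩
    · have := hup t htm
      rwa [e 1, e0, ← hF, ← hF] at this
    · have := hdown t htm ht
      rwa [e 1, e0, ← hF, ← hF] at this
  obtain ⟨t₁, a₁, b₁, c₁, d₁⟩ := key k₁ (by omega)
  obtain ⟨t₂, a₂, b₂, c₂, d₂⟩ := key k₂ (by omega)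
  obtain ⟨t₃, a₃, b₃, c₃, d₃⟩ := key k₃ (by omega)
  obtain ⟨t₄, a₄, b₄, c₄, d₄⟩ := key k₄ (by omega)
  constructor
  · rintro ⟨e₁, e₂, e₃, e₄⟩
    have : t₁ < m := by by_contra hc; have := d₁ (by omega); omega
    have : ¬ t₂ < m := by intro hc; have := c₂ hc; omega
    have : t₃ < m := by by_contra hc; have := d₃ (by omega); omega
    have : ¬ t₄ < m := by intro hc; have := c₄ hc; omega
    omega
  · rintro ⟨e₁, e₂, e₃, e₄⟩
    have : ¬ t₁ < m := by intro hc; have := c₁ hc; omega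
    have : t₂ < m := by by_contra hc; have := d₂ (by omega); omega
    have : ¬ t₃ < m := by intro hc; have := c₃ hc; omega
    have : t₄ < m := by by_contra hc; have := d₄ (by omega); omega
    omega

variable {P : GridCycle n} {S : Fin n → Turn}

theorem Realizes.crossAt_ne (hP : P.Realizes S) (o k : ℕ) :
    crossAt (P.walk o k) (P.walk o (k + 1)) (P.walk o (k + 2)) ≠ 0 := by
  obtain ⟨-, -, -, ht⟩ := (realizes_iff P S o).1 hP
  have := ht k
  split at this <;> omega

theorem Realizes.alternates (hP : P.Realizes S) (o : ℕ)
    (h0 : (P.walk o 0).1 ≠ (P.walk o 1).1) (e : ℕ) :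
    ((P.walk o (2 * e)).1 ≠ (P.walk o (2 * e + 1)).1 ∧
      (P.walk o (2 * e + 1)).2 = (P.walk o (2 * e)).2) ∧
    ((P.walk o (2 * e + 1)).2 ≠ (P.walk o (2 * e + 2)).2 ∧
      (P.walk o (2 * e + 2)).1 = (P.walk o (2 * e + 1)).1) := by
  obtain ⟨-, hs, -, -⟩ := (realizes_iff P S o).1 hP
  have hv : ∀ k, (P.walk o k).1 ≠ (P.walk o (k + 1)).1 →
      (P.walk o (k + 1)).2 = (P.walk o k).2 ∧ (P.walk o (k + 1)).2 ≠ (P.walk o (k + 2)).2 ∧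
      (P.walk o (k + 2)).1 = (P.walk o (k + 1)).1 := by
    intro k hk
    have h1 : (P.walk o (k + 1)).2 = (P.walk o k).2 := by
      rcases hs.axis k with h | h
      · exact absurd h hk
      · exact h.symm
    have h2 : (P.walk o (k + 1)).2 ≠ (P.walk o (k + 2)).2 := by
      intro h
      apply hP.crossAt_ne o k
      unfold crossAt
      rw [← h, h1]; ring
    refine ⟨h1, h2, ?_⟩
    rcases hs.axis (k + 1) with h | h
    · exact h.symm
    · exact absurd h h2
  have hh : ∀ k, (P.walk o k).1 ≠ (P.walk o (k + 1)).1 →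
      (P.walk o (k + 2)).1 ≠ (P.walk o (k + 3)).1 := by
    intro k hk h
    obtain ⟨h1, h2, h3⟩ := hv k hk
    apply hP.crossAt_ne o (k + 1)
    unfold crossAt
    rw [show k + 1 + 2 = k + 3 by ring, show k + 1 + 1 = k + 2 by ring, ← h, h3]; ring
  have : (P.walk o (2 * e)).1 ≠ (P.walk o (2 * e + 1)).1 := by
    induction e with
    | zero => exact h0
    | succ e ih => exact hh _ ih
  exact ⟨⟨this, (hv _ this).1⟩, (hv _ this).2⟩

/-- An `x`-monotone polygon traces two chains. -/
theorem Realizes.exists_traces (hP : P.Realizes S)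
    (hx : SplitsIntoTwoChains (fun i => (P i).1)) :
    ∃ o p r X Y U Z, n = 2 * p + 2 * r + 4 ∧ Traces p r X Y U Z (P.walk o) := by
  have hn := Nat.pos_of_ne_zero (NeZero.ne n)
  have hF : ∀ o k, (P.walk o k).1 = (fun i => (P i).1) (Fin.ofNat n (o + k)) := fun _ _ => rfl
  obtain ⟨o₁, h1⟩ : ∃ o, (P.walk o 0).1 ≠ (P.walk o 1).1 := by
    by_contra! h
    have h0 := h 0
    have h1 := h 1
    rw [show (1 : ℕ) = 0 + 1 from rfl, walk_offset, walk_offset] at h1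
    apply hP.crossAt_ne 0 0
    unfold crossAt
    simp only [zero_add, Nat.reduceAdd] at *
    rw [← h1, ← h0]; ring
  obtain ⟨o₂, h2⟩ : ∃ o, (P.walk o 0).1 < (P.walk o 1).1 := by
    obtain ⟨l, hl⟩ := exists_lt_succ_of_periodic (F := fun k => (P.walk o₁ k).1)
      (fun k => by rw [walk_add_period]) h1 hn
    exact ⟨o₁ + l, by rw [walk_offset, walk_offset]; exact hl⟩
  have hex : ∃ e, (P.walk o₂ (2 * e + 1)).1 < (P.walk o₂ (2 * e)).1 := by
    obtain ⟨l, hl⟩ := exists_lt_succ_of_periodic (F := fun k => - (P.walk o₂ k).1) (k := 0)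
      (fun k => by rw [walk_add_period]) (by simpa using h2.ne) hn
    rcases Nat.even_or_odd' l with ⟨e, rfl | rfl⟩
    · exact ⟨e, by simpa using hl⟩
    · have := (hP.alternates o₂ h2.ne e).2.2
      rw [add_assoc, this] at hl
      exact absurd hl (lt_irrefl _)
  classical
  -- The walk is restarted at the first leftward edge after a rightward one. The last horizontal
  -- edge of the period then runs to the right, and `x`-monotonicity forces the leftward edges into
  -- one initial block.
  obtain ⟨e, he0, he, hmin⟩ : ∃ e, 0 < e ∧ (P.walk o₂ (2 * e + 1)).1 < (P.walk o₂ (2 * e)).1 ∧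
      (P.walk o₂ (2 * (e - 1))).1 < (P.walk o₂ (2 * (e - 1) + 1)).1 := by
    have h0 : 0 < Nat.find hex := by
      rw [Nat.find_pos]
      simpa using h2.le
    refine ⟨Nat.find hex, h0, Nat.find_spec hex, ?_⟩
    have := Nat.find_min hex (m := Nat.find hex - 1) (by omega)
    have := (hP.alternates o₂ h2.ne (Nat.find hex - 1)).1.1
    omega
  have hw : (P.walk (o₂ + 2 * e) 1).1 < (P.walk (o₂ + 2 * e) 0).1 := by
    rw [walk_offset, walk_offset]; exact he
  obtain ⟨N, hN⟩ : ∃ N, n = 2 * N := by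
    rcases Nat.even_or_odd' n with ⟨N, h | h⟩
    · exact ⟨N, h⟩
    · have h' := (hP.alternates (o₂ + 2 * e) hw.ne' N).2.2
      rw [show 2 * N + 2 = 1 + n by omega, show 2 * N + 1 = 0 + n by omega, walk_add_period,
        walk_add_period] at h'
      omega
  have hlast : (P.walk (o₂ + 2 * e) (2 * (N - 1))).1 < (P.walk (o₂ + 2 * e) (2 * (N - 1) + 1)).1 := by
    rw [walk_offset, walk_offset, show 2 * e + 2 * (N - 1) = 2 * (e - 1) + n by omega,
      show 2 * e + (2 * (N - 1) + 1) = 2 * (e - 1) + 1 + n by omega, walk_add_period,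
      walk_add_period]
    exact hmin
  generalize o₂ + 2 * e = o at *
  have alt := hP.alternates o hw.ne'
  have hN2 : 2 ≤ N := by
    by_contra hc
    obtain rfl : N = 1 := by omega
    simp at hlast
    omega
  obtain ⟨p', hp', hA⟩ := exists_block (fun e => (P.walk o (2 * e + 1)).1 < (P.walk o (2 * e)).1) N
    (fun e₁ e₂ h12 h2 hn1 h2' => by
      have h1' := (alt e₁).1.1
      have e1 : e₁ ≠ 0 := by
        rintro rfl; simp at hn1; omega
      have e2 : e₂ ≠ N - 1 := by
        rintro rfl; omega
      refine (SplitsIntoTwoChains.not_alternating hx o (k₁ := 0) (k₂ := 2 * e₁) (k₃ := 2 * e₂)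
        (k₄ := 2 * (N - 1)) (by omega) (by omega) (by omega) (by omega) (hF o)).2
        ⟨hw, by omega, h2', hlast⟩)
  have p0 : 0 < p' := (hA 0 (by omega)).1 (by simpa using hw)
  have p1 : p' < N := by
    rcases hp'.eq_or_lt with h | h
    · have := (hA (N - 1) (by omega)).2 (by omega)
      omega
    · exact h
  obtain ⟨p, rfl⟩ : ∃ p, p' = p + 1 := ⟨p' - 1, by omega⟩
  obtain ⟨r, rfl⟩ : ∃ r, N = p + r + 2 := ⟨N - p - 2, by omega⟩
  have hn' : n = 2 * p + 2 * r + 4 := by omega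
  refine ⟨o, p, r, _, _, _, _, hn', Traces.of_edges (fun k => ?_) (fun e he => ?_) (fun e he => ?_)
    (fun e he => ?_) (fun e he => ?_)⟩
  · rw [← hn']; exact walk_add_period P o k
  · exact ⟨(hA e (by omega)).2 (by omega), (alt e).1.2⟩
  · exact (alt e).2.2
  · have h1 := hA (p + 1 + e) (by omega)
    have h2 := (alt (p + 1 + e)).1
    rw [show 2 * (p + 1 + e) = 2 * p + 2 + 2 * e by ring,
      show 2 * p + 2 + 2 * e + 1 = 2 * p + 3 + 2 * e by ring] at *
    omega
  · have h2 := (alt (p + 1 + e)).2.2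
    rwa [show 2 * (p + 1 + e) + 2 = 2 * p + 4 + 2 * e by ring,
      show 2 * (p + 1 + e) + 1 = 2 * p + 3 + 2 * e by ring] at h2

/-- In a counterclockwise polygon, the chain that runs to the left lies above the other one. -/
theorem Realizes.left_pos_of_traces (hP : P.Realizes S) {o p r : ℕ} {X Y U Z : ℕ → ℤ}
    (hn : n = 2 * p + 2 * r + 4) (T : Traces p r X Y U Z (P.walk o)) : Z 0 < Y 0 := by
  obtain ⟨-, hs, hc, -⟩ := (realizes_iff P S o).1 hP
  by_contra hneg
  have h0 : Y 0 < Z 0 := by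
    rcases (not_lt.1 hneg).eq_or_lt with h | h
    · refine absurd ?_ (hs.ne (2 * p + 1))
      rw [(T.top 0 p (by omega)).2, show 2 * p + 1 + 1 = 2 * p + 2 + 2 * 0 by ring,
        (T.bot 0 (by omega)).1, h, T.left]
    · exact h
  obtain ⟨v, -, hv⟩ := Finset.exists_min_image Finset.univ (fun i => (P i).2)
    ⟨Fin.ofNat n 0, Finset.mem_univ _⟩
  have hv' : ∀ l, (P v).2 ≤ (P.walk o l).2 := fun l => hv _ (Finset.mem_univ _)
  obtain ⟨k, hk, rfl⟩ := exists_eq_ofNat o v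
  change ∀ l, (P.walk o k).2 ≤ (P.walk o l).2 at hv'
  -- If a leftward edge had minimal height, the left turn required at its left end would lead
  -- further down.
  have htop : ∀ e ≤ p, (P.walk o k).2 ≠ Y (p - e) := by
    intro e he h
    have hE := hc (2 * e) (by
      rw [(T.top (p - e) e (by omega)).2]
      intro l; rw [← h]; exact hv' l)
    have h2 := hv' (2 * e + 2)
    have hx := T.X_lt (p - e) (by omega)
    unfold crossAt at hE
    rw [(T.top (p - e) e (by omega)).1, (T.top (p - e) e (by omega)).2] at hE
    rw [h] at h2
    nlinarith
  have hbot : ∀ j ≤ r, (P.walk o k).2 ≠ Z j := by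
    intro j hj h
    obtain ⟨i, hi, h1, h2⟩ := T.exists_above hj
    have := (T.no_crossing (hn ▸ hs) (i + j) i j rfl hi hj h1 h2).2.2 h0
    have := hv' (2 * (p - i))
    rw [(T.top i (p - i) (by omega)).1] at this
    omega
  rcases chain_cases p (r := r) (k := k) (by omega) with
    ⟨e, he, rfl⟩ | ⟨e, he, rfl⟩ | ⟨e, he, rfl⟩ | ⟨e, he, rfl⟩
  · exact htop e he (by rw [(T.top (p - e) e (by omega)).1])
  · exact htop e he (by rw [(T.top (p - e) e (by omega)).2])
  · exact hbot e he (by rw [(T.bot e he).1])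
  · exact hbot e he (by rw [(T.bot e he).2])

/-- The turns of a polygon with a profile form four stairs. -/
theorem Realizes.stairsFrom_of_profile (hP : P.Realizes S) {o a b c d : ℕ} {X Y U Z : ℕ → ℤ}
    (hn : n = 2 * (a + b + c + d) + 4) (H : IsProfile a b c d X Y U Z)
    (T : Traces (a + d) (b + c) X Y U Z (P.walk o)) : StairsFrom S o a b c d := by
  obtain ⟨-, -, -, ht⟩ := (realizes_iff P S o).1 hP
  refine ⟨hn, fun k hk => ?_⟩
  have h1 := H.turn_spec T (k := k) (by omega) rfl
  have h2 : match S (Fin.ofNat n (o + k)) with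
        | Turn.left => 0 < crossAt (if k = 0 then P.walk o (2 * (a + d) + 2 * (b + c) + 3)
            else P.walk o (k - 1)) (P.walk o k) (P.walk o (k + 1))
        | Turn.right => crossAt (if k = 0 then P.walk o (2 * (a + d) + 2 * (b + c) + 3)
            else P.walk o (k - 1)) (P.walk o k) (P.walk o (k + 1)) < 0 := by
    rcases k with _ | k
    · have := ht (2 * (a + d) + 2 * (b + c) + 3)
      rw [show 2 * (a + d) + 2 * (b + c) + 3 + 2 = 1 + n by omega,
        show 2 * (a + d) + 2 * (b + c) + 3 + 1 = 0 + n by omega, walk_add_period,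
        walk_add_period, ofNat_congr (l := o + 0) (by rw [← add_assoc, Nat.add_mod_right])] at this
      exact this
    · exact ht k
  rcases h1 with ⟨h3, h4⟩ | ⟨h3, h4, -⟩
  · rw [h3]
    cases h5 : S (Fin.ofNat n (o + k)) with
    | left => rfl
    | right => rw [h5] at h2; exact absurd h4 (not_lt.2 h2.le)
  · rw [h3]
    cases h5 : S (Fin.ofNat n (o + k)) with
    | right => rfl
    | left => rw [h5] at h2; exact absurd h4 (not_lt.2 h2.le)

/-- The walk descends at the left end and ascends at the right end. With these two edges,
`y`-monotonicity leaves only one change of vertical direction inside each chain, so each chain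
consists of two stairs. -/
theorem Realizes.exists_stairsFrom (hP : P.Realizes S) (hxy : P.IsXYMonotone) :
    ∃ o a b c d, StairsFrom S o a b c d := by
  obtain ⟨hx, hy⟩ := hxy
  obtain ⟨o, p, r, X, Y, U, Z, hn, T⟩ := hP.exists_traces hx
  obtain ⟨-, hs, -, -⟩ := (realizes_iff P S o).1 hP
  have h0 := hP.left_pos_of_traces hn T
  have sep := fun i j (hi : i ≤ p) (hj : j ≤ r) h1 h2 =>
    (T.no_crossing (hn ▸ hs) (i + j) i j rfl hi hj h1 h2).1.2 h0
  have hr : Z r < Y p := sep p r le_rfl le_rfl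
    (by rw [← T.right]; exact (T.X_lt p le_rfl).le) (by rw [T.right]; exact (T.U_lt r le_rfl).le)
  have alt := hP.alternates o (by
    have h := T.X_lt p le_rfl
    rw [(T.top p 0 (by omega)).1, show (1 : ℕ) = 2 * 0 + 1 from rfl, (T.top p 0 (by omega)).2]
    exact h.ne')
  have hF : ∀ k, (P.walk o k).2 = (fun i => (P i).2) (Fin.ofNat n (o + k)) := fun _ => rfl
  have hdown : (P.walk o (2 * p + 2)).2 < (P.walk o (2 * p + 1)).2 := by
    rw [(T.top 0 p (by omega)).2, show 2 * p + 2 = 2 * p + 2 + 2 * 0 by ring, (T.bot 0 (by omega)).1]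
    exact h0
  have hup : (P.walk o (2 * p + 2 * r + 3)).2 < (P.walk o (2 * p + 2 * r + 3 + 1)).2 := by
    rw [show 2 * p + 2 * r + 3 + 1 = 2 * p + 2 * r + 4 by ring, T.last_eq,
      show 2 * p + 2 * r + 3 = 2 * p + 3 + 2 * r by ring, (T.bot r le_rfl).2]
    exact hr
  obtain ⟨d, hd, hA⟩ := exists_block (fun e => (P.walk o (2 * e + 1)).2 < (P.walk o (2 * e + 2)).2)
    (p + 1) (fun e₁ e₂ h12 h2 hn1 h2' => by
      have h1' := (alt e₁).2.1
      have e2 : e₂ ≠ p := by rintro rfl; omega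
      exact (SplitsIntoTwoChains.not_alternating hy o (k₁ := 2 * e₁ + 1) (k₂ := 2 * e₂ + 1)
        (k₃ := 2 * p + 1) (k₄ := 2 * p + 2 * r + 3) (by omega) (by omega) (by omega) (by omega) hF).2
        ⟨by rw [show 2 * e₁ + 1 + 1 = 2 * e₁ + 2 from rfl]; omega, h2', hdown, hup⟩)
  obtain ⟨b, hb, hB⟩ := exists_block
    (fun e => (P.walk o (2 * p + 4 + 2 * e)).2 < (P.walk o (2 * p + 3 + 2 * e)).2)
    (r + 1) (fun e₁ e₂ h12 h2 hn1 h2' => by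
      have h1' := (alt (p + 1 + e₁)).2.1
      rw [show 2 * (p + 1 + e₁) + 1 = 2 * p + 3 + 2 * e₁ by ring,
        show 2 * (p + 1 + e₁) + 2 = 2 * p + 4 + 2 * e₁ by ring] at h1'
      have e2 : e₂ ≠ r := by
        rintro rfl
        rw [show 2 * p + 4 + 2 * e₂ = 2 * p + 2 * e₂ + 3 + 1 by ring,
          show 2 * p + 3 + 2 * e₂ = 2 * p + 2 * e₂ + 3 by ring] at h2'
        omega
      refine (SplitsIntoTwoChains.not_alternating hy o (k₁ := 2 * p + 1) (k₂ := 2 * p + 3 + 2 * e₁)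
        (k₃ := 2 * p + 3 + 2 * e₂) (k₄ := 2 * p + 2 * r + 3) (by omega) (by omega) (by omega)
        (by omega) hF).2 ⟨hdown, ?_, ?_, hup⟩
      · rw [show 2 * p + 3 + 2 * e₁ + 1 = 2 * p + 4 + 2 * e₁ by ring]; omega
      · rw [show 2 * p + 3 + 2 * e₂ + 1 = 2 * p + 4 + 2 * e₂ by ring]; exact h2')
  have hd' : d ≤ p := by
    by_contra hc
    have := (hA p (by omega)).2 (by omega)
    omega
  have hb' : b ≤ r := by
    by_contra hc
    have := (hB r (by omega)).2 (by omega)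
    rw [show 2 * p + 4 + 2 * r = 2 * p + 2 * r + 3 + 1 by ring,
      show 2 * p + 3 + 2 * r = 2 * p + 2 * r + 3 by ring] at this
    omega
  obtain ⟨a, rfl⟩ : ∃ a, p = a + d := ⟨p - d, by omega⟩
  obtain ⟨c, rfl⟩ : ∃ c, r = b + c := ⟨r - b, by omega⟩
  have hYY : ∀ i < a + d, (P.walk o (2 * (a + d - (i + 1)) + 1)).2 = Y (i + 1) ∧
      (P.walk o (2 * (a + d - (i + 1)) + 2)).2 = Y i := by
    intro i hi
    rw [(T.top (i + 1) (a + d - (i + 1)) (by omega)).2,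
      show 2 * (a + d - (i + 1)) + 2 = 2 * (a + d - i) by omega,
      (T.top i (a + d - i) (by omega)).1]
    exact ⟨rfl, rfl⟩
  have hZZ : ∀ j < b + c, (P.walk o (2 * (a + d) + 3 + 2 * j)).2 = Z j ∧
      (P.walk o (2 * (a + d) + 4 + 2 * j)).2 = Z (j + 1) := by
    intro j hj
    rw [(T.bot j (by omega)).2, show 2 * (a + d) + 4 + 2 * j = 2 * (a + d) + 2 + 2 * (j + 1) by ring,
      (T.bot (j + 1) (by omega)).1]
    exact ⟨rfl, rfl⟩
  refine ⟨o, a, b, c, d, hP.stairsFrom_of_profile (by omega) ⟨T.X_lt, T.U_lt, T.left, T.right, ?_, ?_, ?_,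
    ?_, sep⟩ T⟩
  · intro i hi
    obtain ⟨h1, h2⟩ := hYY i (by omega)
    have h3 := hA (a + d - (i + 1)) (by omega)
    have h4 := (alt (a + d - (i + 1))).2.1
    omega
  · intro i hi hi'
    obtain ⟨h1, h2⟩ := hYY i (by omega)
    have h3 := hA (a + d - (i + 1)) (by omega)
    omega
  · intro j hj
    obtain ⟨h1, h2⟩ := hZZ j (by omega)
    have h3 := hB j (by omega)
    omega
  · intro j hj hj'
    obtain ⟨h1, h2⟩ := hZZ j hj'
    have h3 := hB j (by omega)
    have h4 := (alt (a + d + 1 + j)).2.1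
    rw [show 2 * (a + d + 1 + j) + 1 = 2 * (a + d) + 3 + 2 * j by ring,
        show 2 * (a + d + 1 + j) + 2 = 2 * (a + d) + 4 + 2 * j by ring] at h4
    omega

end GridCycle

/-! ### The optimum in terms of the stair counts -/

theorem length_stairSeq (k : ℕ) : (stairSeq k).length = 2 * k := by
  unfold stairSeq
  simp [mul_comm]

theorem getElem?_stairSeq {k i : ℕ} (h : i < 2 * k) :
    (stairSeq k)[i]? = some (if i % 2 = 0 then Turn.left else Turn.right) := by
  induction k generalizing i with
  | zero => omega
  | succ k ih =>
    have e : stairSeq (k + 1) = Turn.left :: Turn.right :: stairSeq k := by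
      simp [stairSeq, List.replicate_succ]
    rw [e]
    rcases i with _ | _ | i
    · rfl
    · rfl
    · rw [List.getElem?_cons_succ, List.getElem?_cons_succ, ih (by omega)]
      congr 2
      rw [Nat.add_assoc, Nat.add_mod_right]

theorem length_stairWord (tl bl br tr : ℕ) :
    (stairWord tl bl br tr).length = 2 * (bl + br + tr + tl) + 4 := by
  unfold stairWord
  simp only [List.length_append, List.length_cons, length_stairSeq]
  ring

/-- The word starts with a separator whereas `stairTurn` starts just after one, whence the shift by
one. -/
theorem getElem?_stairWord {a b c d k : ℕ} (hk : k < 2 * (a + b + c + d) + 4) :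
    (stairWord d a b c)[(k + 1) % (2 * (a + b + c + d) + 4)]? = some (stairTurn a b c d k) := by
  have key : ∀ i k, i < 2 * (a + b + c + d) + 4 → (k + 1 = i ∨ i = 0 ∧ k + 1 = 2 * (a + b + c + d) + 4) →
      (stairWord d a b c)[i]? = some (stairTurn a b c d k) := by
    intro i k hi hk
    have hs : ∀ t (l : List Turn) j, (Turn.left :: stairSeq t ++ l)[j]? =
        if j < 2 * t + 1 then some (if j = 0 ∨ j % 2 = 1 then Turn.left else Turn.right)
        else l[j - (2 * t + 1)]? := by
      intro t l j
      rw [List.getElem?_append]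
      simp only [List.length_cons, length_stairSeq]
      split_ifs with h h1
      · rcases j with _ | j
        · rfl
        · rw [List.getElem?_cons_succ, getElem?_stairSeq (by omega), if_pos (by omega)]
      · rcases j with _ | j
        · omega
        · rw [List.getElem?_cons_succ, getElem?_stairSeq (by omega), if_neg (by omega)]
      · rfl
    have e : stairWord d a b c = Turn.left :: stairSeq d ++ (Turn.left :: stairSeq a ++
        (Turn.left :: stairSeq b ++ (Turn.left :: stairSeq c ++ []))) := by
      unfold stairWord; simp
    rw [e, hs, hs, hs, hs]
    unfold stairTurn
    have hl : ∀ (p : Prop) [Decidable p], p → Turn.left = if p then Turn.left else Turn.right :=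
      fun p _ h => (if_pos h).symm
    have hr : ∀ (p : Prop) [Decidable p], ¬ p → Turn.right = if p then Turn.left else Turn.right :=
      fun p _ h => (if_neg h).symm
    by_cases h1 : i < 2 * d + 1
    · rw [if_pos h1]
      split_ifs <;> first | rfl | omega
    rw [if_neg h1]
    by_cases h2 : i - (2 * d + 1) < 2 * a + 1
    · rw [if_pos h2]
      split_ifs <;> first | rfl | omega
    rw [if_neg h2]
    by_cases h3 : i - (2 * d + 1) - (2 * a + 1) < 2 * b + 1
    · rw [if_pos h3]
      split_ifs <;> first | rfl | omega
    rw [if_neg h3, if_pos (by omega)]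
    split_ifs <;> first | rfl | omega
  refine key _ k (Nat.mod_lt _ (by omega)) ?_
  rcases (show k + 1 ≤ 2 * (a + b + c + d) + 4 by omega).eq_or_lt with h | h
  · rw [h, Nat.mod_self]; omega
  · rw [Nat.mod_eq_of_lt h]; omega

theorem HasStairCounts.exists_stairsFrom {n : ℕ} [NeZero n] {S : Fin n → Turn} {tl bl br tr : ℕ}
    (h : HasStairCounts S tl bl br tr) : ∃ o, StairsFrom S o bl br tr tl := by
  obtain ⟨m, hm⟩ := h
  have hn : n = 2 * (bl + br + tr + tl) + 4 := by
    rw [← length_stairWord tl bl br tr, ← hm, List.length_rotate, List.length_ofFn]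
  refine ⟨m + 1, hn, fun k hk => ?_⟩
  have h1 := getElem?_stairWord (a := bl) (b := br) (c := tr) (d := tl) (k := k) (by omega)
  rw [← hm, ← hn, List.getElem?_rotate (by rw [List.length_ofFn]; exact Nat.mod_lt _ (by omega)),
    List.length_ofFn, List.getElem?_ofFn, dif_pos (Nat.mod_lt _ (by omega))] at h1
  rw [← Option.some_inj, ← h1]
  congr 2
  ext
  simp only [Fin.val_ofNat]
  rw [Nat.mod_add_mod]
  congr 1; ring

namespace StairParams

/-- The `x`-coordinate of vertex `k` of a member of the family. -/
def xCoord (p : StairParams) (a b c d k : ℤ) : ℤ :=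
  if k < 2 * (a + d) + 2 then
    if a + d + 1 - (k + 1) / 2 < 1 then p.x0
    else if a + d + 1 - (k + 1) / 2 < a + 1 then a + d + 1 - (k + 1) / 2
    else p.xT + (a + d + 1 - (k + 1) / 2 - a)
  else
    if (k - (2 * (a + d) + 2) + 1) / 2 < 1 then p.x0
    else if (k - (2 * (a + d) + 2) + 1) / 2 < b + 1 then p.uB + (k - (2 * (a + d) + 2) + 1) / 2
    else if (k - (2 * (a + d) + 2) + 1) / 2 < b + c + 1 then
      p.uC + ramp p.q p.r ((k - (2 * (a + d) + 2) + 1) / 2 - b - 1)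
    else p.xT + d + 1

/-- The `y`-coordinate of vertex `k` of a member of the family. -/
def yCoord (p : StairParams) (a b d k : ℤ) : ℤ :=
  if k < 2 * (a + d) + 2 then
    if a + d - k / 2 < a then a + d - k / 2
    else if a + d - k / 2 < a + 1 then p.yT
    else p.yR - (a + d - k / 2 - a)
  else
    if (k - (2 * (a + d) + 2)) / 2 < b + 1 then p.zB - (k - (2 * (a + d) + 2)) / 2
    else p.zC + ramp p.q p.r ((k - (2 * (a + d) + 2)) / 2 - b - 1)

variable (p : StairParams) (a b c d : ℕ)

theorem xCoord_top {k i : ℕ} (hk : k < 2 * (a + d) + 2) (hi : i + (k + 1) / 2 = a + d + 1) :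
    p.xCoord a b c d k = p.X a i := by
  unfold xCoord X
  rw [if_pos (by omega), show (a + d + 1 - (k + 1) / 2 : ℤ) = i by omega]
  split_ifs <;> first | rfl | omega

theorem xCoord_bot {k j : ℕ} (hj : j = (k + 1) / 2) :
    p.xCoord a b c d (2 * (a + d) + 2 + k : ℕ) = p.U b c d j := by
  unfold xCoord U
  rw [if_neg (by omega), show ((2 * (a + d) + 2 + k : ℕ) - (2 * (a + d) + 2) + 1 : ℤ) / 2 = j by omega]
  split_ifs <;> first | rfl | omega

theorem yCoord_top {k i : ℕ} (hk : k < 2 * (a + d) + 2) (hi : i + k / 2 = a + d) :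
    p.yCoord a b d k = p.Y a i := by
  unfold yCoord Y
  rw [if_pos (by omega), show (a + d - k / 2 : ℤ) = i by omega]
  split_ifs <;> first | rfl | omega

theorem yCoord_bot {k j : ℕ} (hj : j = k / 2) :
    p.yCoord a b d (2 * (a + d) + 2 + k : ℕ) = p.Z b j := by
  unfold yCoord Z
  rw [if_neg (by omega), show ((2 * (a + d) + 2 + k : ℕ) - (2 * (a + d) + 2) : ℤ) / 2 = j by omega]
  split_ifs <;> first | rfl | omega

variable {p a b c d}

theorem traces {n : ℕ} [NeZero n] {P : GridCycle n} {o : ℕ}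
    (hn : n = 2 * (a + b + c + d) + 4)
    (H : IsProfile a b c d (p.X a) (p.Y a) (p.U b c d) (p.Z b))
    (hP : ∀ k : ℕ, k < n → P.walk o k = (p.xCoord a b c d k, p.yCoord a b d k)) :
    Traces (a + d) (b + c) (p.X a) (p.Y a) (p.U b c d) (p.Z b) (P.walk o) where
  top i e he := by
    rw [hP _ (by omega), hP _ (by omega), xCoord_top p a b c d (i := i + 1) (by omega) (by omega),
      yCoord_top p a b d (i := i) (by omega) (by omega),
      xCoord_top p a b c d (i := i) (by omega) (by omega),
      yCoord_top p a b d (i := i) (by omega) (by omega)]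
    exact ⟨rfl, rfl⟩
  bot j hj := by
    rw [show 2 * (a + d) + 3 + 2 * j = 2 * (a + d) + 2 + (2 * j + 1) by ring, hP _ (by omega),
      hP _ (by omega), xCoord_bot p a b c d (j := j) (by omega), yCoord_bot p a b d (j := j) (by omega),
      xCoord_bot p a b c d (j := j + 1) (by omega), yCoord_bot p a b d (j := j) (by omega)]
    exact ⟨rfl, rfl⟩
  period k := by
    rw [show 2 * (a + d) + 2 * (b + c) + 4 = n by omega]
    exact P.walk_add_period o k
  X_lt := H.X_lt
  U_lt := H.U_lt
  left := H.left
  right := H.right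

end StairParams

/-! ### The optimum as a comparison of candidates -/

/-- The value of a strip, or `B` if the strip is not admissible. -/
def stripCost (a b c d B : ℤ) : ℤ :=
  if a < c then B else if 0 < c then stripValue a b c d else if 0 < d then B else stripValue a b c d

/-- `u` if two opposite stairs collide, and `v` otherwise. -/
def ifCollides (a b c d u v : ℤ) : ℤ :=
  if 0 < b then v else if 0 < d then v else if a < c then v else if c < a then v else
    if 0 < a then u else v

/-- A value that exceeds the values of all candidates. -/
def areaBound (a b c d : ℤ) : ℤ :=
  max (max (max (stripValue a b c d) (stripValue b c d a))
    (max (stripValue c d a b) (stripValue d a b c))) (boxValue a b c d) + 1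

/-- The value of the corner-filling polygon, or a larger value if its stairs collide. -/
def boxCost (a b c d : ℤ) : ℤ :=
  ifCollides a b c d (areaBound a b c d)
    (ifCollides b c d a (areaBound a b c d) (boxValue a b c d))

/-- The minimum area. -/
def areaOptimum (a b c d : ℤ) : ℤ :=
  min (min (min (stripCost a b c d (areaBound a b c d)) (stripCost b c d a (areaBound a b c d)))
    (min (stripCost c d a b (areaBound a b c d)) (stripCost d a b c (areaBound a b c d))))
    (boxCost a b c d)

/-- The optimal polygon for the area: `-1` for the corner-filling polygon, and otherwise the number of
rotations for a strip. -/
def areaChoice (a b c d : ℤ) : ℤ :=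
  if areaOptimum a b c d < stripCost a b c d (areaBound a b c d) then
    if areaOptimum a b c d < stripCost b c d a (areaBound a b c d) then
      if areaOptimum a b c d < stripCost c d a b (areaBound a b c d) then
        if areaOptimum a b c d < stripCost d a b c (areaBound a b c d) then -1 else 3
      else 2
    else 1
  else 0

theorem ifCollides_eq_or {a b c d : ℤ} (hb : 0 ≤ b) (hd : 0 ≤ d) (u v : ℤ) :
    (Collides a b c d ∧ ifCollides a b c d u v = u) ∨
    (¬ Collides a b c d ∧ ifCollides a b c d u v = v) := by
  unfold ifCollides Collides
  split_ifs <;> first | (left; exact ⟨by omega, rfl⟩) | (right; exact ⟨by omega, rfl⟩)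

theorem stripCost_eq_or {a b c d : ℤ} (hc : 0 ≤ c) (hd : 0 ≤ d) (B : ℤ) :
    (StripAdmissible a b c d ∧ stripCost a b c d B = stripValue a b c d) ∨
    (¬ StripAdmissible a b c d ∧ stripCost a b c d B = B) := by
  unfold stripCost StripAdmissible
  split_ifs <;> first | (left; exact ⟨by omega, rfl⟩) | (right; exact ⟨by omega, rfl⟩)

/-- `areaBound` plays the role of infinity for inadmissible candidates. A genuine candidate `v`
keeps the minimum below it, so the minimum is attained by an admissible one. -/
theorem areaChoice_spec {a b c d : ℤ} (ha : 0 ≤ a) (hb : 0 ≤ b) (hc : 0 ≤ c) (hd : 0 ≤ d) {v : ℤ}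
    (hv : IsAreaCandidate a b c d v) :
    areaOptimum a b c d ≤ v ∧
    ((areaChoice a b c d = 0 ∧ StripAdmissible a b c d ∧ areaOptimum a b c d = stripValue a b c d) ∨
    (areaChoice a b c d = 1 ∧ StripAdmissible b c d a ∧ areaOptimum a b c d = stripValue b c d a) ∨
    (areaChoice a b c d = 2 ∧ StripAdmissible c d a b ∧ areaOptimum a b c d = stripValue c d a b) ∨
    (areaChoice a b c d = 3 ∧ StripAdmissible d a b c ∧ areaOptimum a b c d = stripValue d a b c) ∨
    (areaChoice a b c d = -1 ∧ (¬ Collides a b c d ∧ ¬ Collides b c d a) ∧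
      areaOptimum a b c d = boxValue a b c d)) := by
  have hB : stripValue a b c d < areaBound a b c d ∧ stripValue b c d a < areaBound a b c d ∧
      stripValue c d a b < areaBound a b c d ∧ stripValue d a b c < areaBound a b c d ∧
      boxValue a b c d < areaBound a b c d := by
    unfold areaBound; omega
  have h0 := stripCost_eq_or (a := a) (b := b) hc hd (areaBound a b c d)
  have h1 := stripCost_eq_or (a := b) (b := c) hd ha (areaBound a b c d)
  have h2 := stripCost_eq_or (a := c) (b := d) ha hb (areaBound a b c d)
  have h3 := stripCost_eq_or (a := d) (b := a) hb hc (areaBound a b c d)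
  have h4 : ((¬ Collides a b c d ∧ ¬ Collides b c d a) ∧ boxCost a b c d = boxValue a b c d) ∨
      (¬ (¬ Collides a b c d ∧ ¬ Collides b c d a) ∧ boxCost a b c d = areaBound a b c d) := by
    unfold boxCost
    rcases ifCollides_eq_or (a := a) (c := c) hb hd (areaBound a b c d)
      (ifCollides b c d a (areaBound a b c d) (boxValue a b c d)) with ⟨h, e⟩ | ⟨h, e⟩
    · exact Or.inr ⟨by tauto, e⟩
    · rw [e]
      rcases ifCollides_eq_or (a := b) (c := d) hc ha (areaBound a b c d) (boxValue a b c d)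
        with ⟨h', e'⟩ | ⟨h', e'⟩
      · exact Or.inr ⟨by tauto, e'⟩
      · exact Or.inl ⟨⟨h, h'⟩, e'⟩
  unfold IsAreaCandidate at hv
  have hm : areaOptimum a b c d = min (min (min (stripCost a b c d (areaBound a b c d))
    (stripCost b c d a (areaBound a b c d)))
    (min (stripCost c d a b (areaBound a b c d)) (stripCost d a b c (areaBound a b c d))))
    (boxCost a b c d) := rfl
  unfold areaChoice
  generalize areaOptimum a b c d = m at *
  generalize areaBound a b c d = B at *
  generalize stripCost a b c d B = x0 at *
  generalize stripCost b c d a B = x1 at *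
  generalize stripCost c d a b B = x2 at *
  generalize stripCost d a b c B = x3 at *
  generalize boxCost a b c d = x4 at *
  generalize stripValue a b c d = y0 at *
  generalize stripValue b c d a = y1 at *
  generalize stripValue c d a b = y2 at *
  generalize stripValue d a b c = y3 at *
  generalize boxValue a b c d = y4 at *
  generalize StripAdmissible a b c d = p0 at *
  generalize StripAdmissible b c d a = p1 at *
  generalize StripAdmissible c d a b = p2 at *
  generalize StripAdmissible d a b c = p3 at *
  generalize (¬ Collides a b c d ∧ ¬ Collides b c d a) = p4 at *
  clear ha hb hc hd
  have hle : m ≤ v ∧ v < B := by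
    rcases hv with ⟨p, rfl⟩ | ⟨p, rfl⟩ | ⟨p, rfl⟩ | ⟨p, rfl⟩ | ⟨p, rfl⟩
    · have : x0 = v := by tauto
      clear h0 h1 h2 h3 h4; omega
    · have : x1 = v := by tauto
      clear h0 h1 h2 h3 h4; omega
    · have : x2 = v := by tauto
      clear h0 h1 h2 h3 h4; omega
    · have : x3 = v := by tauto
      clear h0 h1 h2 h3 h4; omega
    · have : x4 = v := by tauto
      clear h0 h1 h2 h3 h4; omega
  refine ⟨hle.1, ?_⟩
  clear hv
  split_ifs with g0 g1 g2 g3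
  · clear h0 h1 h2 h3
    have : m = x4 := by clear h4; omega
    rcases h4 with h4 | h4
    · exact Or.inr (Or.inr (Or.inr (Or.inr ⟨rfl, h4.1, this.trans h4.2⟩)))
    · omega
  · clear h0 h1 h2 h4
    have : m = x3 := by clear h3; omega
    rcases h3 with h4 | h4
    · exact Or.inr (Or.inr (Or.inr (Or.inl ⟨rfl, h4.1, this.trans h4.2⟩)))
    · omega
  · clear h0 h1 h3 h4
    have : m = x2 := by clear h2; omega
    rcases h2 with h4 | h4
    · exact Or.inr (Or.inr (Or.inl ⟨rfl, h4.1, this.trans h4.2⟩))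
    · omega
  · clear h0 h2 h3 h4
    have : m = x1 := by clear h1; omega
    rcases h1 with h4 | h4
    · exact Or.inr (Or.inl ⟨rfl, h4.1, this.trans h4.2⟩)
    · omega
  · clear h1 h2 h3 h4
    have : m = x0 := by clear h0; omega
    rcases h0 with h4 | h4
    · exact Or.inl ⟨rfl, h4.1, this.trans h4.2⟩
    · omega

/-- One of four values, according to the number of rotations. -/
def rotSelect (s x y z w : ℤ) : ℤ := if s < 1 then x else if s < 2 then y else if s < 3 then z else w

/-- The parameters of the polygon of the given choice. -/
def choiceParams (s a b c d : ℤ) : StairParams :=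
  if s < 0 then boxParams a b c d else stripParams a b c d

namespace Objective

/-- The choice of an optimal polygon. -/
def choice : Objective → ℤ → ℤ → ℤ → ℤ → ℤ
  | boundingBox, a, b, c, d => ifCollides a b c d 0 (ifCollides b c d a 1 (-1))
  | area, a, b, c, d => areaChoice a b c d

/-- The optimal value. -/
def optimum : Objective → ℤ → ℤ → ℤ → ℤ → ℤ
  | boundingBox, a, b, c, d => boxSide a b c d * boxSide b c d a +
      ifCollides a b c d (boxSide a b c d) (ifCollides b c d a (boxSide a b c d) 0)
  | area, a, b, c, d => areaOptimum a b c d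

end Objective

theorem optimum_boundingBox {a b c d : ℤ} (ha : 0 ≤ a) (hb : 0 ≤ b) (hc : 0 ≤ c) (hd : 0 ≤ d) :
    Objective.boundingBox.optimum a b c d = boxOptimum a b c d := by
  change boxSide a b c d * boxSide b c d a + ifCollides a b c d (boxSide a b c d)
    (ifCollides b c d a (boxSide a b c d) 0) = _
  unfold boxOptimum
  congr 1
  rcases ifCollides_eq_or (a := a) (c := c) hb hd (boxSide a b c d)
      (ifCollides b c d a (boxSide a b c d) 0) with ⟨h, e⟩ | ⟨h, e⟩
  · rw [e, if_pos (Or.inl h)]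
  · rcases ifCollides_eq_or (a := b) (c := d) hc ha (boxSide a b c d) 0 with ⟨h', e'⟩ | ⟨h', e'⟩
    · rw [e, e', if_pos (Or.inr h')]
    · rw [e, e', if_neg (by tauto)]

theorem GridCycle.Realizes.optimum_le {n : ℕ} [NeZero n] {P : GridCycle n} {S : Fin n → Turn}
    (obj : Objective) (hP : P.Realizes S) {o a b c d : ℕ} (hS : StairsFrom S o a b c d) :
    obj.optimum a b c d ≤ obj.value P := by
  obtain ⟨a', b', c', d', o', X, Y, U, Z, hc, hS', H, T⟩ := hP.exists_profile hS
  cases obj with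
  | boundingBox =>
    rw [optimum_boundingBox (by omega) (by omega) (by omega) (by omega), ← hc.boxOptimum_eq]
    exact H.boxOptimum_le T hS'.1
  | area =>
    obtain ⟨v, h1, h2⟩ := H.exists_candidate_le_area T hS'.1
    exact (areaChoice_spec (by omega) (by omega) (by omega) (by omega)
      (hc.isAreaCandidate h1)).1.trans h2

/-! ### The constructed polygons attain the optimum -/

section Construction

variable {n : ℕ} [NeZero n] {P : GridCycle n} {S : Fin n → Turn} {o a b c d : ℕ}

theorem realizes_of_box (hS : StairsFrom S o a b c d) (h : ¬ Collides a b c d ∧ ¬ Collides b c d a)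
    (hP : ∀ k : ℕ, k < n → P.walk o k =
      ((boxParams a b c d).xCoord a b c d k, (boxParams a b c d).yCoord a b d k)) :
    P.Realizes S ∧ P.area = boxValue a b c d ∧ P.boxArea = boxSide a b c d * boxSide b c d a := by
  have H := boxParams_isProfile a b c d h.1 h.2
  have T := StairParams.traces hS.1 H hP
  refine ⟨GridCycle.realizes_of_profile hS H T, ?_, ?_⟩
  · rw [T.area_eq_sum (by have := hS.1; omega) H.separated, boxParams_area]
  · rw [H.boxArea_eq T hS.1]
    unfold StairParams.X StairParams.Y StairParams.Z
    rw [if_neg (by omega), if_neg (by omega), if_pos rfl, if_neg (by omega), if_pos rfl,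
      if_pos le_rfl]
    simp only [boxParams]
    push_cast
    ring

/-- For colliding stairs the strip is the diagonal with unit steps; its box is one unit higher than
the smallest box, so it is also optimal for the bounding box. -/
theorem realizes_of_strip (hS : StairsFrom S o a b c d) (h : StripAdmissible a b c d)
    (hP : ∀ k : ℕ, k < n → P.walk o k =
      ((stripParams a b c d).xCoord a b c d k, (stripParams a b c d).yCoord a b d k)) :
    P.Realizes S ∧ P.area = stripValue a b c d ∧
      (Collides a b c d → P.boxArea = boxSide a b c d * boxSide b c d a + boxSide a b c d) := by
  have H := stripParams_isProfile h
  have T := StairParams.traces hS.1 H hP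
  refine ⟨GridCycle.realizes_of_profile hS H T, ?_, ?_⟩
  · rw [T.area_eq_sum (by have := hS.1; omega) H.separated, stripParams_area h]
  · rintro ⟨hb, hd, hac, ha⟩
    obtain rfl : b = 0 := by omega
    obtain rfl : d = 0 := by omega
    obtain rfl : a = c := by omega
    rw [H.boxArea_eq T hS.1]
    have hq : (a : ℤ) / (a + 1) = 0 := Int.ediv_eq_zero_of_lt (by omega) (by omega)
    have hf : extraFirst a (0 : ℕ) a = 0 := by unfold extraFirst; rw [hq]; simp
    have hl : extraLast a (0 : ℕ) a (0 : ℕ) = 1 := by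
      unfold extraLast; rw [hq, hf, if_pos]; simp; omega
    unfold StairParams.X StairParams.Y StairParams.Z
    simp only [stripParams, bayParams, hq, hf, hl]
    unfold boxSide
    simp
    have : max (a : ℤ) 0 = a := by omega
    ring

end Construction

/-- A nonnegative `s` is a number of rotations; `A`, `B`, `C`, `D` and `O` are the rotated counts
and the matching start of the reading, so one formula covers all constructions. The realization `Q`
only provides the candidate that `areaChoice_spec` asks for. -/
theorem StairsFrom.realizes {n : ℕ} [NeZero n] {P Q : GridCycle n} {S : Fin n → Turn} {o a b c d : ℕ}
    (obj : Objective) (hS : StairsFrom S o a b c d) (hQ : Q.Realizes S) {s A B C D O : ℤ}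
    (hs : s = obj.choice a b c d) (hA : A = rotSelect s a b c d) (hB : B = rotSelect s b c d a)
    (hC : C = rotSelect s c d a b) (hD : D = rotSelect s d a b c)
    (hO : O = rotSelect s o (o + 2 * d + 1) (o + 2 * d + 2 * a + 2) (o + 2 * d + 2 * a + 2 * b + 3))
    (hP : ∀ (u : Fin n) (k : ℕ), k < n → (u : ℤ) = (O + k) % n →
      P u = ((choiceParams s A B C D).xCoord A B C D k, (choiceParams s A B C D).yCoord A B D k)) :
    P.Realizes S ∧ obj.value P = obj.optimum a b c d := by
  have hw : ∀ (o' : ℕ), O = o' → ∀ k : ℕ, k < n → P.walk o' k =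
      ((choiceParams s A B C D).xCoord A B C D k, (choiceParams s A B C D).yCoord A B D k) := by
    intro o' ho k hk
    refine hP _ k hk ?_
    rw [ho]
    simp
  clear hP
  have strip : ∀ {o' a' b' c' d' : ℕ}, IsCyclicShift a b c d a' b' c' d' → O = o' → A = a' → B = b' →
      C = c' → D = d' → 0 ≤ s → StairsFrom S o' a' b' c' d' → StripAdmissible a' b' c' d' →
      P.Realizes S ∧ P.area = stripValue a' b' c' d' ∧
      (Collides a' b' c' d' → P.boxArea = boxOptimum a b c d) := by
    rintro o' a' b' c' d' hc ho rfl rfl rfl rfl hs hS' hadm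
    have hw := hw o' ho
    unfold choiceParams at hw
    rw [if_neg (by omega)] at hw
    obtain ⟨h1, h2, h3⟩ := realizes_of_strip hS' hadm hw
    refine ⟨h1, h2, fun h => ?_⟩
    rw [h3 h, ← hc.boxOptimum_eq]
    unfold boxOptimum
    rw [if_pos (Or.inl h)]
  have box : O = o → A = a → B = b → C = c → D = d → s < 0 →
      (¬ Collides a b c d ∧ ¬ Collides b c d a) →
      P.Realizes S ∧ P.area = boxValue a b c d ∧ P.boxArea = boxSide a b c d * boxSide b c d a := by
    rintro ho rfl rfl rfl rfl hs h
    have hw := hw o ho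
    unfold choiceParams at hw
    rw [if_pos hs] at hw
    exact realizes_of_box hS h hw
  clear hw
  have s1 := hS.rotate
  have s2 := s1.rotate
  have s3 := s2.rotate
  have r1 : ∀ x y z w, rotSelect (-1) x y z w = x := fun _ _ _ _ => rfl
  have r0 : ∀ x y z w, rotSelect 0 x y z w = x := fun _ _ _ _ => rfl
  cases obj with
  | boundingBox =>
    change _ ∧ P.boxArea = _
    rw [optimum_boundingBox (by omega) (by omega) (by omega) (by omega)]
    change s = ifCollides a b c d 0 (ifCollides b c d a 1 (-1)) at hs
    rcases ifCollides_eq_or (a := (a : ℤ)) (b := b) (c := c) (d := d) (by omega) (by omega) 0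
      (ifCollides b c d a 1 (-1)) with ⟨h, e⟩ | ⟨h, e⟩
    · rw [e] at hs
      subst hs
      have hh := h
      obtain ⟨h1, h2, h3, h4⟩ := h
      obtain ⟨g1, -, g2⟩ := strip (Or.inl ⟨rfl, rfl, rfl, rfl⟩) hO hA hB hC hD le_rfl hS
        ⟨by omega, by omega⟩
      exact ⟨g1, g2 hh⟩
    · rw [e] at hs
      rcases ifCollides_eq_or (a := (b : ℤ)) (b := c) (c := d) (d := a) (by omega) (by omega) 1
        (-1) with ⟨h', e'⟩ | ⟨h', e'⟩
      · rw [e'] at hs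
        subst hs
        have hh := h'
        obtain ⟨h1, h2, h3, h4⟩ := h'
        obtain ⟨g1, -, g2⟩ := strip (Or.inr (Or.inl ⟨rfl, rfl, rfl, rfl⟩)) hO hA hB hC hD (by omega)
          s1 ⟨by omega, by omega⟩
        exact ⟨g1, g2 hh⟩
      · rw [e'] at hs
        subst hs
        obtain ⟨g1, -, g2⟩ := box hO hA hB hC hD (by omega) ⟨h, h'⟩
        refine ⟨g1, ?_⟩
        rw [g2]
        unfold boxOptimum
        rw [if_neg (by tauto), add_zero]
  | area =>
    change _ ∧ P.area = areaOptimum a b c d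
    change s = areaChoice a b c d at hs
    obtain ⟨a', b', c', d', o', X, Y, U, Z, hc, hS', H, T⟩ := hQ.exists_profile hS
    obtain ⟨v, hv, -⟩ := H.exists_candidate_le_area T hS'.1
    obtain ⟨-, h⟩ := areaChoice_spec (a := (a : ℤ)) (b := b) (c := c) (d := d) (by omega) (by omega)
      (by omega) (by omega) (hc.isAreaCandidate hv)
    rw [← hs] at h
    rcases h with ⟨rfl, h1, h2⟩ | ⟨rfl, h1, h2⟩ | ⟨rfl, h1, h2⟩ | ⟨rfl, h1, h2⟩ | ⟨rfl, h1, h2⟩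
    · obtain ⟨g1, g2, -⟩ := strip (Or.inl ⟨rfl, rfl, rfl, rfl⟩) hO hA hB hC hD le_rfl hS h1
      exact ⟨g1, g2.trans h2.symm⟩
    · obtain ⟨g1, g2, -⟩ := strip (Or.inr (Or.inl ⟨rfl, rfl, rfl, rfl⟩)) hO hA hB hC hD (by omega) s1 h1
      exact ⟨g1, g2.trans h2.symm⟩
    · obtain ⟨g1, g2, -⟩ := strip (Or.inr (Or.inr (Or.inl ⟨rfl, rfl, rfl, rfl⟩)))
        (hO.trans (by norm_num [rotSelect]; ring)) hA hB hC hD (by omega) s2 h1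
      exact ⟨g1, g2.trans h2.symm⟩
    · obtain ⟨g1, g2, -⟩ := strip (Or.inr (Or.inr (Or.inr ⟨rfl, rfl, rfl, rfl⟩)))
        (hO.trans (by norm_num [rotSelect]; ring)) hA hB hC hD (by omega) s3 h1
      exact ⟨g1, g2.trans h2.symm⟩
    · obtain ⟨g1, g2, -⟩ := box hO hA hB hC hD (by omega) h1
      exact ⟨g1, g2.trans h2.symm⟩

/-! ### Bounds for computations -/

namespace RamState

/-- All values stored by the machine have absolute value at most `M`. -/
structure IsBounded (M : ℤ) (s : RamState) : Prop where
  reg : ∀ r, |s.reg r| ≤ M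
  mem : ∀ a, |s.mem a| ≤ M

theorem IsBounded.mono {M M' : ℤ} {s : RamState} (h : s.IsBounded M) (hM : M ≤ M') :
    s.IsBounded M' :=
  ⟨fun r => (h.reg r).trans hM, fun a => (h.mem a).trans hM⟩

end RamState

namespace RamExpr

theorem Fits.mono {W W' : ℤ} {s : RamState} (hW : W ≤ W') {e : RamExpr} (h : e.Fits W s) :
    e.Fits W' s := by
  induction e with
  | const k => exact le_trans h hW
  | reg r => exact le_trans h hW
  | load a ih => exact ⟨ih h.1, h.2.trans hW⟩
  | add e f ihe ihf => exact ⟨ihe h.1, ihf h.2.1, h.2.2.trans hW⟩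
  | sub e f ihe ihf => exact ⟨ihe h.1, ihf h.2.1, h.2.2.trans hW⟩
  | mul e f ihe ihf => exact ⟨ihe h.1, ihf h.2.1, h.2.2.trans hW⟩
  | div e f ihe ihf => exact ⟨ihe h.1, ihf h.2.1, h.2.2.trans hW⟩

/-- The largest absolute value of a constant in an expression. -/
def constMax : RamExpr → ℕ
  | const k => k.natAbs
  | reg _ => 0
  | load a => a.constMax
  | add e f => max e.constMax f.constMax
  | sub e f => max e.constMax f.constMax
  | mul e f => max e.constMax f.constMax
  | div e f => max e.constMax f.constMax

theorem one_le_cost (e : RamExpr) : 1 ≤ e.cost := by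
  cases e <;> simp [cost]

/-- Multiplication adds exponents, and the factor `2` lost in an addition is covered by the
additional `M` that the cost of the operation provides. A loaded value is bounded by `M` whatever
its address is. -/
theorem fits_pow_cost {M : ℤ} (hM : 2 ≤ M) {s : RamState} (hs : s.IsBounded M) (e : RamExpr)
    (he : (e.constMax : ℤ) ≤ M) : |e.eval s| ≤ M ^ e.cost ∧ e.Fits (M ^ e.cost) s := by
  have mono : ∀ {i j : ℕ}, i ≤ j → M ^ i ≤ M ^ j := fun h => pow_le_pow_right₀ (by omega) h
  have pos : ∀ i : ℕ, 0 < M ^ i := fun i => pow_pos (by omega) i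
  have hadd : ∀ (e f : RamExpr) (x y : ℤ), |x| ≤ M ^ e.cost → |y| ≤ M ^ f.cost →
      |x| + |y| ≤ M ^ (e.cost + f.cost + 1) := by
    intro e f x y hx hy
    have h1 := mono (i := e.cost) (j := e.cost + f.cost) (by omega)
    have h2 := mono (i := f.cost) (j := e.cost + f.cost) (by omega)
    have h3 := pos (e.cost + f.cost)
    rw [pow_succ]
    nlinarith
  have hcost : ∀ e f : RamExpr, M ^ e.cost ≤ M ^ (e.cost + f.cost + 1) ∧
      M ^ f.cost ≤ M ^ (e.cost + f.cost + 1) := fun e f => ⟨mono (by omega), mono (by omega)⟩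
  induction e with
  | const k =>
    have : |k| ≤ M ^ 1 := by
      rw [pow_one, Int.abs_eq_natAbs]; exact he
    exact ⟨this, this⟩
  | reg r =>
    have : |s.reg r| ≤ M ^ 1 := by
      rw [pow_one]; exact hs.reg r
    exact ⟨this, this⟩
  | load a ih =>
    have h1 : M ^ 1 ≤ M ^ (a.cost + 1) := mono (by omega)
    have h2 := hs.mem (a.eval s)
    rw [pow_one] at h1
    exact ⟨h2.trans h1, (ih he).2.mono (mono (Nat.le_succ _)), h2.trans h1⟩
  | add e f ihe ihf =>
    simp only [constMax, Nat.cast_max, max_le_iff] at he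
    obtain ⟨e1, e2⟩ := ihe he.1
    obtain ⟨f1, f2⟩ := ihf he.2
    have h : |(add e f).eval s| ≤ M ^ (e.cost + f.cost + 1) :=
      (abs_add_le _ _).trans (hadd e f _ _ e1 f1)
    exact ⟨h, e2.mono (hcost e f).1, f2.mono (hcost e f).2, h⟩
  | sub e f ihe ihf =>
    simp only [constMax, Nat.cast_max, max_le_iff] at he
    obtain ⟨e1, e2⟩ := ihe he.1
    obtain ⟨f1, f2⟩ := ihf he.2
    have h : |(sub e f).eval s| ≤ M ^ (e.cost + f.cost + 1) :=
      (abs_sub _ _).trans (hadd e f _ _ e1 f1)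
    exact ⟨h, e2.mono (hcost e f).1, f2.mono (hcost e f).2, h⟩
  | mul e f ihe ihf =>
    simp only [constMax, Nat.cast_max, max_le_iff] at he
    obtain ⟨e1, e2⟩ := ihe he.1
    obtain ⟨f1, f2⟩ := ihf he.2
    have h : |(mul e f).eval s| ≤ M ^ (e.cost + f.cost + 1) := by
      change |e.eval s * f.eval s| ≤ _
      rw [abs_mul]
      refine (mul_le_mul e1 f1 (abs_nonneg _) (pos _).le).trans ?_
      rw [← pow_add]
      exact mono (by omega)
    exact ⟨h, e2.mono (hcost e f).1, f2.mono (hcost e f).2, h⟩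
  | div e f ihe ihf =>
    simp only [constMax, Nat.cast_max, max_le_iff] at he
    obtain ⟨e1, e2⟩ := ihe he.1
    obtain ⟨f1, f2⟩ := ihf he.2
    have h : |(div e f).eval s| ≤ M ^ (e.cost + f.cost + 1) :=
      (Int.abs_ediv_le_abs _ _).trans (e1.trans (hcost e f).1)
    exact ⟨h, e2.mono (hcost e f).1, f2.mono (hcost e f).2, h⟩

end RamExpr

theorem RamRun.mono {W W' : ℤ} (hW : W ≤ W') {p : RamProg} {s s' : RamState} {t : ℕ}
    (h : RamRun W p s t s') : RamRun W' p s t s' := by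
  induction h with
  | nop s => exact .nop s
  | assign r e s h => exact .assign r e s (h.mono hW)
  | store a e s h h' => exact .store a e s (h.mono hW) (h'.mono hW)
  | seq p q s s' s'' t t' _ _ ih ih' => exact .seq p q s s' s'' t t' ih ih'
  | branchPos e p q s s' t h h' _ ih => exact .branchPos e p q s s' t (h.mono hW) h' ih
  | branchNonpos e p q s s' t h h' _ ih => exact .branchNonpos e p q s s' t (h.mono hW) h' ih
  | loopStop e p s h h' => exact .loopStop e p s (h.mono hW) h'
  | loopStep e p s s' s'' t t' h h' _ _ ih ih' =>
    exact .loopStep e p s s' s'' t t' (h.mono hW) h' ih ih'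

/-! ### Programs without tests -/

namespace RamProg

/-- Programs without tests. -/
def IsStraight : RamProg → Prop
  | assign _ _ => True
  | store _ _ => True
  | seq p q => p.IsStraight ∧ q.IsStraight
  | _ => False

/-- The final state of a program without tests. -/
def exec : RamProg → RamState → RamState
  | assign r e, s => ⟨Function.update s.reg r (e.eval s), s.mem⟩
  | store a e, s => ⟨s.reg, Function.update s.mem (a.eval s) (e.eval s)⟩
  | seq p q, s => q.exec (p.exec s)
  | _, s => s

/-- The running time of a program without tests. -/
def time : RamProg → ℕ
  | assign _ e => e.cost + 1
  | store a e => a.cost + e.cost + 1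
  | seq p q => p.time + q.time
  | _ => 0

/-- A bound for the growth of the values during a program without tests. -/
def degree : RamProg → ℕ
  | assign _ e => e.cost
  | store a e => a.cost + e.cost
  | seq p q => p.degree * q.degree
  | _ => 1

/-- The largest absolute value of a constant in a program without tests. -/
def constMax : RamProg → ℕ
  | assign _ e => e.constMax
  | store a e => max a.constMax e.constMax
  | seq p q => max p.constMax q.constMax
  | _ => 0

theorem one_le_degree (p : RamProg) : 1 ≤ p.degree := by
  induction p with
  | assign r e => exact e.one_le_cost
  | store a e => have := e.one_le_cost; simp only [degree]; omega
  | seq p q ihp ihq => exact Nat.mul_pos ihp ihq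
  | _ => exact le_rfl

/-- Composition substitutes one polynomial bound into the next, so the exponents multiply; they
depend on the program alone. -/
theorem IsStraight.run {p : RamProg} (hp : p.IsStraight) {M : ℤ} (hM : 2 ≤ M) {s : RamState}
    (hs : s.IsBounded M) (hc : (p.constMax : ℤ) ≤ M) :
    RamRun (M ^ p.degree) p s p.time (p.exec s) ∧ (p.exec s).IsBounded (M ^ p.degree) := by
  have mono : ∀ {M : ℤ}, 2 ≤ M → ∀ {i j : ℕ}, i ≤ j → M ^ i ≤ M ^ j :=
    fun h _ _ h' => pow_le_pow_right₀ (by omega) h'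
  induction p generalizing s M with
  | assign r e =>
    obtain ⟨h1, h2⟩ := e.fits_pow_cost hM hs hc
    have hd : ∀ x, |x| ≤ M → |x| ≤ M ^ e.cost := fun x hx =>
      hx.trans (le_self_pow₀ (by omega) (by have := e.one_le_cost; omega))
    refine ⟨.assign r e s h2, fun r' => ?_, fun a => hd _ (hs.mem a)⟩
    · simp only [exec, Function.update_apply]
      split_ifs
      · exact h1
      · exact hd _ (hs.reg r')
  | store a e =>
    simp only [constMax, Nat.cast_max, max_le_iff] at hc
    obtain ⟨h1, h2⟩ := a.fits_pow_cost hM hs hc.1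
    obtain ⟨h3, h4⟩ := e.fits_pow_cost hM hs hc.2
    have hd : ∀ x, |x| ≤ M → |x| ≤ M ^ (a.cost + e.cost) := fun x hx =>
      hx.trans (le_self_pow₀ (by omega) (by have := e.one_le_cost; omega))
    refine ⟨.store a e s (h2.mono (mono hM (Nat.le_add_right _ _)))
      (h4.mono (mono hM (Nat.le_add_left _ _))),
      fun r' => hd _ (hs.reg r'), fun b => ?_⟩
    simp only [exec, Function.update_apply]
    split_ifs
    · exact h3.trans (mono hM (Nat.le_add_left _ _))
    · exact hd _ (hs.mem b)
  | seq p q ihp ihq =>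
    simp only [constMax, Nat.cast_max, max_le_iff] at hc
    obtain ⟨h1, h2⟩ := ihp hp.1 hM hs hc.1
    have hp1 := p.one_le_degree
    have hM' : M ≤ M ^ p.degree := le_self_pow₀ (by omega) (by omega)
    obtain ⟨h3, h4⟩ := ihq hp.2 (hM.trans hM') h2 (hc.2.trans hM')
    rw [← pow_mul] at h3 h4
    exact ⟨.seq p q _ _ _ _ _ (h1.mono (mono hM (Nat.le_mul_of_pos_right _ q.one_le_degree))) h3, h4⟩
  | _ => exact hp.elim

end RamProg

/-- A loop with a fixed number of iterations. -/
theorem RamRun.loop_of_invariant {W : ℤ} {guard : RamExpr} {body : RamProg} {c N : ℕ}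
    (Inv : ℕ → RamState → Prop)
    (hstep : ∀ i < N, ∀ s, Inv i s → guard.Fits W s ∧ 0 < guard.eval s ∧
      ∃ s', RamRun W body s c s' ∧ Inv (i + 1) s')
    (hdone : ∀ s, Inv N s → guard.Fits W s ∧ guard.eval s ≤ 0) {s : RamState} (hs : Inv 0 s) :
    ∃ s', RamRun W (RamProg.loop guard body) s (N * (guard.cost + 1 + c) + (guard.cost + 1)) s' ∧
      Inv N s' := by
  have key : ∀ m i, i + m = N → ∀ s, Inv i s → ∃ s',
      RamRun W (RamProg.loop guard body) s (m * (guard.cost + 1 + c) + (guard.cost + 1)) s' ∧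
      Inv N s' := by
    intro m
    induction m with
    | zero =>
      rintro i rfl s hs
      obtain ⟨h1, h2⟩ := hdone s hs
      exact ⟨s, by simpa using RamRun.loopStop guard body s h1 h2, hs⟩
    | succ m ih =>
      intro i hi s hs
      obtain ⟨h1, h2, s', h3, h4⟩ := hstep i (by omega) s hs
      obtain ⟨s'', h5, h6⟩ := ih (i + 1) (by omega) s' h4
      refine ⟨s'', ?_, h6⟩
      have := RamRun.loopStep guard body s s' s'' _ _ h1 h2 h3 h5
      convert this using 1
      ring
  exact key N 0 (by omega) s hs

/-! ### Arithmetic expressions for case distinctions -/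

namespace RamExpr

instance : Add RamExpr := ⟨add⟩
instance : Sub RamExpr := ⟨sub⟩
instance : Mul RamExpr := ⟨mul⟩
instance : Div RamExpr := ⟨div⟩
instance (k : ℕ) : OfNat RamExpr k := ⟨const k⟩

/-- `1` if the value of `x` is negative, and `0` otherwise. -/
def isNeg (x : RamExpr) : RamExpr := 0 - x / (x * x + 1)

/-- The value of `u` if the value of `x` is less than the value of `y`, and the value of `v`
otherwise. -/
def ifLt (x y u v : RamExpr) : RamExpr := v + isNeg (x - y) * (u - v)

variable (s : RamState) (x y u v : RamExpr)

@[simp] theorem eval_add : (x + y).eval s = x.eval s + y.eval s := rfl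
@[simp] theorem eval_sub : (x - y).eval s = x.eval s - y.eval s := rfl
@[simp] theorem eval_mul : (x * y).eval s = x.eval s * y.eval s := rfl
@[simp] theorem eval_div : (x / y).eval s = x.eval s / y.eval s := rfl
@[simp] theorem eval_two : (2 : RamExpr).eval s = 2 := rfl
@[simp] theorem eval_three : (3 : RamExpr).eval s = 3 := rfl
@[simp] theorem eval_zero : (0 : RamExpr).eval s = 0 := rfl
@[simp] theorem eval_one : (1 : RamExpr).eval s = 1 := rfl
@[simp] theorem eval_reg (r : ℕ) : (reg r).eval s = s.reg r := rfl
@[simp] theorem eval_load : (load x).eval s = s.mem (x.eval s) := rfl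

/-- The quotient of `x` by `x ^ 2 + 1` lies strictly between `-1` and `1`, and integer division
rounds it down to `-1` or `0`. Case distinctions thus become arithmetic, and programs built from
them need no tests. -/
theorem eval_isNeg : (isNeg x).eval s = if x.eval s < 0 then 1 else 0 := by
  simp only [isNeg, eval_sub, eval_zero, eval_div, eval_add, eval_mul, eval_one]
  generalize x.eval s = z
  split_ifs with h
  · have : z / (z * z + 1) = -1 := by
      rw [Int.ediv_eq_iff_of_pos (by nlinarith)]
      constructor <;> nlinarith
    rw [this]; rfl
  · rw [Int.ediv_eq_zero_of_lt (by omega) (by nlinarith)]; rfl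

@[simp] theorem eval_ifLt : (ifLt x y u v).eval s =
    if x.eval s < y.eval s then u.eval s else v.eval s := by
  simp only [ifLt, eval_add, eval_mul, eval_isNeg, eval_sub, sub_neg]
  split_ifs <;> ring

end RamExpr

/-! ### Expressions for the optimum and for the coordinates of an optimal polygon -/

namespace RamExpr

def maxExpr (x y : RamExpr) : RamExpr := ifLt x y y x

def minExpr (x y : RamExpr) : RamExpr := ifLt x y x y

def triExpr (x : RamExpr) : RamExpr := x * (x + 1) / 2

def stripValueExpr (a b c d : RamExpr) : RamExpr :=
  triExpr b + triExpr d + 1 + (c + 1) * triExpr (a / (c + 1)) + (c - 1) * maxExpr (a / (c + 1)) 1 +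
    maxExpr (maxExpr (a / (c + 1)) b) 1 + maxExpr (maxExpr (a / (c + 1)) d) 1 +
    (a - a / (c + 1) * (c + 1)) * (a / (c + 1) + 1) +
    ifLt 0 (a / (c + 1))
      (maxExpr 0 (a - a / (c + 1) * (c + 1) -
        (ifLt (a / (c + 1)) b 1 0 + ifLt (a / (c + 1)) d 1 0)))
      0

def boxSideExpr (a b c d : RamExpr) : RamExpr := maxExpr (a + d) (b + c) + 1

def boxValueExpr (a b c d : RamExpr) : RamExpr :=
  boxSideExpr a b c d * boxSideExpr b c d a - triExpr a - triExpr b - triExpr c - triExpr d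

def ifCollidesExpr (a b c d u v : RamExpr) : RamExpr :=
  ifLt 0 b v (ifLt 0 d v (ifLt a c v (ifLt c a v (ifLt 0 a u v))))

def stripCostExpr (a b c d B : RamExpr) : RamExpr :=
  ifLt a c B (ifLt 0 c (stripValueExpr a b c d) (ifLt 0 d B (stripValueExpr a b c d)))

def areaBoundExpr (a b c d : RamExpr) : RamExpr :=
  maxExpr (maxExpr (maxExpr (stripValueExpr a b c d) (stripValueExpr b c d a))
    (maxExpr (stripValueExpr c d a b) (stripValueExpr d a b c))) (boxValueExpr a b c d) + 1

def boxCostExpr (a b c d : RamExpr) : RamExpr :=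
  ifCollidesExpr a b c d (areaBoundExpr a b c d)
    (ifCollidesExpr b c d a (areaBoundExpr a b c d) (boxValueExpr a b c d))

def areaOptimumExpr (a b c d : RamExpr) : RamExpr :=
  minExpr (minExpr
    (minExpr (stripCostExpr a b c d (areaBoundExpr a b c d))
      (stripCostExpr b c d a (areaBoundExpr a b c d)))
    (minExpr (stripCostExpr c d a b (areaBoundExpr a b c d))
      (stripCostExpr d a b c (areaBoundExpr a b c d))))
    (boxCostExpr a b c d)

def areaChoiceExpr (a b c d : RamExpr) : RamExpr :=
  ifLt (areaOptimumExpr a b c d) (stripCostExpr a b c d (areaBoundExpr a b c d))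
    (ifLt (areaOptimumExpr a b c d) (stripCostExpr b c d a (areaBoundExpr a b c d))
      (ifLt (areaOptimumExpr a b c d) (stripCostExpr c d a b (areaBoundExpr a b c d))
        (ifLt (areaOptimumExpr a b c d) (stripCostExpr d a b c (areaBoundExpr a b c d)) (0 - 1) 3)
        2)
      1)
    0

def rotSelectExpr (s x y z w : RamExpr) : RamExpr := ifLt s 1 x (ifLt s 2 y (ifLt s 3 z w))

def optimumExpr : Objective → RamExpr → RamExpr → RamExpr → RamExpr → RamExpr
  | Objective.boundingBox, a, b, c, d => boxSideExpr a b c d * boxSideExpr b c d a +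
      ifCollidesExpr a b c d (boxSideExpr a b c d) (ifCollidesExpr b c d a (boxSideExpr a b c d) 0)
  | Objective.area, a, b, c, d => areaOptimumExpr a b c d

def choiceExpr : Objective → RamExpr → RamExpr → RamExpr → RamExpr → RamExpr
  | Objective.boundingBox, a, b, c, d => ifCollidesExpr a b c d 0 (ifCollidesExpr b c d a 1 (0 - 1))
  | Objective.area, a, b, c, d => areaChoiceExpr a b c d

def extraFirstExpr (a b c : RamExpr) : RamExpr :=
  ifLt (a / (c + 1)) b (ifLt 0 (a - a / (c + 1) * (c + 1)) (ifLt 0 (a / (c + 1)) 1 0) 0) 0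

def extraLastExpr (a b c d : RamExpr) : RamExpr :=
  ifLt (extraFirstExpr a b c) (a - a / (c + 1) * (c + 1))
    (ifLt (a / (c + 1)) d 1 (ifLt (a - a / (c + 1) * (c + 1) - extraFirstExpr a b c) c 0 1)) 0

def rampExpr (q r t : RamExpr) : RamExpr := t * q + minExpr t r

section Eval

variable (s : RamState) (a b c d u v w z : RamExpr)

@[simp] theorem eval_maxExpr : (maxExpr u v).eval s = max (u.eval s) (v.eval s) := by
  rw [maxExpr, eval_ifLt, max_def_lt]

@[simp] theorem eval_minExpr : (minExpr u v).eval s = min (u.eval s) (v.eval s) := by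
  rw [minExpr, eval_ifLt, min_def_lt]

@[simp] theorem eval_triExpr : (triExpr u).eval s = tri (u.eval s) := by simp [triExpr, tri]

@[simp] theorem eval_stripValueExpr : (stripValueExpr a b c d).eval s =
    stripValue (a.eval s) (b.eval s) (c.eval s) (d.eval s) := by
  simp only [stripValueExpr, eval_add, eval_sub, eval_mul, eval_div, eval_one, eval_zero, eval_ifLt,
    eval_maxExpr, eval_triExpr]
  rfl

@[simp] theorem eval_boxSideExpr : (boxSideExpr a b c d).eval s =
    boxSide (a.eval s) (b.eval s) (c.eval s) (d.eval s) := by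
  simp [boxSideExpr, boxSide]

@[simp] theorem eval_boxValueExpr : (boxValueExpr a b c d).eval s =
    boxValue (a.eval s) (b.eval s) (c.eval s) (d.eval s) := by
  simp [boxValueExpr, boxValue]

@[simp] theorem eval_ifCollidesExpr : (ifCollidesExpr a b c d u v).eval s =
    ifCollides (a.eval s) (b.eval s) (c.eval s) (d.eval s) (u.eval s) (v.eval s) := by
  simp only [ifCollidesExpr, eval_ifLt, eval_zero]
  rfl

@[simp] theorem eval_stripCostExpr : (stripCostExpr a b c d u).eval s =
    stripCost (a.eval s) (b.eval s) (c.eval s) (d.eval s) (u.eval s) := by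
  simp only [stripCostExpr, eval_ifLt, eval_zero, eval_stripValueExpr]
  rfl

@[simp] theorem eval_areaBoundExpr : (areaBoundExpr a b c d).eval s =
    areaBound (a.eval s) (b.eval s) (c.eval s) (d.eval s) := by
  simp [areaBoundExpr, areaBound]

@[simp] theorem eval_boxCostExpr : (boxCostExpr a b c d).eval s =
    boxCost (a.eval s) (b.eval s) (c.eval s) (d.eval s) := by
  simp [boxCostExpr, boxCost]

@[simp] theorem eval_areaOptimumExpr : (areaOptimumExpr a b c d).eval s =
    areaOptimum (a.eval s) (b.eval s) (c.eval s) (d.eval s) := by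
  simp only [areaOptimumExpr, eval_minExpr, eval_stripCostExpr, eval_areaBoundExpr, eval_boxCostExpr]
  rfl

@[simp] theorem eval_areaChoiceExpr : (areaChoiceExpr a b c d).eval s =
    areaChoice (a.eval s) (b.eval s) (c.eval s) (d.eval s) := by
  simp only [areaChoiceExpr, eval_ifLt, eval_areaOptimumExpr, eval_stripCostExpr, eval_areaBoundExpr,
    eval_sub, eval_zero, eval_one, eval_two, eval_three]
  rfl

@[simp] theorem eval_rotSelectExpr : (rotSelectExpr u a b c d).eval s =
    rotSelect (u.eval s) (a.eval s) (b.eval s) (c.eval s) (d.eval s) := by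
  simp only [rotSelectExpr, eval_ifLt, eval_one, eval_two, eval_three]
  rfl

@[simp] theorem eval_optimumExpr (obj : Objective) : (optimumExpr obj a b c d).eval s =
    obj.optimum (a.eval s) (b.eval s) (c.eval s) (d.eval s) := by
  cases obj <;> simp [optimumExpr, Objective.optimum]

@[simp] theorem eval_choiceExpr (obj : Objective) : (choiceExpr obj a b c d).eval s =
    obj.choice (a.eval s) (b.eval s) (c.eval s) (d.eval s) := by
  cases obj <;> simp [choiceExpr, Objective.choice]

@[simp] theorem eval_extraFirstExpr : (extraFirstExpr a b c).eval s =
    extraFirst (a.eval s) (b.eval s) (c.eval s) := by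
  simp only [extraFirstExpr, eval_ifLt, eval_add, eval_sub, eval_mul, eval_div, eval_one, eval_zero]
  have key : ∀ (p q r : Prop) [Decidable p] [Decidable q] [Decidable r],
      (if p then if q then if r then (1 : ℤ) else 0 else 0 else 0) = if p ∧ q ∧ r then 1 else 0 := by
    intros; split_ifs <;> tauto
  exact key _ _ _

@[simp] theorem eval_extraLastExpr : (extraLastExpr a b c d).eval s =
    extraLast (a.eval s) (b.eval s) (c.eval s) (d.eval s) := by
  simp only [extraLastExpr, eval_ifLt, eval_add, eval_sub, eval_mul, eval_div, eval_one, eval_zero,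
    eval_extraFirstExpr]
  have key : ∀ (p q r r' : Prop) [Decidable p] [Decidable q] [Decidable r] [Decidable r'], (r' ↔ ¬ r) →
      (if p then if q then (1 : ℤ) else if r then 0 else 1 else 0) =
        if p ∧ (q ∨ r') then 1 else 0 := by
    intros; split_ifs <;> tauto
  exact key _ _ _ _ not_lt.symm

@[simp] theorem eval_rampExpr : (rampExpr a b c).eval s =
    StairParams.ramp (a.eval s) (b.eval s) (c.eval s) := by
  simp [rampExpr, StairParams.ramp]

end Eval

end RamExpr

/-- Expressions for the parameters of a member of the family. -/
structure StairExprs : Type where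
  x0 : RamExpr
  xT : RamExpr
  yT : RamExpr
  yR : RamExpr
  uB : RamExpr
  zB : RamExpr
  uC : RamExpr
  zC : RamExpr
  q : RamExpr
  r : RamExpr

namespace StairExprs

open RamExpr

/-- The values of the parameters. -/
def eval (p : StairExprs) (s : RamState) : StairParams :=
  ⟨p.x0.eval s, p.xT.eval s, p.yT.eval s, p.yR.eval s, p.uB.eval s, p.zB.eval s, p.uC.eval s,
    p.zC.eval s, p.q.eval s, p.r.eval s⟩

def box (a b c d : RamExpr) : StairExprs where
  x0 := 0
  xT := boxSideExpr a b c d - 1 - d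
  yT := a
  yR := a
  uB := 0
  zB := b - boxSideExpr b c d a + a
  uC := boxSideExpr a b c d - c
  zC := 1 - boxSideExpr b c d a + a
  q := 1
  r := 0

def bay (a b d q r m l : RamExpr) : StairExprs where
  x0 := minExpr 0 (m - b)
  xT := a
  yT := a + maxExpr 0 (d - l)
  yR := a - l + d
  uB := m - b
  zB := ifLt 0 (m + b) (0 - 1) (0 - 2)
  uC := m + 1
  zC := m - 1
  q := q
  r := r

def strip (a b c d : RamExpr) : StairExprs :=
  bay a b d (a / (c + 1))
    (a - a / (c + 1) * (c + 1) - extraFirstExpr a b c - extraLastExpr a b c d)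
    (a / (c + 1) + extraFirstExpr a b c) (a / (c + 1) + extraLastExpr a b c d)

/-- The first parameters if `e` is negative, and the other ones otherwise. -/
def ifNeg (e : RamExpr) (p p' : StairExprs) : StairExprs :=
  ⟨ifLt e 0 p.x0 p'.x0, ifLt e 0 p.xT p'.xT, ifLt e 0 p.yT p'.yT, ifLt e 0 p.yR p'.yR,
    ifLt e 0 p.uB p'.uB, ifLt e 0 p.zB p'.zB, ifLt e 0 p.uC p'.uC, ifLt e 0 p.zC p'.zC,
    ifLt e 0 p.q p'.q, ifLt e 0 p.r p'.r⟩

def choice (e a b c d : RamExpr) : StairExprs := ifNeg e (box a b c d) (strip a b c d)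

def xCoord (p : StairExprs) (a b c d k : RamExpr) : RamExpr :=
  ifLt k (2 * (a + d) + 2)
    (ifLt (a + d + 1 - (k + 1) / 2) 1 p.x0
      (ifLt (a + d + 1 - (k + 1) / 2) (a + 1) (a + d + 1 - (k + 1) / 2)
        (p.xT + (a + d + 1 - (k + 1) / 2 - a))))
    (ifLt ((k - (2 * (a + d) + 2) + 1) / 2) 1 p.x0
      (ifLt ((k - (2 * (a + d) + 2) + 1) / 2) (b + 1) (p.uB + (k - (2 * (a + d) + 2) + 1) / 2)
        (ifLt ((k - (2 * (a + d) + 2) + 1) / 2) (b + c + 1)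
          (p.uC + rampExpr p.q p.r ((k - (2 * (a + d) + 2) + 1) / 2 - b - 1))
          (p.xT + d + 1))))

def yCoord (p : StairExprs) (a b d k : RamExpr) : RamExpr :=
  ifLt k (2 * (a + d) + 2)
    (ifLt (a + d - k / 2) a (a + d - k / 2)
      (ifLt (a + d - k / 2) (a + 1) p.yT (p.yR - (a + d - k / 2 - a))))
    (ifLt ((k - (2 * (a + d) + 2)) / 2) (b + 1) (p.zB - (k - (2 * (a + d) + 2)) / 2)
      (p.zC + rampExpr p.q p.r ((k - (2 * (a + d) + 2)) / 2 - b - 1)))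

variable (s : RamState) (p : StairExprs) (a b c d e k : RamExpr)

theorem eval_ifNeg (p' : StairExprs) :
    (ifNeg e p p').eval s = if e.eval s < 0 then p.eval s else p'.eval s := by
  by_cases h : e.eval s < 0
  · have key : ∀ u v, (ifLt e 0 u v).eval s = u.eval s := fun u v => by
      rw [eval_ifLt]; exact if_pos h
    rw [if_pos h]
    simp only [ifNeg, eval, key]
  · have key : ∀ u v, (ifLt e 0 u v).eval s = v.eval s := fun u v => by
      rw [eval_ifLt]; exact if_neg h
    rw [if_neg h]
    simp only [ifNeg, eval, key]

theorem eval_box : (box a b c d).eval s =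
    boxParams (a.eval s) (b.eval s) (c.eval s) (d.eval s) := by
  simp [eval, box, boxParams]

theorem eval_strip : (strip a b c d).eval s =
    stripParams (a.eval s) (b.eval s) (c.eval s) (d.eval s) := by
  simp only [eval, strip, bay, stripParams, bayParams, eval_minExpr, eval_maxExpr, eval_ifLt,
    eval_zero, eval_one, eval_two, eval_add, eval_sub, eval_mul, eval_div, eval_extraFirstExpr,
    eval_extraLastExpr]
  rfl

theorem eval_choice : (choice e a b c d).eval s =
    choiceParams (e.eval s) (a.eval s) (b.eval s) (c.eval s) (d.eval s) := by
  rw [choice, eval_ifNeg, eval_box, eval_strip]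
  rfl

theorem eval_xCoord : (xCoord p a b c d k).eval s =
    (p.eval s).xCoord (a.eval s) (b.eval s) (c.eval s) (d.eval s) (k.eval s) := by
  simp only [xCoord, eval_ifLt, eval_add, eval_sub, eval_mul, eval_div, eval_one, eval_two,
    eval_rampExpr]
  rfl

theorem eval_yCoord : (yCoord p a b d k).eval s =
    (p.eval s).yCoord (a.eval s) (b.eval s) (d.eval s) (k.eval s) := by
  simp only [yCoord, eval_ifLt, eval_add, eval_sub, eval_mul, eval_div, eval_one, eval_two,
    eval_rampExpr]
  rfl

end StairExprs

/-! ### Evaluation of the optimum in constant time -/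

theorem natCast_le_pow {n : ℤ} (hn : 2 ≤ n) (C : ℕ) : (C : ℤ) ≤ n ^ (C + 1) := by
  have h1 : (C : ℤ) < 2 ^ C := by exact_mod_cast C.lt_two_pow_self
  have h2 : (2 : ℤ) ^ C ≤ n ^ C := pow_le_pow_left₀ (by norm_num) hn C
  have h3 : n ^ C ≤ n ^ (C + 1) := pow_le_pow_right₀ (by omega) (by omega)
  omega

/-- Computation of the optimum from the reflex counts. -/
def optimumProgram (obj : Objective) : RamProg :=
  RamProg.assign 0 (RamExpr.optimumExpr obj (RamExpr.reg 1) (RamExpr.reg 2) (RamExpr.reg 3)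
    (RamExpr.reg 0))

theorem optimumProgram_isStraight (obj : Objective) : (optimumProgram obj).IsStraight := trivial

/-- The counts are at most `n`, and `n ^ (constMax + 1)` also dominates every constant of the
program, so the general bound for programs without tests applies. The count `tl` plays the role of
`d`, hence the order of the registers. -/
theorem run_optimumProgram (obj : Objective) {n tl bl br tr : ℕ}
    (hn : n = 2 * (bl + br + tr + tl) + 4) :
    ∃ s, RamRun ((n : ℤ) ^ (((optimumProgram obj).constMax + 1) * (optimumProgram obj).degree))
      (optimumProgram obj) (countsInput tl bl br tr) (optimumProgram obj).time s ∧
      s.reg 0 = obj.optimum bl br tr tl := by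
  have hn2 : (2 : ℤ) ≤ n := by omega
  have hM := natCast_le_pow hn2 (optimumProgram obj).constMax
  have hM1 : (n : ℤ) ≤ n ^ ((optimumProgram obj).constMax + 1) :=
    le_self_pow₀ (by omega) (by omega)
  have hb : (countsInput tl bl br tr).IsBounded (n ^ ((optimumProgram obj).constMax + 1)) := by
    refine RamState.IsBounded.mono ⟨fun r => ?_, fun a => ?_⟩ hM1
    · unfold countsInput
      dsimp only
      split_ifs <;> simp <;> omega
    · simp [countsInput]
  obtain ⟨h1, -⟩ := (optimumProgram_isStraight obj).run (hn2.trans hM1) hb hM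
  rw [← pow_mul] at h1
  refine ⟨_, h1, ?_⟩
  simp only [optimumProgram, RamProg.exec, Function.update_self, RamExpr.eval_optimumExpr,
    RamExpr.eval_reg]
  rfl

/-! ### The separators between the stairs -/

section Separators

variable {n : ℕ} [NeZero n] {S : Fin n → Turn} {o p a b c d : ℕ}

theorem StairsFrom.congr {o' : ℕ} (h : StairsFrom S o a b c d) (ho : o % n = o' % n) :
    StairsFrom S o' a b c d := by
  refine ⟨h.1, fun k hk => ?_⟩
  rw [← h.2 k hk]
  congr 1
  ext
  simp only [Fin.val_ofNat]
  exact (Nat.ModEq.add_right k ho).symm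

/-- Some separator is the first one, and no other one has passed the end of the sequence. -/
theorem StairsFrom.exists_first (h : StairsFrom S o a b c d) :
    ∃ p a b c d, StairsFrom S (p + 1) a b c d ∧ p + 2 * d + 2 * a + 2 * b + 3 < n := by
  have hn := h.1
  obtain ⟨p, hp, h⟩ : ∃ p, p < n ∧ StairsFrom S (p + 1) a b c d := by
    refine ⟨(o + n - 1) % n, Nat.mod_lt _ (by omega), h.congr ?_⟩
    rw [Nat.mod_add_mod, show o + n - 1 + 1 = o + n by omega, Nat.add_mod_right]
  have sub : ∀ {q a b c d : ℕ}, n ≤ q → StairsFrom S (q + 1) a b c d →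
      StairsFrom S (q - n + 1) a b c d := fun {q _ _ _ _} hq h => h.congr (by
    rw [← Nat.add_mod_right (q - n + 1), show q - n + 1 + n = q + 1 by omega])
  -- The earliest separator that passes the end of the sequence becomes the leading one after
  -- subtraction of `n`.
  by_cases h1 : n ≤ p + 2 * d + 1
  · exact ⟨p + 2 * d + 1 - n, b, c, d, a, sub h1 (by convert h.rotate using 1; ring), by omega⟩
  by_cases h2 : n ≤ p + 2 * d + 2 * a + 2
  · exact ⟨p + 2 * d + 2 * a + 2 - n, c, d, a, b,
      sub h2 (by convert h.rotate.rotate using 1; ring), by omega⟩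
  by_cases h3 : n ≤ p + 2 * d + 2 * a + 2 * b + 3
  · exact ⟨p + 2 * d + 2 * a + 2 * b + 3 - n, d, a, b, c,
      sub h3 (by convert h.rotate.rotate.rotate using 1; ring), by omega⟩
  exact ⟨p, a, b, c, d, h, by omega⟩

theorem stairTurn_eq_left_iff {k : ℕ} : stairTurn a b c d k = Turn.left ↔
    if k < 2 * (a + d) + 2 then k % 2 = 0 ∧ k / 2 ≤ d ∨ k % 2 = 1 ∧ d ≤ k / 2
    else k % 2 = 0 ∧ (k - (2 * (a + d) + 2)) / 2 ≤ b ∨ k % 2 = 1 ∧ b ≤ (k - (2 * (a + d) + 2)) / 2 := by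
  unfold stairTurn
  split_ifs <;> simp <;> omega

/-- The separators are the places where two left turns are adjacent. -/
theorem StairsFrom.left_left_iff (h : StairsFrom S (p + 1) a b c d)
    (hp : p + 2 * d + 2 * a + 2 * b + 3 < n) {i : ℕ} (hi : i < n) :
    S (Fin.ofNat n i) = Turn.left ∧ S (Fin.ofNat n (i + 1)) = Turn.left ↔
      i = p ∨ i = p + 2 * d + 1 ∨ i = p + 2 * d + 2 * a + 2 ∨ i = p + 2 * d + 2 * a + 2 * b + 3 := by
  have hn := h.1
  have key : ∀ k j, k < n → (p + 1 + k = j ∨ p + 1 + k = j + n) →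
      S (Fin.ofNat n j) = stairTurn a b c d k := by
    intro k j hk hj
    rw [← h.2 k hk]
    congr 1
    ext
    simp only [Fin.val_ofNat]
    rcases hj with hj | hj <;> rw [hj]
    rw [Nat.add_mod_right]
  obtain ⟨k, hk, e⟩ : ∃ k < n, p + 1 + k = i ∨ p + 1 + k = i + n := by
    by_cases hip : p < i
    · exact ⟨i - (p + 1), by omega, by omega⟩
    · exact ⟨i + n - (p + 1), by omega, by omega⟩
  obtain ⟨k', hk', e', hkk⟩ : ∃ k' < n, (p + 1 + k' = i + 1 ∨ p + 1 + k' = i + 1 + n) ∧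
      (k' = k + 1 ∨ k' = 0 ∧ k + 1 = n) := by
    by_cases hkn : k + 1 < n
    · exact ⟨k + 1, hkn, by omega, by omega⟩
    · exact ⟨0, by omega, by omega, by omega⟩
  rw [key k i hk e, key k' (i + 1) hk' e', stairTurn_eq_left_iff, stairTurn_eq_left_iff]
  split_ifs <;> omega

end Separators

/-! ### The program that finds the separators -/

namespace RamExpr

/-- The value of `u` if the turns at positions `reg 5` and `reg 5 + 1` are left turns, and the value
of `v` otherwise. -/
def ifLeftLeft (u v : RamExpr) : RamExpr :=
  ifLt 0 (load (reg 5)) (ifLt 0 (load (reg 5 + 1)) u v) v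

end RamExpr

open RamExpr RamProg in
/-- One step of the scan for separators: the last four of them are kept in the registers `1`, `2`,
`3`, `4`. -/
def scanStep : RamProg :=
  seq (assign 1 (ifLeftLeft (reg 2) (reg 1)))
    (seq (assign 2 (ifLeftLeft (reg 3) (reg 2)))
      (seq (assign 3 (ifLeftLeft (reg 4) (reg 3)))
        (seq (assign 4 (ifLeftLeft (reg 5) (reg 4))) (assign 5 (reg 5 + 1)))))

theorem scanStep_isStraight : scanStep.IsStraight := ⟨trivial, trivial, trivial, trivial, trivial⟩

/-- The state of the scan before position `i` is inspected. -/
structure IsScanned (n p₁ p₂ p₃ p₄ : ℤ) (m : ℤ → ℤ) (i : ℤ) (s : RamState) : Prop where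
  mem : s.mem = m
  reg0 : s.reg 0 = n
  reg1 : s.reg 1 = if p₄ < i then p₁ else 0
  reg2 : s.reg 2 = if p₄ < i then p₂ else if p₃ < i then p₁ else 0
  reg3 : s.reg 3 = if p₄ < i then p₃ else if p₃ < i then p₂ else if p₂ < i then p₁ else 0
  reg4 : s.reg 4 = if p₄ < i then p₄ else if p₃ < i then p₃ else if p₂ < i then p₂ else
    if p₁ < i then p₁ else 0
  reg5 : s.reg 5 = i
  reg_eq_zero : ∀ r, 6 ≤ r → s.reg r = 0

namespace IsScanned

variable {n p₁ p₂ p₃ p₄ : ℤ} {m : ℤ → ℤ} {i : ℤ} {s : RamState}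

theorem isBounded (h : IsScanned n p₁ p₂ p₃ p₄ m i s) (h0 : 0 ≤ p₁) (h1 : p₁ < p₂) (h2 : p₂ < p₃)
    (h3 : p₃ < p₄) (h4 : p₄ < n) (hi : 0 ≤ i) (hin : i ≤ n) (hm : ∀ a, |m a| ≤ n) :
    s.IsBounded n := by
  refine ⟨fun r => ?_, fun a => h.mem ▸ hm a⟩
  rw [abs_le]
  rcases r with _ | _ | _ | _ | _ | _ | r
  · rw [h.reg0]; omega
  · rw [h.reg1]; split_ifs <;> omega
  · rw [h.reg2]; split_ifs <;> omega
  · rw [h.reg3]; split_ifs <;> omega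
  · rw [h.reg4]; split_ifs <;> omega
  · rw [h.reg5]; omega
  · rw [h.reg_eq_zero _ (by omega)]; omega

/-- The registers `1` to `4` form a shift register. They are overwritten in increasing order, so
each assignment still reads the old content of its successor. -/
theorem step (h : IsScanned n p₁ p₂ p₃ p₄ m i s) (h1 : p₁ < p₂) (h2 : p₂ < p₃)
    (h3 : p₃ < p₄) (hm : 0 < m i ∧ 0 < m (i + 1) ↔ i = p₁ ∨ i = p₂ ∨ i = p₃ ∨ i = p₄) :
    IsScanned n p₁ p₂ p₃ p₄ m (i + 1) (scanStep.exec s) := by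
  obtain ⟨e, e0, e1, e2, e3, e4, e5, e6⟩ := h
  have key : ∀ (u v : RamExpr) (s' : RamState), s'.mem = m → s'.reg 5 = i →
      (RamExpr.ifLeftLeft u v).eval s' =
        if i = p₁ ∨ i = p₂ ∨ i = p₃ ∨ i = p₄ then u.eval s' else v.eval s' := by
    intro u v s' h h'
    simp only [RamExpr.ifLeftLeft, RamExpr.eval_ifLt, RamExpr.eval_load, RamExpr.eval_add,
      RamExpr.eval_reg, RamExpr.eval_zero, RamExpr.eval_one, h, h']
    split_ifs <;> tauto
  simp only [scanStep, RamProg.exec]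
  constructor
  · exact e
  · simpa using e0
  all_goals
    simp only [Function.update_apply, RamExpr.eval_reg, RamExpr.eval_add, RamExpr.eval_one, key, e,
      e5, if_true, if_false, Nat.reduceEqDiff, OfNat.ofNat_ne_one, OfNat.one_ne_ofNat]
  · rw [e1, e2]; split_ifs <;> omega
  · rw [e2, e3]; split_ifs <;> omega
  · rw [e3, e4]; split_ifs <;> omega
  · rw [e4]; split_ifs <;> omega
  · intro r hr
    rw [if_neg (by omega), if_neg (by omega), if_neg (by omega), if_neg (by omega),
      if_neg (by omega), e6 r hr]

end IsScanned

open RamExpr RamProg in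
/-- The first turn is copied to the end of the sequence, and then the sequence is scanned. -/
def scanProgram : RamProg :=
  seq (store (reg 0) (load 0)) (loop (reg 0 - reg 5) scanStep)

/-- The copy of the first turn at address `n` lets the test at position `n - 1` look across the end
of the sequence. All four separators lie in one period, so after `n` steps the shift register holds
them in increasing order. -/
theorem run_scanProgram {n : ℕ} [NeZero n] {S : Fin n → Turn} {p a b c d : ℕ}
    (h : StairsFrom S (p + 1) a b c d) (hp : p + 2 * d + 2 * a + 2 * b + 3 < n) :
    ∃ s, RamRun ((n : ℤ) ^ ((scanStep.constMax + 1) * (scanStep.degree + 4))) scanProgram (seqInput S)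
        (3 + 1 + (n * (3 + 1 + scanStep.time) + (3 + 1))) s ∧ s.IsBounded n ∧
      s.reg 0 = n ∧ s.reg 1 = p ∧ s.reg 2 = p + 2 * d + 1 ∧ s.reg 3 = p + 2 * d + 2 * a + 2 ∧
      s.reg 4 = p + 2 * d + 2 * a + 2 * b + 3 ∧ s.reg 6 = 0 := by
  have hn := h.1
  set M : ℤ := (n : ℤ) ^ (scanStep.constMax + 1) with hMdef
  have hM := natCast_le_pow (n := (n : ℤ)) (by omega) scanStep.constMax
  have hM1 : (n : ℤ) ≤ M := le_self_pow₀ (by omega) (by omega)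
  have hM2 : 2 ≤ M := by omega
  have hW : ∀ {j}, j ≤ scanStep.degree + 4 →
      M ^ j ≤ (n : ℤ) ^ ((scanStep.constMax + 1) * (scanStep.degree + 4)) := by
    intro j hj
    rw [pow_mul]
    exact pow_le_pow_right₀ (by omega) hj
  have hinput : ∀ i < n, (seqInput S).mem (i : ℤ) = (S (Fin.ofNat n i)).code := by
    intro i hi
    simp only [seqInput, Int.toNat_natCast, dif_pos hi, if_pos (Int.natCast_nonneg i)]
    congr 2
    ext
    exact (Nat.mod_eq_of_lt hi).symm
  have hcode : ∀ t : Turn, |t.code| ≤ n := by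
    intro t
    cases t <;> simp [Turn.code] <;> omega
  have hb : (seqInput S).IsBounded n := by
    refine ⟨fun r => ?_, fun x => ?_⟩
    · simp only [seqInput]
      split_ifs <;> simp
    · simp only [seqInput]
      split_ifs
      · exact hcode _
      all_goals simp
  let m : ℤ → ℤ := Function.update (seqInput S).mem n ((seqInput S).mem 0)
  have hmb : ∀ x, |m x| ≤ n := by
    intro x
    simp only [m, Function.update_apply]
    split_ifs
    exacts [hb.mem _, hb.mem _]
  have hm : ∀ i, i ≤ n → m (i : ℤ) = (S (Fin.ofNat n i)).code := by
    intro i hi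
    simp only [m, Function.update_apply]
    split_ifs with hin
    · have := hinput 0 (by omega)
      rw [Nat.cast_zero] at this
      rw [this, ofNat_congr (k := i) (l := 0)]
      rw [Nat.cast_inj.1 hin, Nat.mod_self, Nat.zero_mod]
    · exact hinput i (by omega)
  have hleft : ∀ t : Turn, 0 < t.code ↔ t = Turn.left := by
    intro t
    cases t <;> simp [Turn.code]
  have hpos : ∀ i < n, 0 < m (i : ℤ) ∧ 0 < m ((i : ℤ) + 1) ↔ (i : ℤ) = p ∨ (i : ℤ) = p + 2 * d + 1 ∨
      (i : ℤ) = p + 2 * d + 2 * a + 2 ∨ (i : ℤ) = p + 2 * d + 2 * a + 2 * b + 3 := by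
    intro i hi
    rw [← Nat.cast_succ, hm i hi.le, hm (i + 1) hi, hleft, hleft, h.left_left_iff hp hi]
    omega
  have hfits : ∀ (e : RamExpr) (s : RamState), s.IsBounded n → e.constMax = 0 → e.cost ≤ 4 →
      e.Fits ((n : ℤ) ^ ((scanStep.constMax + 1) * (scanStep.degree + 4))) s := fun e s hs h0 h4 =>
    (RamExpr.fits_pow_cost hM2 (hs.mono hM1) e (by rw [h0]; simp; omega)).2.mono (hW (by omega))
  have start : RamRun ((n : ℤ) ^ ((scanStep.constMax + 1) * (scanStep.degree + 4)))
      (RamProg.store (RamExpr.reg 0) (RamExpr.load 0)) (seqInput S) (3 + 1)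
      ⟨(seqInput S).reg, m⟩ :=
    RamRun.store (RamExpr.reg 0) (RamExpr.load 0) _ (hfits _ _ hb rfl (by decide))
      (hfits _ _ hb rfl (by decide))
  obtain ⟨s, hs, inv⟩ := RamRun.loop_of_invariant (N := n)
    (W := (n : ℤ) ^ ((scanStep.constMax + 1) * (scanStep.degree + 4)))
    (guard := RamExpr.reg 0 - RamExpr.reg 5) (body := scanStep) (c := scanStep.time)
    (fun i s => IsScanned n p (p + 2 * d + 1) (p + 2 * d + 2 * a + 2)
      (p + 2 * d + 2 * a + 2 * b + 3) m i s)
    (s := ⟨(seqInput S).reg, m⟩)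
    (fun i hi s hs => by
      have hsb := hs.isBounded (by omega) (by omega) (by omega) (by omega) (by omega) (by omega)
        (by omega) hmb
      refine ⟨hfits _ _ hsb rfl (by decide), ?_, _,
        (scanStep_isStraight.run hM2 (hsb.mono hM1) hM).1.mono (hW (by omega)), ?_⟩
      · rw [RamExpr.eval_sub, RamExpr.eval_reg, RamExpr.eval_reg, hs.reg0, hs.reg5]
        omega
      · rw [Nat.cast_succ]
        exact hs.step (by omega) (by omega) (by omega) (hpos i hi))
    (fun s hs => by
      have hsb := hs.isBounded (by omega) (by omega) (by omega) (by omega) (by omega) (by omega)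
        (by omega) hmb
      refine ⟨hfits _ _ hsb rfl (by decide), ?_⟩
      rw [RamExpr.eval_sub, RamExpr.eval_reg, RamExpr.eval_reg, hs.reg0, hs.reg5]
      omega)
    (by
      constructor
      · rfl
      · rfl
      · rw [if_neg (by omega)]; rfl
      · rw [if_neg (by omega), if_neg (by omega)]; rfl
      · rw [if_neg (by omega), if_neg (by omega), if_neg (by omega)]; rfl
      · rw [if_neg (by omega), if_neg (by omega), if_neg (by omega), if_neg (by omega)]; rfl
      · rfl
      · intro r hr
        exact if_neg (by omega))
  refine ⟨s, .seq _ _ _ _ _ _ _ start hs, inv.isBounded (by omega) (by omega) (by omega) (by omega)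
    (by omega) (by omega) le_rfl hmb, inv.reg0, ?_, ?_, ?_, ?_, inv.reg_eq_zero 6 le_rfl⟩
  · rw [inv.reg1, if_pos (by omega)]
  · rw [inv.reg2, if_pos (by omega)]
  · rw [inv.reg3, if_pos (by omega)]
  · rw [inv.reg4, if_pos (by omega)]

/-! ### The program that writes an optimal polygon -/

namespace PolygonProgram

open RamExpr RamProg

/-- The reflex counts of the four stairs. -/
def countA : RamExpr := (reg 3 - reg 2 - 1) / 2
def countB : RamExpr := (reg 4 - reg 3 - 1) / 2
def countC : RamExpr := (reg 1 + reg 0 - reg 4 - 1) / 2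
def countD : RamExpr := (reg 2 - reg 1 - 1) / 2

variable (obj : Objective)

def chosen : RamExpr := choiceExpr obj countA countB countC countD

def rotA : RamExpr := rotSelectExpr (chosen obj) countA countB countC countD
def rotB : RamExpr := rotSelectExpr (chosen obj) countB countC countD countA
def rotC : RamExpr := rotSelectExpr (chosen obj) countC countD countA countB
def rotD : RamExpr := rotSelectExpr (chosen obj) countD countA countB countC

def origin : RamExpr :=
  rotSelectExpr (chosen obj) (reg 1 + 1) (reg 2 + 1) (reg 3 + 1) (reg 4 + 1)

def params : StairExprs :=
  StairExprs.choice (chosen obj) (rotA obj) (rotB obj) (rotC obj) (rotD obj)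

def coordX : RamExpr :=
  (params obj).xCoord (rotA obj) (rotB obj) (rotC obj) (rotD obj) (reg 6)

def coordY : RamExpr := (params obj).yCoord (rotA obj) (rotB obj) (rotD obj) (reg 6)

/-- The address of the `x`-coordinate of vertex `reg 6`. -/
def address : RamExpr :=
  reg 0 + 2 * (origin obj + reg 6 - reg 0 * ((origin obj + reg 6) / reg 0))

def writeStep : RamProg :=
  seq (store (address obj) (coordX obj))
    (seq (store (address obj + 1) (coordY obj)) (assign 6 (reg 6 + 1)))

theorem writeStep_isStraight : (writeStep obj).IsStraight := ⟨trivial, trivial, trivial⟩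

def writeProgram : RamProg := loop (reg 0 - reg 6) (writeStep obj)

theorem eval_address (s : RamState) :
    (address obj).eval s = s.reg 0 + 2 * (((origin obj).eval s + s.reg 6) % s.reg 0) := by
  rw [Int.emod_def]
  rfl

/-- The values do not depend on the memory, and the choice does not depend on the position. -/
theorem eval_eq {s s' : RamState} (h : ∀ r < 6, s.reg r = s'.reg r) :
    (chosen obj).eval s = (chosen obj).eval s' ∧ (rotA obj).eval s = (rotA obj).eval s' ∧
    (rotB obj).eval s = (rotB obj).eval s' ∧ (rotC obj).eval s = (rotC obj).eval s' ∧
    (rotD obj).eval s = (rotD obj).eval s' ∧ (origin obj).eval s = (origin obj).eval s' := by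
  have h0 := h 0 (by omega)
  have h1 := h 1 (by omega)
  have h2 := h 2 (by omega)
  have h3 := h 3 (by omega)
  have h4 := h 4 (by omega)
  simp only [chosen, rotA, rotB, rotC, rotD, origin, countA, countB, countC, countD,
    eval_choiceExpr, eval_rotSelectExpr, eval_div, eval_sub, eval_add, eval_reg, eval_one, eval_two,
    h0, h1, h2, h3, h4, and_self]

theorem eval_coordX (s : RamState) : (coordX obj).eval s =
    (choiceParams ((chosen obj).eval s) ((rotA obj).eval s) ((rotB obj).eval s) ((rotC obj).eval s)
      ((rotD obj).eval s)).xCoord ((rotA obj).eval s) ((rotB obj).eval s) ((rotC obj).eval s)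
      ((rotD obj).eval s) (s.reg 6) := by
  rw [coordX, StairExprs.eval_xCoord, params, StairExprs.eval_choice, eval_reg]

theorem eval_coordY (s : RamState) : (coordY obj).eval s =
    (choiceParams ((chosen obj).eval s) ((rotA obj).eval s) ((rotB obj).eval s) ((rotC obj).eval s)
      ((rotD obj).eval s)).yCoord ((rotA obj).eval s) ((rotB obj).eval s)
      ((rotD obj).eval s) (s.reg 6) := by
  rw [coordY, StairExprs.eval_yCoord, params, StairExprs.eval_choice, eval_reg]

theorem eval_congr {s s' : RamState} (h : s.reg = s'.reg) :
    (coordX obj).eval s = (coordX obj).eval s' ∧ (coordY obj).eval s = (coordY obj).eval s' ∧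
    (address obj).eval s = (address obj).eval s' := by
  obtain ⟨h1, h2, h3, h4, h5, h6⟩ := eval_eq obj (s := s) (s' := s') fun r _ => by rw [h]
  rw [eval_coordX, eval_coordX, eval_coordY, eval_coordY, eval_address, eval_address, h1, h2, h3, h4,
    h5, h6, h]
  exact ⟨rfl, rfl, rfl⟩

/-- Address and coordinates are computed from registers alone, so storing the first coordinate does
not affect the second one or its address. -/
theorem exec_writeStep (s : RamState) : (writeStep obj).exec s =
    ⟨Function.update s.reg 6 (s.reg 6 + 1),
      Function.update (Function.update s.mem ((address obj).eval s) ((coordX obj).eval s))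
        ((address obj).eval s + 1) ((coordY obj).eval s)⟩ := by
  obtain ⟨-, h2, h3⟩ := eval_congr obj
    (s := ⟨s.reg, Function.update s.mem ((address obj).eval s) ((coordX obj).eval s)⟩) (s' := s) rfl
  simp only [writeStep, RamProg.exec, eval_add, eval_one, eval_reg, h2, h3]

/-- The degree of a bound for the values in memory. -/
def memDegree : ℕ := ((writeStep obj).constMax + 1) * ((coordX obj).cost + (coordY obj).cost)

theorem pow_memDegree (n : ℤ) : n ^ memDegree obj =
    (n ^ ((writeStep obj).constMax + 1)) ^ ((coordX obj).cost + (coordY obj).cost) :=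
  pow_mul _ _ _

theorem constMax_coord_le : (coordX obj).constMax ≤ (writeStep obj).constMax ∧
    (coordY obj).constMax ≤ (writeStep obj).constMax := by
  simp [writeStep, RamProg.constMax]

attribute [irreducible] coordX coordY address writeStep memDegree

/-- The registers remain bounded by `n` and everything stored is a fixed expression in them, so the
memory obeys the same bound before every iteration. The growth estimate for programs without tests
is spent on a single iteration and does not accumulate. -/
theorem run_writeProgram {n : ℕ} (hn : 2 ≤ n) {s : RamState} (hs : s.IsBounded n)
    (h0 : s.reg 0 = n) (h6 : s.reg 6 = 0) :
    ∃ s', RamRun ((n : ℤ) ^ (memDegree obj * ((writeStep obj).degree + 3))) (writeProgram obj) s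
        (n * (3 + 1 + (writeStep obj).time) + (3 + 1)) s' ∧
      ∀ u k : ℕ, k < n → (u : ℤ) = ((origin obj).eval s + k) % n →
        s'.mem (n + 2 * u) =
          (coordX obj).eval ⟨Function.update s.reg 6 k, s.mem⟩ ∧
        s'.mem (n + 2 * u + 1) =
          (coordY obj).eval ⟨Function.update s.reg 6 k, s.mem⟩ := by
  set M : ℤ := (n : ℤ) ^ ((writeStep obj).constMax + 1) with hMdef
  have hM := natCast_le_pow (n := (n : ℤ)) (by omega) (writeStep obj).constMax
  have hM1 : (n : ℤ) ≤ M := le_self_pow₀ (by omega) (by omega)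
  have hM2 : 2 ≤ M := by omega
  have hcx := (coordX obj).one_le_cost
  have hMW : (n : ℤ) ^ memDegree obj = M ^ ((coordX obj).cost + (coordY obj).cost) :=
    pow_memDegree obj n
  have hM3 : M ≤ (n : ℤ) ^ memDegree obj := hMW ▸ le_self_pow₀ (by omega) (by omega)
  have hW : ∀ {j}, j ≤ (writeStep obj).degree + 3 →
      ((n : ℤ) ^ memDegree obj) ^ j ≤
        (n : ℤ) ^ (memDegree obj * ((writeStep obj).degree + 3)) := by
    intro j hj
    rw [pow_mul]
    exact pow_le_pow_right₀ (by omega) hj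
  have hregs : ∀ k : ℕ, k ≤ n →
      RamState.IsBounded n ⟨Function.update s.reg 6 k, s.mem⟩ := by
    refine fun k hk => ⟨fun r => ?_, hs.mem⟩
    simp only [Function.update_apply]
    split_ifs
    · rw [abs_le]; omega
    · exact hs.reg r
  have hx : ∀ k : ℕ, k ≤ n → |(coordX obj).eval ⟨Function.update s.reg 6 k, s.mem⟩| ≤
      (n : ℤ) ^ memDegree obj := by
    intro k hk
    rw [hMW]
    exact (fits_pow_cost hM2 ((hregs k hk).mono hM1) _
      (le_trans (Nat.cast_le.2 (constMax_coord_le obj).1) hM)).1.trans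
      (pow_le_pow_right₀ (by omega) (by omega))
  have hy : ∀ k : ℕ, k ≤ n → |(coordY obj).eval ⟨Function.update s.reg 6 k, s.mem⟩| ≤
      (n : ℤ) ^ memDegree obj := by
    intro k hk
    rw [hMW]
    exact (fits_pow_cost hM2 ((hregs k hk).mono hM1) _
      (le_trans (Nat.cast_le.2 (constMax_coord_le obj).2) hM)).1.trans
      (pow_le_pow_right₀ (by omega) (by omega))
  have hguard : ∀ t : RamState, t.IsBounded (n ^ memDegree obj) →
      (reg 0 - reg 6).Fits ((n : ℤ) ^ (memDegree obj * ((writeStep obj).degree + 3))) t := fun t ht =>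
    (fits_pow_cost (hM2.trans hM3) ht (reg 0 - reg 6) (by
      rw [show (reg 0 - reg 6).constMax = 0 from rfl, Nat.cast_zero]
      omega)).2.mono (hW (show (reg 0 - reg 6).cost ≤ _ by
        rw [show (reg 0 - reg 6).cost = 3 from rfl]; omega))
  let Inv : ℕ → RamState → Prop := fun k t =>
    t.reg = Function.update s.reg 6 k ∧ t.IsBounded (n ^ memDegree obj) ∧
    ∀ u k' : ℕ, k' < k → (u : ℤ) = ((origin obj).eval s + k') % n →
      t.mem (n + 2 * u) = (coordX obj).eval ⟨Function.update s.reg 6 k', s.mem⟩ ∧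
      t.mem (n + 2 * u + 1) = (coordY obj).eval ⟨Function.update s.reg 6 k', s.mem⟩
  have hval : ∀ k t, Inv k t → (reg 0 - reg 6).eval t = n - k := by
    intro k t ht
    rw [eval_sub, eval_reg, eval_reg, ht.1, Function.update_self, Function.update_of_ne (by omega), h0]
  obtain ⟨s', hr, -, -, hs'⟩ := RamRun.loop_of_invariant (N := n) (guard := reg 0 - reg 6)
    (W := (n : ℤ) ^ (memDegree obj * ((writeStep obj).degree + 3)))
    (body := writeStep obj) (c := (writeStep obj).time) Inv (s := s)
    (fun k hk t ht => by
      refine ⟨hguard t ht.2.1, by rw [hval k t ht]; omega, _,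
        ((writeStep_isStraight obj).run (hM2.trans hM3) ht.2.1 (hM.trans hM3)).1.mono
          (hW (by omega)), ?_⟩
      obtain ⟨e1, e2, e3⟩ := ht
      obtain ⟨g1, g2, -⟩ := eval_congr obj (s := t) (s' := ⟨Function.update s.reg 6 k, s.mem⟩) e1
      have ho := (eval_eq obj (s := t) (s' := s) fun r hr => by
        rw [e1, Function.update_of_ne (by omega)]).2.2.2.2.2
      have ha : (address obj).eval t = n + 2 * (((origin obj).eval s + k) % n) := by
        rw [eval_address, ho, e1, Function.update_self, Function.update_of_ne (by omega), h0]
      rw [exec_writeStep, g1, g2, ha, e1]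
      refine ⟨?_, ⟨fun r => ?_, fun x => ?_⟩, fun u k' hk' hu => ?_⟩
      · simp
      · simp only [Function.update_self, Function.update_idem]
        have := (hregs (k + 1) hk).reg r
        push_cast at this
        exact this.trans (hM1.trans hM3)
      · simp only [Function.update_apply]
        split_ifs
        exacts [hy k hk.le, hx k hk.le, e2.mem x]
      · simp only [Function.update_apply]
        rcases eq_or_ne k' k with rfl | hne
        · rw [← hu, if_neg (by omega), if_pos rfl, if_pos rfl]
          exact ⟨rfl, rfl⟩
        -- Distinct positions below `n` are distinct modulo `n` after translation, so the pair of
        -- cells written now is disjoint from those of earlier vertices.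
        · have hdiff : (u : ℤ) ≠ ((origin obj).eval s + k) % n := by
            intro h
            have := Int.ModEq.add_left_cancel' _ (hu.symm.trans h)
            rw [Int.ModEq, Int.emod_eq_of_lt (by omega) (by omega),
              Int.emod_eq_of_lt (by omega) (by omega)] at this
            omega
          rw [if_neg (by omega), if_neg (by omega), if_neg (by omega), if_neg (by omega)]
          exact e3 u k' (by omega) hu)
    (fun t ht => ⟨hguard t ht.2.1, by rw [hval n t ht]; omega⟩)
    ⟨by rw [Nat.cast_zero, ← h6, Function.update_eq_self], hs.mono (hM1.trans hM3), by omega⟩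
  exact ⟨s', hr, hs'⟩

/-- The values computed from the positions of the separators. -/
theorem eval_of_separators {s : RamState} {n p a b c d : ℕ} (hn : n = 2 * (a + b + c + d) + 4)
    (h0 : s.reg 0 = n) (h1 : s.reg 1 = p) (h2 : s.reg 2 = p + 2 * d + 1)
    (h3 : s.reg 3 = p + 2 * d + 2 * a + 2) (h4 : s.reg 4 = p + 2 * d + 2 * a + 2 * b + 3) :
    (chosen obj).eval s = obj.choice a b c d ∧
    (rotA obj).eval s = rotSelect ((chosen obj).eval s) a b c d ∧
    (rotB obj).eval s = rotSelect ((chosen obj).eval s) b c d a ∧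
    (rotC obj).eval s = rotSelect ((chosen obj).eval s) c d a b ∧
    (rotD obj).eval s = rotSelect ((chosen obj).eval s) d a b c ∧
    (origin obj).eval s = rotSelect ((chosen obj).eval s) (p + 1 : ℕ) ((p + 1 : ℕ) + 2 * d + 1)
      ((p + 1 : ℕ) + 2 * d + 2 * a + 2) ((p + 1 : ℕ) + 2 * d + 2 * a + 2 * b + 3) := by
  have ha : countA.eval s = a := by
    simp only [countA, eval_div, eval_sub, eval_reg, eval_one, eval_two]; omega
  have hb : countB.eval s = b := by
    simp only [countB, eval_div, eval_sub, eval_reg, eval_one, eval_two]; omega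
  have hc : countC.eval s = c := by
    simp only [countC, eval_div, eval_sub, eval_add, eval_reg, eval_one, eval_two]; omega
  have hd : countD.eval s = d := by
    simp only [countD, eval_div, eval_sub, eval_reg, eval_one, eval_two]; omega
  refine ⟨?_, ?_, ?_, ?_, ?_, ?_⟩
  · rw [chosen, eval_choiceExpr, ha, hb, hc, hd]
  · rw [rotA, eval_rotSelectExpr, ha, hb, hc, hd]
  · rw [rotB, eval_rotSelectExpr, ha, hb, hc, hd]
  · rw [rotC, eval_rotSelectExpr, ha, hb, hc, hd]
  · rw [rotD, eval_rotSelectExpr, ha, hb, hc, hd]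
  · rw [origin, eval_rotSelectExpr]
    congr 1 <;> simp only [eval_add, eval_reg, eval_one] <;> omega

end PolygonProgram

/-! ### The main theorem -/

/-- A scan for the separators of the stairs followed by the output of an optimal polygon. -/
def optimalPolygonProgram (obj : Objective) : RamProg :=
  RamProg.seq scanProgram (PolygonProgram.writeProgram obj)

theorem IsXYMonotoneSeq.exists_optimal (obj : Objective) {n : ℕ} [NeZero n] {S : Fin n → Turn}
    (hS : IsXYMonotoneSeq S) {s s' : RamState} {p a b c d : ℕ} (h : StairsFrom S (p + 1) a b c d)
    (h0 : s.reg 0 = n) (h1 : s.reg 1 = p) (h2 : s.reg 2 = p + 2 * d + 1)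
    (h3 : s.reg 3 = p + 2 * d + 2 * a + 2) (h4 : s.reg 4 = p + 2 * d + 2 * a + 2 * b + 3)
    (hs' : ∀ u k : ℕ, k < n → (u : ℤ) = ((PolygonProgram.origin obj).eval s + k) % n →
        s'.mem (n + 2 * u) =
          (PolygonProgram.coordX obj).eval ⟨Function.update s.reg 6 k, s.mem⟩ ∧
        s'.mem (n + 2 * u + 1) =
          (PolygonProgram.coordY obj).eval ⟨Function.update s.reg 6 k, s.mem⟩) :
    (polygonOutput n s').Realizes S ∧ obj.value (polygonOutput n s') = obj.optimum a b c d := by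
  obtain ⟨Q, hQ, -⟩ := hS
  obtain ⟨e1, e2, e3, e4, e5, e6⟩ :=
    PolygonProgram.eval_of_separators obj h.1 h0 h1 h2 h3 h4
  refine h.realizes obj hQ e1 e2 e3 e4 e5 e6 fun u k hk hu => ?_
  obtain ⟨g1, g2⟩ := hs' u k hk hu
  obtain ⟨i1, i2, i3, i4, i5, -⟩ := PolygonProgram.eval_eq obj
    (s := ⟨Function.update s.reg 6 k, s.mem⟩) (s' := s) fun r hr => Function.update_of_ne (by omega) _ _
  rw [PolygonProgram.eval_coordX, i1, i2, i3, i4, i5] at g1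
  rw [PolygonProgram.eval_coordY, i1, i2, i3, i4, i5] at g2
  simp only [Function.update_self] at g1 g2
  exact Prod.ext g1 g2

/-- The optimum is attained. -/
theorem StairsFrom.exists_value_eq_optimum (obj : Objective) {n : ℕ} [NeZero n] {S : Fin n → Turn}
    {Q : GridCycle n} (hQ : Q.Realizes S) {o a b c d : ℕ} (h : StairsFrom S o a b c d) :
    ∃ P : GridCycle n, P.Realizes S ∧ obj.value P = obj.optimum a b c d := by
  obtain ⟨s, hs⟩ : ∃ s, s = obj.choice a b c d := ⟨_, rfl⟩
  obtain ⟨A, hA⟩ : ∃ A, A = rotSelect s a b c d := ⟨_, rfl⟩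
  obtain ⟨B, hB⟩ : ∃ B, B = rotSelect s b c d a := ⟨_, rfl⟩
  obtain ⟨C, hC⟩ : ∃ C, C = rotSelect s c d a b := ⟨_, rfl⟩
  obtain ⟨D, hD⟩ : ∃ D, D = rotSelect s d a b c := ⟨_, rfl⟩
  obtain ⟨O, hO⟩ : ∃ O, O = rotSelect s o (o + 2 * d + 1) (o + 2 * d + 2 * a + 2)
    (o + 2 * d + 2 * a + 2 * b + 3) := ⟨_, rfl⟩
  refine ⟨fun u => ((choiceParams s A B C D).xCoord A B C D ((u - O) % n),
    (choiceParams s A B C D).yCoord A B D ((u - O) % n)),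
    h.realizes obj hQ hs hA hB hC hD hO fun u k hk hu => ?_⟩
  have : ((u : ℤ) - O) % n = k := by
    rw [hu, Int.emod_sub_emod, add_sub_cancel_left, Int.emod_eq_of_lt (by omega) (by omega)]
  simp only [this]

theorem mainTheorem3 (obj : Objective) :
    (∃ (prog : RamProg) (C k : ℕ), ∀ (n : ℕ) (S : Fin n → Turn), IsXYMonotoneSeq S →
      ∃ (t : ℕ) (s : RamState),
        RamRun ((n : ℤ) ^ k) prog (seqInput S) t s ∧ t ≤ C * n ∧
        (polygonOutput n s).Realizes S ∧
        ∀ Q : GridCycle n, Q.Realizes S → obj.value (polygonOutput n s) ≤ obj.value Q) ∧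
    (∃ (prog : RamProg) (C k : ℕ), ∀ (n : ℕ) (S : Fin n → Turn), IsXYMonotoneSeq S →
      ∀ tl bl br tr : ℕ, HasStairCounts S tl bl br tr →
      ∃ (t : ℕ) (s : RamState),
        RamRun ((n : ℤ) ^ k) prog (countsInput tl bl br tr) t s ∧ t ≤ C ∧
        IsLeast {v : ℤ | ∃ Q : GridCycle n, Q.Realizes S ∧ obj.value Q = v} (s.reg 0)) := by
  constructor
  · obtain ⟨c₁, hc₁⟩ : ∃ c₁, c₁ = scanStep.time := ⟨_, rfl⟩
    obtain ⟨c₂, hc₂⟩ : ∃ c₂, c₂ = (PolygonProgram.writeStep obj).time := ⟨_, rfl⟩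
    obtain ⟨k₁, hk₁⟩ : ∃ k₁, k₁ = (scanStep.constMax + 1) * (scanStep.degree + 4) := ⟨_, rfl⟩
    obtain ⟨k₂, hk₂⟩ : ∃ k₂, k₂ = PolygonProgram.memDegree obj *
      ((PolygonProgram.writeStep obj).degree + 3) := ⟨_, rfl⟩
    -- Each of the two loops spends `4` steps per iteration besides its body. The initial store and
    -- the two final tests take `12` steps, which is at most `12 * n`.
    refine ⟨optimalPolygonProgram obj, c₁ + c₂ + 20, k₁ + k₂, fun n S hS => ?_⟩
    obtain ⟨P, hP, hxy⟩ := hS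
    have : NeZero n := ⟨by have := hP.simple.three_le; omega⟩
    obtain ⟨o, a, b, c, d, h⟩ := hP.exists_stairsFrom hxy
    obtain ⟨p, a, b, c, d, h, hp⟩ := h.exists_first
    have hn := h.1
    obtain ⟨s, hr, hb, h0, h1, h2, h3, h4, h6⟩ := run_scanProgram h hp
    obtain ⟨s', hr', hs'⟩ := PolygonProgram.run_writeProgram obj (by omega) hb h0 h6
    obtain ⟨g1, g2⟩ := IsXYMonotoneSeq.exists_optimal obj ⟨P, hP, hxy⟩ h h0 h1 h2 h3 h4 hs'
    rw [← hc₁, ← hk₁] at hr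
    rw [← hc₂, ← hk₂] at hr'
    have hpow : ∀ {j}, j ≤ k₁ + k₂ → (n : ℤ) ^ j ≤ n ^ (k₁ + k₂) := fun hj =>
      pow_le_pow_right₀ (by omega) hj
    refine ⟨_, s', .seq _ _ _ _ _ _ _ (hr.mono (hpow (by omega))) (hr'.mono (hpow (by omega))), ?_,
      g1, fun Q hQ => ?_⟩
    · have : 12 ≤ 12 * n := by omega
      linarith
    · rw [g2]
      exact GridCycle.Realizes.optimum_le obj hQ h
  · refine ⟨optimumProgram obj, (optimumProgram obj).time,
      ((optimumProgram obj).constMax + 1) * (optimumProgram obj).degree,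
      fun n S hS tl bl br tr hc => ?_⟩
    obtain ⟨P, hP, -⟩ := hS
    have : NeZero n := ⟨by have := hP.simple.three_le; omega⟩
    obtain ⟨o, h⟩ := hc.exists_stairsFrom
    obtain ⟨s, hr, hs⟩ := run_optimumProgram obj h.1
    refine ⟨_, s, hr, le_rfl, ?_⟩
    rw [hs]
    refine ⟨h.exists_value_eq_optimum obj hP, ?_⟩
    rintro v ⟨Q, hQ, rfl⟩
    exact GridCycle.Realizes.optimum_le obj hQ h
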